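/- **Definitions.** Fix a vocabulary $V$ and a set of symbols $B$ with a sentence symbol $s\in B$. A *dependency grammar* $G$ (Gaifman) consists of a set of rules of three shapes: (I) $(x,\,y_1\dots y_l\star y_{l+1}\dots y_n)$ with $x,y_i\in B$; (II) $(w,x)$ with $w\in V$, $x\in B$; (III) $(x,s)$ with $x\in B$. In a rule of type I both lists of symbols are written in the order of the string. A *dependency structure* of $G$ on a string $u=w_1\dots w_n\in V^*$ consists of symbols $x_1,\dots,x_n\in B$ and a relation $d$ on the positions $\{1,\dots,n\}$ ($(i,j)\in d$ meaning that $i$ depends on $j$) such that 1. $(w_i,x_i)\in G$ for all $i$; 2. $(i,i)$ is never in the transitive closure of $d$; 3. if $(i,j),(i,k)\in d$ then $j=k$; 4. if $j$ lies between $i$ and $k$ (that is, $i\le j\le k$ or $k\le j\le i$) and $(i,k)\in RTC(d)$, then $(j,k)\in RTC(d)$, where $RTC$ is the reflexive transitive closure; 5. there is exactly one position $h$ with $(h,j)\notin d$ for all $j$, and $(x_h,s)\in G$; 6. for every $i$, if $y_1\dots y_l$ are the symbols at the positions left of $i$ that depend on $i$, and $y_{l+1}\dots y_m$ those at the positions right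 of $i$ that depend on $i$, in the order of the string, then $(x_i,\,y_1\dots y_l\star y_{l+1}\dots y_m)\in G$. A *pregroup grammar* consists of a vocabulary $V$, a set $B'$ of basic types, a lexicon $\Delta\subseteq V\times P(B')$, where $P(B')$ is the set of types generated from $B'$ by the unit, $\otimes$, $(-)^l$ and $(-)^r$, a set $I\subseteq B'\times B'$ of induced steps, and $s'\in B'$. Its reductions of $u$ are the morphisms $u\to s'$ in the free rigid category $\mathbf{RC}(\Delta+I)$ on the basic types $B'+V$ with a generator $w\to t$ for each $(w,t)\in\Delta$ and a generator $x\to x'$ for each $(x,x')\in I$. It is *operadic* if every lexical entry has the form $(w,\,y^r x\,z^l)$ with $x\in B'$ and $y,z\in B'^*$, where $(y_1\dots y_l)^r=y_l^r\dots y_1^r$ and $(z_1\dots z_m)^l=z_m^l\dots z_1^l$. For $s'\in B'\supseteq B$ let $\tilde G_{s'}$ be the pregroup grammar with basic types $B'$, lexicon $\{(w,\,y^r x\,z^l) : (w,x)\in G,\ (x,\,y\star z)\in G\}$, induced steps $\{(x,s') : (x,s)\in G\}$ and sentence type $s'$. Let $C_{s'}$ be the context-free grammar with nonterminals $B'$,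 terminals $V$, start symbol $s'$, rules $x\to y\,w\,z$ for $(w,x)\in G$ and $(x,\,y\star z)\in G$, and rules $s'\to x$ for $(x,s)\in G$. A *dependency tree* of $u$ is an ordered tree whose nodes are labelled by a word $w$ and a symbol $x$ with $(w,x)\in G$, in which the children of a node are divided into left and right children whose symbols form lists $y$, $z$ with $(x,\,y\star z)\in G$, whose root has a symbol $x$ with $(x,s)\in G$, and whose words, read in infix order (left subtrees, node, right subtrees), form $u$. A dependency tree determines symbols and a dependency relation on the positions of $u$ (child depends on parent), a derivation tree of $u$ in $C_{s'}$, and a reduction $u\to s'$ of $\tilde G_{s'}$: replace each word by its lexical entry $y^r x\,z^l$, connect the types of its children with $y^r$ and $z^l$ by cups, and apply the induced step $x\to s'$ at the root. Say that $G$ is *structurally equivalent* to $\tilde G_{s'}$ and $C_{s'}$ if for every $u\in V^*$ the following holds. Each dependency structure of $G$ on $u$ is determined by exactly one dependency tree of $u$, and each dependency tree of $u$ determines a dependency structure. There are bijections between the set of dependency structures of $G$ on $u$, the set of reductions $u\to s'$ of $\tilde G_{s'}$ in $\mathbf{RC}(\tilde G_{s'})$, and the set of derivation trees of $u$ in $C_{s'}$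 from $s'$, under which structures determined by the same dependency tree correspond. **Theorem.** Every dependency grammar $G$ is structurally equivalent to both a pregroup grammar and a context-free grammar. More precisely: (a) For every $G$, with $B'=B\sqcup\{s'\}$ and $s'$ a new sentence symbol, $G$ is structurally equivalent to $\tilde G_{s'}$ and $C_{s'}$. (b) If the sentence symbol $s$ occurs in no rule of type I of $G$ and $(s,s)\notin G$, then with $B'=B$ and $s'=s$, $G$ is structurally equivalent to $\tilde G=\tilde G_s$ and $C=C_s$. In both cases the pregroup grammar is operadic; its sets of basic types and of induced steps are finite if $B$ is finite; and its lexicon and the set of rules of the context-free grammar are finite if $G$ has finitely many rules. -/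

import Mathlib

open CategoryTheory

universe u v

/-! ### Free rigid categories -/

/-- Pregroup types over a set `A` of basic types: `t ::= a | 1 | t ⊗ t | tˡ | tʳ`. -/
inductive PregroupType (A : Type u) : Type u
  | of : A → PregroupType A
  | unit : PregroupType A
  | tensor : PregroupType A → PregroupType A → PregroupType A
  | left : PregroupType A → PregroupType A
  | right : PregroupType A → PregroupType A

namespace PregroupType

variable {A : Type u} {A' : Type v}

/-- Renaming of basic types. -/
def map (f : A → A') : PregroupType A → PregroupType A'
  | of a => of (f a)
  | unit => unit
  | tensor s t => tensor (map f s) (map f t)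
  | left t => left (map f t)
  | right t => right (map f t)

/-- `a₁ … aₙ` as a type. -/
def ofList : List A → PregroupType A
  | [] => unit
  | a :: l => tensor (of a) (ofList l)

/-- `(a₁ … aₙ)ʳ = aₙʳ … a₁ʳ`. -/
def rightList : List A → PregroupType A
  | [] => unit
  | a :: l => tensor (rightList l) (right (of a))

/-- `(a₁ … aₙ)ˡ = aₙˡ … a₁ˡ`. -/
def leftList : List A → PregroupType A
  | [] => unit
  | a :: l => tensor (leftList l) (left (of a))

/-- The type `yʳ x zˡ` of a word of type `x` that takes the arguments `y` on its left and `z` on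
its right, both listed from left to right. -/
def operadic (y : List A) (x : A) (z : List A) : PregroupType A :=
  tensor (rightList y) (tensor (of x) (leftList z))

end PregroupType

/-- A rigid signature on the set `A` of basic types: a graph whose vertices are pregroup types. -/
structure RigidSignature (A : Type u) where
  Gen : Type v
  dom : Gen → PregroupType A
  cod : Gen → PregroupType A

namespace RigidSignature

variable {A : Type u}

/-- Formal morphisms: composites and tensor products of generators, structural isomorphisms,
cups `aˡ ⊗ a → 1`, `a ⊗ aʳ → 1` and caps `1 → a ⊗ aˡ`, `1 → aʳ ⊗ a`. -/
inductive Term (S : RigidSignature.{u, v} A) :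
    PregroupType A → PregroupType A → Type (max u v)
  | gen (g : S.Gen) : Term S (S.dom g) (S.cod g)
  | id (X) : Term S X X
  | comp {X Y Z} (f : Term S X Y) (g : Term S Y Z) : Term S X Z
  | tensor {X Y X' Y'} (f : Term S X Y) (g : Term S X' Y') : Term S (.tensor X X') (.tensor Y Y')
  | assocHom (X Y Z) : Term S (.tensor (.tensor X Y) Z) (.tensor X (.tensor Y Z))
  | assocInv (X Y Z) : Term S (.tensor X (.tensor Y Z)) (.tensor (.tensor X Y) Z)
  | leftUnitHom (X) : Term S (.tensor .unit X) X
  | leftUnitInv (X) : Term S X (.tensor .unit X)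
  | rightUnitHom (X) : Term S (.tensor X .unit) X
  | rightUnitInv (X) : Term S X (.tensor X .unit)
  | cupLeft (X) : Term S (.tensor (.left X) X) .unit
  | capLeft (X) : Term S .unit (.tensor X (.left X))
  | cupRight (X) : Term S (.tensor X (.right X)) .unit
  | capRight (X) : Term S .unit (.tensor (.right X) X)

/-- The congruence on formal morphisms generated by the axioms of a monoidal category and the four
snake equations. -/
inductive TermEq (S : RigidSignature.{u, v} A) :
    ∀ {X Y : PregroupType A}, Term S X Y → Term S X Y → Prop
  | refl {X Y} (f : Term S X Y) : TermEq S f f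
  | symm {X Y} {f g : Term S X Y} : TermEq S f g → TermEq S g f
  | trans {X Y} {f g h : Term S X Y} : TermEq S f g → TermEq S g h → TermEq S f h
  | comp {X Y Z} {f f' : Term S X Y} {g g' : Term S Y Z} :
      TermEq S f f' → TermEq S g g' → TermEq S (.comp f g) (.comp f' g')
  | tensor {X Y X' Y'} {f f' : Term S X Y} {g g' : Term S X' Y'} :
      TermEq S f f' → TermEq S g g' → TermEq S (.tensor f g) (.tensor f' g')
  | id_comp {X Y} (f : Term S X Y) : TermEq S (.comp (.id X) f) f
  | comp_id {X Y} (f : Term S X Y) : TermEq S (.comp f (.id Y)) f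
  | assoc {W X Y Z} (f : Term S W X) (g : Term S X Y) (h : Term S Y Z) :
      TermEq S (.comp (.comp f g) h) (.comp f (.comp g h))
  | tensor_id (X Y) : TermEq S (.tensor (.id X) (.id Y)) (.id (.tensor X Y))
  | tensor_comp {X Y Z X' Y' Z'} (f : Term S X Y) (f' : Term S X' Y') (g : Term S Y Z)
      (g' : Term S Y' Z') :
      TermEq S (.comp (.tensor f f') (.tensor g g')) (.tensor (.comp f g) (.comp f' g'))
  | assoc_hom_inv (X Y Z) : TermEq S (.comp (.assocHom X Y Z) (.assocInv X Y Z)) (.id _)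
  | assoc_inv_hom (X Y Z) : TermEq S (.comp (.assocInv X Y Z) (.assocHom X Y Z)) (.id _)
  | assoc_naturality {X₁ X₂ X₃ Y₁ Y₂ Y₃} (f₁ : Term S X₁ Y₁) (f₂ : Term S X₂ Y₂)
      (f₃ : Term S X₃ Y₃) :
      TermEq S (.comp (.tensor (.tensor f₁ f₂) f₃) (.assocHom Y₁ Y₂ Y₃))
        (.comp (.assocHom X₁ X₂ X₃) (.tensor f₁ (.tensor f₂ f₃)))
  | left_hom_inv (X) : TermEq S (.comp (.leftUnitHom X) (.leftUnitInv X)) (.id _)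
  | left_inv_hom (X) : TermEq S (.comp (.leftUnitInv X) (.leftUnitHom X)) (.id _)
  | left_naturality {X Y} (f : Term S X Y) :
      TermEq S (.comp (.tensor (.id .unit) f) (.leftUnitHom Y)) (.comp (.leftUnitHom X) f)
  | right_hom_inv (X) : TermEq S (.comp (.rightUnitHom X) (.rightUnitInv X)) (.id _)
  | right_inv_hom (X) : TermEq S (.comp (.rightUnitInv X) (.rightUnitHom X)) (.id _)
  | right_naturality {X Y} (f : Term S X Y) :
      TermEq S (.comp (.tensor f (.id .unit)) (.rightUnitHom Y)) (.comp (.rightUnitHom X) f)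
  | pentagon (W X Y Z) :
      TermEq S
        (.comp (.tensor (.assocHom W X Y) (.id Z))
          (.comp (.assocHom W (.tensor X Y) Z) (.tensor (.id W) (.assocHom X Y Z))))
        (.comp (.assocHom (.tensor W X) Y Z) (.assocHom W X (.tensor Y Z)))
  | triangle (X Y) :
      TermEq S (.comp (.assocHom X .unit Y) (.tensor (.id X) (.leftUnitHom Y)))
        (.tensor (.rightUnitHom X) (.id Y))
  | snake_left (X) :
      TermEq S
        (.comp (.tensor (.capLeft X) (.id X))
          (.comp (.assocHom X (.left X) X) (.tensor (.id X) (.cupLeft X))))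
        (.comp (.leftUnitHom X) (.rightUnitInv X))
  | snake_left' (X) :
      TermEq S
        (.comp (.tensor (.id (.left X)) (.capLeft X))
          (.comp (.assocInv (.left X) X (.left X)) (.tensor (.cupLeft X) (.id (.left X)))))
        (.comp (.rightUnitHom (.left X)) (.leftUnitInv (.left X)))
  | snake_right (X) :
      TermEq S
        (.comp (.tensor (.id X) (.capRight X))
          (.comp (.assocInv X (.right X) X) (.tensor (.cupRight X) (.id X))))
        (.comp (.rightUnitHom X) (.leftUnitInv X))
  | snake_right' (X) :
      TermEq S
        (.comp (.tensor (.capRight X) (.id (.right X)))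
          (.comp (.assocHom (.right X) X (.right X)) (.tensor (.id (.right X)) (.cupRight X))))
        (.comp (.leftUnitHom (.right X)) (.rightUnitInv (.right X)))

instance termSetoid (S : RigidSignature.{u, v} A) (X Y : PregroupType A) : Setoid (Term S X Y) :=
  ⟨TermEq S, TermEq.refl, TermEq.symm, TermEq.trans⟩

/-- The morphisms of the free rigid category. -/
def Hom (S : RigidSignature.{u, v} A) (X Y : PregroupType A) : Type (max u v) :=
  Quotient (termSetoid S X Y)

namespace Hom

variable {S : RigidSignature.{u, v} A}

/-- The class of a formal morphism. -/
def mk {X Y : PregroupType A} (f : Term S X Y) : Hom S X Y := Quotient.mk (termSetoid S X Y) f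

theorem sound {X Y : PregroupType A} {f g : Term S X Y} (h : TermEq S f g) : mk f = mk g :=
  Quotient.sound h

/-- Composition. -/
def comp {X Y Z : PregroupType A} : Hom S X Y → Hom S Y Z → Hom S X Z :=
  Quotient.map₂ Term.comp (fun _ _ hf _ _ hg => TermEq.comp hf hg)

/-- Tensor product. -/
def tensor {X Y X' Y' : PregroupType A} :
    Hom S X Y → Hom S X' Y' → Hom S (.tensor X X') (.tensor Y Y') :=
  Quotient.map₂ Term.tensor (fun _ _ hf _ _ hg => TermEq.tensor hf hg)

end Hom

/-- The objects of the free rigid category on `S`. -/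
def FreeRigid (_ : RigidSignature.{u, v} A) : Type u := PregroupType A

instance freeRigidCategory (S : RigidSignature.{u, v} A) : Category.{max u v} (FreeRigid S) where
  Hom X Y := Hom S X Y
  id X := Hom.mk (Term.id X)
  comp f g := Hom.comp f g
  id_comp := by rintro X Y ⟨f⟩; exact Hom.sound (TermEq.id_comp f)
  comp_id := by rintro X Y ⟨f⟩; exact Hom.sound (TermEq.comp_id f)
  assoc := by rintro W X Y Z ⟨f⟩ ⟨g⟩ ⟨h⟩; exact Hom.sound (TermEq.assoc f g h)

instance freeRigidMonoidal (S : RigidSignature.{u, v} A) : MonoidalCategory (FreeRigid S) where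
  tensorObj X Y := PregroupType.tensor X Y
  tensorUnit := PregroupType.unit
  tensorHom f g := Hom.tensor f g
  whiskerLeft X _ _ f := Hom.tensor (Hom.mk (Term.id X)) f
  whiskerRight f Y := Hom.tensor f (Hom.mk (Term.id Y))
  associator X Y Z := ⟨Hom.mk (Term.assocHom X Y Z), Hom.mk (Term.assocInv X Y Z),
    Hom.sound (TermEq.assoc_hom_inv X Y Z), Hom.sound (TermEq.assoc_inv_hom X Y Z)⟩
  leftUnitor X := ⟨Hom.mk (Term.leftUnitHom X), Hom.mk (Term.leftUnitInv X),
    Hom.sound (TermEq.left_hom_inv X), Hom.sound (TermEq.left_inv_hom X)⟩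
  rightUnitor X := ⟨Hom.mk (Term.rightUnitHom X), Hom.mk (Term.rightUnitInv X),
    Hom.sound (TermEq.right_hom_inv X), Hom.sound (TermEq.right_inv_hom X)⟩
  tensorHom_def := by
    rintro X₁ Y₁ X₂ Y₂ ⟨f⟩ ⟨g⟩
    exact Hom.sound (TermEq.symm ((TermEq.tensor_comp _ _ _ _).trans
      (TermEq.tensor (TermEq.comp_id f) (TermEq.id_comp g))))
  id_tensorHom_id X Y := Hom.sound (TermEq.tensor_id X Y)
  tensorHom_comp_tensorHom := by
    rintro X₁ Y₁ Z₁ X₂ Y₂ Z₂ ⟨f₁⟩ ⟨f₂⟩ ⟨g₁⟩ ⟨g₂⟩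
    exact Hom.sound (TermEq.tensor_comp f₁ f₂ g₁ g₂)
  whiskerLeft_id X Y := Hom.sound (TermEq.tensor_id X Y)
  id_whiskerRight X Y := Hom.sound (TermEq.tensor_id X Y)
  associator_naturality := by
    rintro X₁ X₂ X₃ Y₁ Y₂ Y₃ ⟨f₁⟩ ⟨f₂⟩ ⟨f₃⟩
    exact Hom.sound (TermEq.assoc_naturality f₁ f₂ f₃)
  leftUnitor_naturality := by
    rintro X Y ⟨f⟩
    exact Hom.sound (TermEq.left_naturality f)
  rightUnitor_naturality := by
    rintro X Y ⟨f⟩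
    exact Hom.sound (TermEq.right_naturality f)
  pentagon W X Y Z := Hom.sound (TermEq.pentagon W X Y Z)
  triangle X Y := Hom.sound (TermEq.triangle X Y)

/-- The left adjoint `aˡ` is what Mathlib calls the right dual of `a`: there are maps `1 → a ⊗ aˡ`
and `aˡ ⊗ a → 1`. Likewise `aʳ` is what Mathlib calls the left dual. -/
instance freeRigidRigid (S : RigidSignature.{u, v} A) : RigidCategory (FreeRigid S) where
  rightDual X :=
    { rightDual := PregroupType.left X
      exact :=
        { coevaluation' := Hom.mk (Term.capLeft X)
          evaluation' := Hom.mk (Term.cupLeft X)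
          coevaluation_evaluation' := Hom.sound (TermEq.snake_left' X)
          evaluation_coevaluation' := Hom.sound (TermEq.snake_left X) } }
  leftDual X :=
    { leftDual := PregroupType.right X
      exact :=
        { coevaluation' := Hom.mk (Term.capRight X)
          evaluation' := Hom.mk (Term.cupRight X)
          coevaluation_evaluation' := Hom.sound (TermEq.snake_right X)
          evaluation_coevaluation' := Hom.sound (TermEq.snake_right' X) } }

end RigidSignature

/-! ### Pregroup grammars -/

/-- A pregroup grammar with vocabulary `V` and basic types `B`. -/
structure PregroupGrammar (V : Type u) (B : Type v) where
  lexicon : Set (V × PregroupType B)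
  induced : Set (B × B)
  start : B

namespace PregroupGrammar

variable {V : Type u} {B : Type v} (P : PregroupGrammar V B)

/-- Finitely many basic types and finitely many induced steps. -/
def IsFinite : Prop := Finite B ∧ P.induced.Finite

/-- Every lexical entry has the form `(w, yʳ x zˡ)` with `x ∈ B` and `y, z ∈ B*`. -/
def IsOperadic : Prop :=
  ∀ w t, (w, t) ∈ P.lexicon → ∃ (y : List B) (x : B) (z : List B), t = .operadic y x z

/-- The rigid signature on the basic types `B + V` with one generator `w → t` for each lexical
entry `(w, t)` and one generator `x → x'` for each induced step `(x, x')`. -/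
def signature : RigidSignature.{max u v, max u v} (B ⊕ V) where
  Gen := P.lexicon ⊕ P.induced
  dom
    | .inl e => .of (.inr e.1.1)
    | .inr e => .of (.inl e.1.1)
  cod
    | .inl e => e.1.2.map .inl
    | .inr e => .of (.inl e.1.2)

/-- The free rigid category generated by the lexicon and the induced steps. -/
abbrev RC : Type (max u v) := P.signature.FreeRigid

/-- A pregroup type over `B` as an object. -/
abbrev ob (t : PregroupType B) : PregroupType (B ⊕ V) := t.map Sum.inl

/-- A string of words as an object. -/
abbrev words (u : List V) : PregroupType (B ⊕ V) := PregroupType.ofList (u.map Sum.inr)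

/-- The reductions `u → s` of a string `u`: the morphisms in the free rigid category. -/
def Reduction (u : List V) : Type (max u v) :=
  Quiver.Hom (V := P.RC) (words u) (ob (.of P.start))

/-- Formal morphisms in the free rigid category. -/
abbrev Tm (X Y : PregroupType (B ⊕ V)) : Type (max u v) := RigidSignature.Term P.signature X Y

/-- The generator of a lexical entry. -/
def lex (w : V) (t : PregroupType B) (h : (w, t) ∈ P.lexicon) : P.Tm (.of (Sum.inr w)) (ob t) :=
  RigidSignature.Term.gen (S := P.signature) (Sum.inl ⟨(w, t), h⟩)

/-- The generator of an induced step. -/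
def step (x x' : B) (h : (x, x') ∈ P.induced) : P.Tm (ob (.of x)) (ob (.of x')) :=
  RigidSignature.Term.gen (S := P.signature) (Sum.inr ⟨(x, x'), h⟩)

/-- The nested cups `y₁ … yₙ ⊗ yₙʳ … y₁ʳ → 1`. -/
def cupsR : ∀ y : List B, P.Tm (.tensor (ob (.ofList y)) (ob (.rightList y))) .unit
  | [] => .leftUnitHom .unit
  | b :: y =>
    .comp (.assocHom (ob (.of b)) (ob (.ofList y)) (ob (.rightList (b :: y))))
      (.comp
        (.tensor (.id (ob (.of b)))
          (.comp (.assocInv (ob (.ofList y)) (ob (.rightList y)) (ob (.right (.of b))))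
            (.comp (.tensor (cupsR y) (.id (ob (.right (.of b)))))
              (.leftUnitHom (ob (.right (.of b)))))))
        (.cupRight (ob (.of b))))

/-- The nested cups `zₙˡ … z₁ˡ ⊗ z₁ … zₙ → 1`. -/
def cupsL : ∀ z : List B, P.Tm (.tensor (ob (.leftList z)) (ob (.ofList z))) .unit
  | [] => .leftUnitHom .unit
  | b :: z =>
    .comp (.assocHom (ob (.leftList z)) (ob (.left (.of b))) (ob (.ofList (b :: z))))
      (.comp
        (.tensor (.id (ob (.leftList z)))
          (.comp (.assocInv (ob (.left (.of b))) (ob (.of b)) (ob (.ofList z)))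
            (.comp (.tensor (.cupLeft (ob (.of b))) (.id (ob (.ofList z))))
              (.leftUnitHom (ob (.ofList z))))))
        (cupsL z))

/-- Links a word of type `yʳ x zˡ` to its arguments by cups: `y ⊗ ((yʳ x zˡ) ⊗ z) → x`. -/
def link (y : List B) (x : B) (z : List B) :
    P.Tm (.tensor (ob (.ofList y)) (.tensor (ob (.operadic y x z)) (ob (.ofList z))))
      (ob (.of x)) :=
  .comp
    (.tensor (.id (ob (.ofList y)))
      (.comp (.assocHom (ob (.rightList y)) (ob (.tensor (.of x) (.leftList z))) (ob (.ofList z)))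
        (.tensor (.id (ob (.rightList y)))
          (.comp (.assocHom (ob (.of x)) (ob (.leftList z)) (ob (.ofList z)))
            (.comp (.tensor (.id (ob (.of x))) (P.cupsL z)) (.rightUnitHom (ob (.of x))))))))
    (.comp (.assocInv (ob (.ofList y)) (ob (.rightList y)) (ob (.of x)))
      (.comp (.tensor (P.cupsR y) (.id (ob (.of x)))) (.leftUnitHom (ob (.of x)))))

/-- The structural isomorphism from a concatenation of strings to their tensor product. -/
def split : ∀ u u' : List V, P.Tm (words (u ++ u')) (.tensor (words u) (words u'))
  | [], u' => .leftUnitInv (words u')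
  | w :: u, u' =>
    .comp (.tensor (.id (.of (Sum.inr w))) (split u u'))
      (.assocInv (.of (Sum.inr w)) (words u) (words u'))

end PregroupGrammar

/-! ### Context-free grammars -/

/-- A context-free grammar with terminals `V` and nonterminals `N`. Its set of rules may be
infinite. -/
structure CFG (V : Type u) (N : Type v) where
  rules : Set (ContextFreeRule V N)
  start : N

namespace CFG

variable {V : Type u} {N : Type v}

/-- `C.Forest [a₁, …, aₙ]` is the type of lists of `n` derivation trees (ordered, with leaves
labelled by terminals), with roots labelled `a₁, …, aₙ`. -/
inductive Forest (C : CFG V N) : List (Symbol V N) → Type (max u v)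
  | nil : Forest C []
  | leaf (w : V) {α : List (Symbol V N)} (rest : Forest C α) : Forest C (.terminal w :: α)
  | node (r : ContextFreeRule V N) (hr : r ∈ C.rules) (children : Forest C r.output)
      {α : List (Symbol V N)} (rest : Forest C α) : Forest C (.nonterminal r.input :: α)

namespace Forest

/-- The string of leaves. -/
def yield {C : CFG V N} : ∀ {α : List (Symbol V N)}, C.Forest α → List V
  | _, .nil => []
  | _, .leaf w rest => w :: rest.yield
  | _, .node _ _ children rest => children.yield ++ rest.yield

/-- Juxtaposition of forests. -/
def append {C : CFG V N} {β : List (Symbol V N)} (g : C.Forest β) :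
    ∀ {α : List (Symbol V N)}, C.Forest α → C.Forest (α ++ β)
  | _, .nil => g
  | _, .leaf w rest => .leaf w (append g rest)
  | _, .node r hr children rest => .node r hr children (append g rest)

theorem yield_append {C : CFG V N} {β : List (Symbol V N)} (g : C.Forest β)
    {α : List (Symbol V N)} (f : C.Forest α) : (append g f).yield = f.yield ++ g.yield := by
  induction f with
  | nil => rfl
  | leaf w rest ih => simp [append, yield, ih]
  | node r hr children rest _ ih => simp [append, yield, ih]

end Forest

/-- The derivation trees of a string `u` from the start symbol. -/
def Derivation (C : CFG V N) (u : List V) : Type (max u v) :=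
  {t : C.Forest [.nonterminal C.start] // t.yield = u}

end CFG

/-! ### Dependency grammars -/

/-- A dependency grammar in the sense of Gaifman, with vocabulary `V`, symbols `B` and sentence
symbol `start`. The rule `(x, y₁ … y_l ⋆ y_{l+1} … yₙ)` of type I is the triple
`(x, [y₁, …, y_l], [y_{l+1}, …, yₙ])`; both lists are in the order of the string. The rule `(w, x)`
of type II is a pair, and the rule `(x, s)` of type III is given by `x`. -/
structure DependencyGrammar (V : Type u) (B : Type v) where
  typeI : Set (B × List B × List B)
  typeII : Set (V × B)
  typeIII : Set B
  start : B

namespace DependencyGrammar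

variable {V : Type u} {B : Type v}

/-- The sentence symbol occurs in no rule of type I, and does not itself govern a sentence. -/
def StartReserved (G : DependencyGrammar V B) : Prop :=
  (∀ x y z, (x, y, z) ∈ G.typeI → x ≠ G.start ∧ G.start ∉ y ∧ G.start ∉ z) ∧
    G.start ∉ G.typeIII

/-- Finitely many rules. -/
def FiniteRules (G : DependencyGrammar V B) : Prop :=
  G.typeI.Finite ∧ G.typeII.Finite ∧ G.typeIII.Finite

open Classical in
/-- An analysis of the string `u` by `G`: a symbol `type i` for the `i`-th word, and a dependency
relation on the positions of `u`, where `dep i j` says that `i` depends on `j`. -/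
@[ext]
structure Analysis (G : DependencyGrammar V B) (u : List V) where
  type : Fin u.length → B
  dep : Fin u.length → Fin u.length → Prop
  /-- the words have the given types -/
  typed : ∀ i, (u.get i, type i) ∈ G.typeII
  acyclic : ∀ i, ¬ Relation.TransGen dep i i
  /-- every position depends on at most one head -/
  monogamous : ∀ i j k, dep i j → dep i k → j = k
  /-- whatever lies between `k` and a direct or indirect dependent of `k` is also a direct or
  indirect dependent of `k` (or `k` itself) -/
  planar : ∀ i j k, (i ≤ j ∧ j ≤ k) ∨ (k ≤ j ∧ j ≤ i) →
    Relation.ReflTransGen dep i k → Relation.ReflTransGen dep j k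
  /-- there is exactly one position without head, and its symbol governs a sentence -/
  rooted : ∃ h, (∀ k, (∀ j, ¬ dep k j) ↔ k = h) ∧ type h ∈ G.typeIII
  /-- the left and right dependents of each position are allowed by a rule of type I -/
  allowed : ∀ i,
    (type i, ((List.finRange u.length).filter (fun j => j < i ∧ dep j i)).map type,
      ((List.finRange u.length).filter (fun j => i < j ∧ dep j i)).map type) ∈ G.typeI

/-- The pregroup grammar of `G`, whose basic types are those of `G` renamed along `ι`, with sentence
type `s`. Its lexical entries are `(w, yʳ x zˡ)` for the rules `(w, x)` and `(x, y ⋆ z)` of `G`, its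
induced steps are `x → s` for the rules `(x, s)` of `G`. -/
def pregroup (G : DependencyGrammar V B) {B' : Type v} (ι : B → B') (s : B') :
    PregroupGrammar V B' where
  lexicon := {e | ∃ x y z, (e.1, x) ∈ G.typeII ∧ (x, y, z) ∈ G.typeI ∧
    e.2 = .operadic (y.map ι) (ι x) (z.map ι)}
  induced := {e | ∃ x ∈ G.typeIII, e = (ι x, s)}
  start := s

/-- The right-hand side `y w z` of a context-free rule. -/
def rhs {B' : Type v} (ι : B → B') (y : List B) (w : V) (z : List B) : List (Symbol V B') :=
  y.map (fun b => .nonterminal (ι b)) ++ .terminal w :: z.map (fun b => .nonterminal (ι b))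

/-- The context-free grammar of `G`, whose nonterminals are the symbols of `G` renamed along `ι`,
with start symbol `s`. Its rules are `x → y w z` for the rules `(w, x)` and `(x, y ⋆ z)` of `G`, and
`s → x` for the rules `(x, s)` of `G`. -/
def cfg (G : DependencyGrammar V B) {B' : Type v} (ι : B → B') (s : B') : CFG V B' where
  rules := {r | (∃ w x y z, (w, x) ∈ G.typeII ∧ (x, y, z) ∈ G.typeI ∧ r = ⟨ι x, rhs ι y w z⟩) ∨
    ∃ x ∈ G.typeIII, r = ⟨s, [.nonterminal (ι x)]⟩}
  start := s

theorem lexical_mem (G : DependencyGrammar V B) {B' : Type v} (ι : B → B') (s : B') {w : V} {x : B}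
    {y z : List B} (hII : (w, x) ∈ G.typeII) (hI : (x, y, z) ∈ G.typeI) :
    (⟨ι x, rhs ι y w z⟩ : ContextFreeRule V B') ∈ (G.cfg ι s).rules :=
  Or.inl ⟨w, x, y, z, hII, hI, rfl⟩

theorem root_mem (G : DependencyGrammar V B) {B' : Type v} (ι : B → B') (s : B') {x : B}
    (h : x ∈ G.typeIII) :
    (⟨s, [.nonterminal (ι x)]⟩ : ContextFreeRule V B') ∈ (G.cfg ι s).rules :=
  Or.inr ⟨x, h, rfl⟩

/-- `G.Forest [x₁, …, xₙ]` is the type of lists of `n` dependency trees whose roots are words of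
types `x₁, …, xₙ`. A dependency tree consists of a word `w` of type `x` and of the lists of the
dependency trees of its left and of its right dependents, as allowed by `G`. -/
inductive Forest (G : DependencyGrammar V B) : List B → Type (max u v)
  | nil : Forest G []
  | cons (w : V) (x : B) (y z : List B) (hII : (w, x) ∈ G.typeII) (hI : (x, y, z) ∈ G.typeI)
      (l : Forest G y) (r : Forest G z) {xs : List B} (rest : Forest G xs) : Forest G (x :: xs)

namespace Forest

variable {G : DependencyGrammar V B}

/-- The string of words. -/
def yield : ∀ {xs : List B}, G.Forest xs → List V
  | _, .nil => []
  | _, .cons w _ _ _ _ _ l r rest => l.yield ++ w :: (r.yield ++ rest.yield)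

/-- The types of the words, in the order of the string. -/
def types : ∀ {xs : List B}, G.Forest xs → List B
  | _, .nil => []
  | _, .cons _ x _ _ _ _ l r rest => l.types ++ x :: (r.types ++ rest.types)

/-- The positions of the heads of the words, in the order of the string, where the first word has
position `n` and the roots of the forest have head `h` (`none` if they have no head). -/
def heads : ∀ {xs : List B}, G.Forest xs → ℕ → Option ℕ → List (Option ℕ)
  | _, .nil, _, _ => []
  | _, .cons _ _ _ _ _ _ l r rest, n, h =>
    let p := n + l.yield.length
    l.heads n (some p) ++
      h :: (r.heads (p + 1) (some p) ++ rest.heads (p + 1 + r.yield.length) h)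

/-- The reduction of the string of words to the types of the roots: each word is replaced by a
lexical entry and linked by cups to the roots of the trees of its dependents. -/
def toTerm {B' : Type v} (ι : B → B') (s : B') : ∀ {xs : List B} (f : G.Forest xs),
    (G.pregroup ι s).Tm (PregroupGrammar.words f.yield) (PregroupGrammar.ob (.ofList (xs.map ι)))
  | _, .nil => .id .unit
  | _, .cons (xs := xs) w x y z hII hI l r rest =>
    let P := G.pregroup ι s
    let Y : PregroupType (B' ⊕ V) := PregroupGrammar.ob (.ofList (y.map ι))
    let Z : PregroupType (B' ⊕ V) := PregroupGrammar.ob (.ofList (z.map ι))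
    let Xs : PregroupType (B' ⊕ V) := PregroupGrammar.ob (.ofList (xs.map ι))
    let t : PregroupType B' := .operadic (y.map ι) (ι x) (z.map ι)
    .comp (P.split l.yield (w :: (r.yield ++ rest.yield)))
      (.comp
        (.tensor (l.toTerm ι s)
          (.tensor (P.lex w t ⟨x, y, z, hII, hI, rfl⟩)
            (.comp (P.split r.yield rest.yield) (.tensor (r.toTerm ι s) (rest.toTerm ι s)))))
        (.comp (.tensor (.id Y) (.assocInv (PregroupGrammar.ob t) Z Xs))
          (.comp (.assocInv Y (.tensor (PregroupGrammar.ob t) Z) Xs)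
            (.tensor (P.link (y.map ι) (ι x) (z.map ι)) (.id Xs)))))

/-- The forest as a forest of derivation trees of the context-free grammar. -/
def toCFG {B' : Type v} (ι : B → B') (s : B') : ∀ {xs : List B} (_ : G.Forest xs),
    (G.cfg ι s).Forest (xs.map (fun b => .nonterminal (ι b)))
  | _, .nil => .nil
  | _, .cons w x y z hII hI l r rest =>
    .node ⟨ι x, rhs ι y w z⟩ (G.lexical_mem ι s hII hI)
      (.append (.leaf w (r.toCFG ι s)) (l.toCFG ι s)) (rest.toCFG ι s)

theorem yield_toCFG {B' : Type v} (ι : B → B') (s : B') {xs : List B} (f : G.Forest xs) :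
    (f.toCFG ι s).yield = f.yield := by
  induction f with
  | nil => rfl
  | cons w x y z hII hI l r rest ihl ihr ih =>
    have h := CFG.Forest.yield_append (CFG.Forest.leaf w (r.toCFG ι s)) (l.toCFG ι s)
    refine (congrArg₂ (· ++ ·) h ih).trans ?_
    simp [CFG.Forest.yield, yield, ihl, ihr]

end Forest

/-- A dependency tree of the string `u`, whose root governs a sentence. -/
structure Tree (G : DependencyGrammar V B) (u : List V) where
  root : B
  governs : root ∈ G.typeIII
  forest : G.Forest [root]
  yield_eq : forest.yield = u

namespace Tree

variable {G : DependencyGrammar V B} {u : List V}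

/-- The tree `t` and the analysis `a` have the same types and the same dependencies. -/
def Describes (t : G.Tree u) (a : G.Analysis u) : Prop :=
  (∀ i, t.forest.types[i.val]? = some (a.type i)) ∧
    ∀ i j, a.dep i j ↔ (t.forest.heads 0 none)[i.val]? = some (some j.val)

/-- The pregroup reduction of a dependency tree, whose cups are the edges of the tree. -/
def toReduction {B' : Type v} (ι : B → B') (s : B') (t : G.Tree u) :
    (G.pregroup ι s).Reduction u :=
  t.yield_eq ▸ RigidSignature.Hom.mk
    (.comp (t.forest.toTerm ι s)
      (.comp (.rightUnitHom (PregroupGrammar.ob (.of (ι t.root))))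
        ((G.pregroup ι s).step (ι t.root) s ⟨t.root, t.governs, rfl⟩)))

/-- The derivation tree of a dependency tree. -/
def toDerivation {B' : Type v} (ι : B → B') (s : B') (t : G.Tree u) :
    (G.cfg ι s).Derivation u :=
  ⟨.node ⟨s, [.nonterminal (ι t.root)]⟩ (G.root_mem ι s t.governs) (t.forest.toCFG ι s) .nil,
    by simp [CFG.Forest.yield, Forest.yield_toCFG, t.yield_eq]⟩

end Tree

/-- `G` is structurally equivalent to its pregroup grammar and to its context-free grammar (for
the given renaming of the symbols and sentence symbol): for every string, its analyses by `G`
correspond one-to-one to its reductions and to its derivation trees, where corresponding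
structures come from the same dependency tree. -/
def StructurallyEquivalent (G : DependencyGrammar V B) {B' : Type v} (ι : B → B') (s : B') : Prop :=
  ∀ u : List V,
    ∃ (φ : G.Analysis u ≃ (G.pregroup ι s).Reduction u)
      (ψ : G.Analysis u ≃ (G.cfg ι s).Derivation u),
      (∀ a : G.Analysis u, ∃! t : G.Tree u, t.Describes a) ∧
      (∀ t : G.Tree u, ∃! a : G.Analysis u, t.Describes a) ∧
      ∀ (a : G.Analysis u) (t : G.Tree u), t.Describes a →
        φ a = t.toReduction ι s ∧ ψ a = t.toDerivation ι s

end DependencyGrammar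

/-!
# Dependency grammars, pregroup grammars and context-free grammars

Dependency trees are put in bijection with analyses, with reductions and with derivation trees. The
last two bijections hold whenever the sentence symbol of the target grammars is new (`Fresh`), which
covers both the added sentence symbol and a reserved one.

*Distinct trees have distinct reductions.* The free rigid category is interpreted in sets and
relations. All basic types have the dependency trees as values, adjoint types have the same values,
and a lexical entry relates the word to the triples formed by its left dependents, the resulting
tree and its right dependents. The reduction of a tree then has this tree as its only value
(`toReduction_injective`).

*Every reduction comes from a tree.* A formal morphism may contain arbitrary cups and caps, so that
a normal form is needed. A morphism `X ⟶ Y` is viewed as a transformation from `X ⊗ -` to `Y ⊗ -`,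
and these functors are replaced by composites of the functors of tensoring with iterated adjoints
of basic types. This turns structural isomorphisms into identities and cups and caps into counits
and units (`hat`), and all that matters is that for each basic type these functors form a chain of
adjunctions, and that their composites factor uniquely (`AdjointChains`).

A *state* is a transformation `𝟭 ⟶ F`; the factors of `F` are its *legs*, and the position of a leg
in its chain is its *degree*. The basic reductions, which link a word to its arguments or apply an
induced step, are bent into states, whose legs can be moved around (`State`). A *component* is a
cap to which such boxes are applied (`Grow`), and a state is *good* if it is obtained by inserting
components one after the other (`Good`). Good states are preserved by boxes, caps and cups, hence
by all morphisms (`preserves_hat`). The interesting case is a cup. If it joins two components, then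
one of them, bent down at its leg, grows out of the leg of the other (`Grow.cut_outer`,
`Grow.cut_inner`). It cannot join two legs of one component: from the outermost to the innermost
leg, the degrees of the legs of a component are `e + 1, …, e + 1, e, e - 1, …, e - 1` with `e` even
(`HasShape`), whereas the degrees of the legs joined by a cup increase (`HasShape.not_ascending`).

A reduction `u ⟶ s`, bent into a state, has legs of degree `1` for the words and one leg of degree
`0` for `s`. Since every component has a leg of even degree, it is a single component, which grows
out of the leg of `s` (`grow_of_reduction`). All legs which occur on the way have degree `1`, so
each box is in its original position, and closing the legs by the words builds a dependency tree
from its leaves to its root (`isClosing_grow`, `exists_toReduction_eq`).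

*Derivation trees.* The start symbol is the left-hand side of the rules `s → x` only, and occurs on
no right-hand side. A derivation tree therefore consists of such a rule at the root and of rules
`x → y w z` below it, which is the same as a dependency tree (`toDerivation_bijective`).

*Analyses.* In a tree, the words governed by a given word form an interval (`exists_reaches_iff`),
which gives the planarity of its analysis. Conversely, planarity cuts a string into *blocks*, that
is intervals which consist of whole trees with the same head: the tree of the first word of a block
is an interval, which its root divides into two blocks, those of its left and of its right
dependents (`IsBlock.exists_split`). The tree of an analysis is built from this by induction
(`exists_tree`), and its uniqueness is `Forest.heq_of_heads`.
-/

/-! ### Bending strings along adjunctions of endofunctors -/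

namespace Bending

variable {C : Type u} [Category.{v} C]

/-- `α` applied in the context of an inner functor `N` and an outer functor `M`. -/
abbrev whisker (N : C ⥤ C) {F G : C ⥤ C} (α : F ⟶ G) (M : C ⥤ C) : N ⋙ F ⋙ M ⟶ N ⋙ G ⋙ M :=
  Functor.whiskerLeft N (Functor.whiskerRight α M)

/-- For `F ⊣ G`, a transformation out of `K ⋙ F` is one out of `K`. -/
def curry {F G : C ⥤ C} (adj : F ⊣ G) (K H : C ⥤ C) : (K ⋙ F ⟶ H) ≃ (K ⟶ H ⋙ G) where
  toFun α := Functor.whiskerLeft K adj.unit ≫ Functor.whiskerRight α G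
  invFun s := Functor.whiskerRight s F ≫ Functor.whiskerLeft H adj.counit
  left_inv α := by
    ext Z
    simp
  right_inv s := by
    ext Z
    simp

/-- For `F ⊣ G`, a transformation out of `G ⋙ K` is one out of `K`. -/
def cocurry {F G : C ⥤ C} (adj : F ⊣ G) (K H : C ⥤ C) : (G ⋙ K ⟶ H) ≃ (K ⟶ F ⋙ H) where
  toFun α := Functor.whiskerRight adj.unit K ≫ Functor.whiskerLeft F α
  invFun s := Functor.whiskerLeft G s ≫ Functor.whiskerRight adj.counit H
  left_inv α := by
    ext Z
    have h := α.naturality (adj.counit.app Z)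
    simp only [Functor.comp_obj, Functor.id_obj, Functor.comp_map] at h
    simp [← h, ← K.map_comp_assoc]
  right_inv s := by
    ext Z
    simp [← H.map_comp]

/-- For `F ⊣ G`, the transformation out of the identity obtained from one out of `F` by bending its
domain up into an additional outermost factor `G` of the codomain. -/
def bendL {F G : C ⥤ C} (adj : F ⊣ G) (H : C ⥤ C) : (F ⟶ H) ≃ (𝟭 C ⟶ H ⋙ G) :=
  curry adj (𝟭 C) H

/-- For `F ⊣ G`, the transformation out of the identity obtained from one out of `G` by bending its
domain up into an additional innermost factor `F` of the codomain. -/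
def bendR {F G : C ⥤ C} (adj : F ⊣ G) (H : C ⥤ C) : (G ⟶ H) ≃ (𝟭 C ⟶ F ⋙ H) :=
  cocurry adj (𝟭 C) H

section

variable {F G : C ⥤ C} (adj : F ⊣ G)

@[simp] theorem curry_app (K H : C ⥤ C) (α : K ⋙ F ⟶ H) (Z : C) :
    (curry adj K H α).app Z = adj.unit.app (K.obj Z) ≫ G.map (α.app Z) := rfl

@[simp] theorem curry_symm_app (K H : C ⥤ C) (s : K ⟶ H ⋙ G) (Z : C) :
    ((curry adj K H).symm s).app Z = F.map (s.app Z) ≫ adj.counit.app (H.obj Z) := rfl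

@[simp] theorem cocurry_app (K H : C ⥤ C) (α : G ⋙ K ⟶ H) (Z : C) :
    (cocurry adj K H α).app Z = K.map (adj.unit.app Z) ≫ α.app (F.obj Z) := rfl

@[simp] theorem cocurry_symm_app (K H : C ⥤ C) (s : K ⟶ F ⋙ H) (Z : C) :
    ((cocurry adj K H).symm s).app Z = s.app (G.obj Z) ≫ H.map (adj.counit.app Z) := rfl

@[simp] theorem bendL_app (H : C ⥤ C) (α : F ⟶ H) (Z : C) :
    (bendL adj H α).app Z = adj.unit.app Z ≫ G.map (α.app Z) := rfl

@[simp] theorem bendL_symm_app (H : C ⥤ C) (s : 𝟭 C ⟶ H ⋙ G) (Z : C) :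
    ((bendL adj H).symm s).app Z = F.map (s.app Z) ≫ adj.counit.app (H.obj Z) := rfl

@[simp] theorem bendR_app (H : C ⥤ C) (α : G ⟶ H) (Z : C) :
    (bendR adj H α).app Z = adj.unit.app Z ≫ α.app (F.obj Z) := rfl

@[simp] theorem bendR_symm_app (H : C ⥤ C) (s : 𝟭 C ⟶ F ⋙ H) (Z : C) :
    ((bendR adj H).symm s).app Z = s.app (G.obj Z) ≫ H.map (adj.counit.app Z) := rfl

theorem bendL_id : bendL adj F (𝟙 F) = adj.unit := by
  ext Z; simp

theorem bendR_id : bendR adj G (𝟙 G) = adj.unit := by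
  ext Z; simp

theorem bendL_symm_comp {H H' : C ⥤ C} (s : 𝟭 C ⟶ H ⋙ G) (γ : H ⟶ H') :
    (bendL adj H').symm (s ≫ Functor.whiskerRight γ G) = (bendL adj H).symm s ≫ γ := by
  ext Z
  simp

theorem bendR_symm_comp {H H' : C ⥤ C} (s : 𝟭 C ⟶ F ⋙ H) (γ : H ⟶ H') :
    (bendR adj H').symm (s ≫ Functor.whiskerLeft F γ) = (bendR adj H).symm s ≫ γ := by
  ext Z
  simp

end

/-- Moves the outermost factor of the codomain of a state, that is of a transformation out of the
identity, to the innermost place. -/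
def rotate {F G K : C ⥤ C} (adj : F ⊣ G) (adj' : G ⊣ K) (H : C ⥤ C) :
    (𝟭 C ⟶ H ⋙ K) ≃ (𝟭 C ⟶ F ⋙ H) :=
  (bendL adj' H).symm.trans (bendR adj H)

end Bending

open Bending

/-! ### Chains of adjoint endofunctors -/

/-- `IsWord T l F`: the endofunctor `F` is the composite of the functors `T a n` for the entries
`(a, n)` of `l`, the first entry being the outermost functor. -/
inductive IsWord {A : Type*} {C : Type u} [Category.{v} C] (T : A → ℤ → C ⥤ C) :
    List (A × ℤ) → (C ⥤ C) → Prop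
  | nil : IsWord T [] (𝟭 C)
  | cons (a : A) (n : ℤ) {l : List (A × ℤ)} {F : C ⥤ C} :
      IsWord T l F → IsWord T ((a, n) :: l) (F ⋙ T a n)

/-- For each symbol `a` a chain of adjunctions `⋯ ⊣ T a 0 ⊣ T a 1 ⊣ ⋯` of endofunctors, such that
composites of these functors have unique factorizations. -/
structure AdjointChains (A : Type*) (C : Type u) [Category.{v} C] where
  T : A → ℤ → C ⥤ C
  adj : ∀ a n, T a n ⊣ T a (n + 1)
  unique : ∀ {l l' : List (A × ℤ)} {F : C ⥤ C}, IsWord T l F → IsWord T l' F → l = l'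

namespace IsWord

variable {A : Type*} {C : Type u} [Category.{v} C] {T : A → ℤ → C ⥤ C}

theorem append {m n : List (A × ℤ)} {M N : C ⥤ C} (hm : IsWord T m M) (hn : IsWord T n N) :
    IsWord T (m ++ n) (N ⋙ M) := by
  induction hm with
  | nil => exact hn
  | cons a k _ ih => exact .cons a k ih

theorem single (a : A) (n : ℤ) : IsWord T [(a, n)] (T a n) := .cons a n .nil

theorem eq_of_nil {F : C ⥤ C} (h : IsWord T [] F) : F = 𝟭 C := by
  cases h; rfl

theorem exists_cons {a : A} {k : ℤ} {l : List (A × ℤ)} {F : C ⥤ C} (h : IsWord T ((a, k) :: l) F) :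
    ∃ L, IsWord T l L ∧ F = L ⋙ T a k := by
  cases h with
  | cons _ _ h => exact ⟨_, h, rfl⟩

theorem eq {l : List (A × ℤ)} {F F' : C ⥤ C} (h : IsWord T l F) (h' : IsWord T l F') : F = F' := by
  induction h generalizing F' with
  | nil => exact h'.eq_of_nil.symm
  | cons a k _ ih =>
    obtain ⟨L, hL, rfl⟩ := h'.exists_cons
    rw [ih hL]

theorem exists_append {m n : List (A × ℤ)} {F : C ⥤ C} (h : IsWord T (m ++ n) F) :
    ∃ M N, IsWord T m M ∧ IsWord T n N ∧ F = N ⋙ M := by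
  induction m generalizing F with
  | nil => exact ⟨𝟭 C, F, .nil, h, rfl⟩
  | cons p m ih =>
    obtain ⟨L, hL, rfl⟩ := exists_cons (a := p.1) (k := p.2) h
    obtain ⟨M, N, hM, hN, rfl⟩ := ih hL
    exact ⟨M ⋙ T p.1 p.2, N, .cons _ _ hM, hN, rfl⟩

end IsWord

/-- Where a marked entry of a list is relative to a decomposition of the list in three parts. -/
theorem List.append_append_eq_append_cons {α : Type*} {m' ξ n' m n : List α} {p : α}
    (h : m' ++ (ξ ++ n') = m ++ p :: n) :
    (∃ x, m' = m ++ p :: x ∧ n = x ++ (ξ ++ n')) ∨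
    (∃ x y, ξ = x ++ p :: y ∧ m = m' ++ x ∧ n = y ++ n') ∨
    ∃ x, n' = x ++ p :: n ∧ m = m' ++ (ξ ++ x) := by
  rcases List.append_eq_append_iff.1 h with ⟨x, rfl, hx⟩ | ⟨x, rfl, hx⟩
  · rcases List.append_eq_append_iff.1 hx with ⟨y, rfl, hy⟩ | ⟨y, rfl, hy⟩
    · exact .inr (.inr ⟨y, hy, rfl⟩)
    · cases y with
      | nil => exact .inr (.inr ⟨[], by simpa using hy.symm, by simp⟩)
      | cons q y =>
        simp only [List.cons_append, List.cons.injEq] at hy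
        obtain ⟨rfl, rfl⟩ := hy
        exact .inr (.inl ⟨x, y, rfl, rfl, rfl⟩)
  · cases x with
    | nil =>
      simp only [List.nil_append] at hx
      cases ξ with
      | nil => exact .inr (.inr ⟨[], by simpa using hx.symm, by simp⟩)
      | cons q y =>
        simp only [List.cons_append, List.cons.injEq] at hx
        obtain ⟨rfl, rfl⟩ := hx
        exact .inr (.inl ⟨[], y, rfl, by simp, rfl⟩)
    | cons q x =>
      simp only [List.cons_append, List.cons.injEq] at hx
      obtain ⟨rfl, rfl⟩ := hx
      exact .inl ⟨x, rfl, rfl⟩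

namespace AdjointChains

variable {A : Type*} {C : Type u} [Category.{v} C] (K : AdjointChains A C)

/-- A composite of functors of the chains. -/
def IsComposite (F : C ⥤ C) : Prop := ∃ l, IsWord K.T l F

variable {K}

theorem IsComposite.comp {N M : C ⥤ C} (hN : K.IsComposite N) (hM : K.IsComposite M) :
    K.IsComposite (N ⋙ M) := by
  obtain ⟨n, hn⟩ := hN
  obtain ⟨m, hm⟩ := hM
  exact ⟨_, hm.append hn⟩

theorem isComposite_id : K.IsComposite (𝟭 C) := ⟨_, .nil⟩

theorem isComposite_T (a : A) (n : ℤ) : K.IsComposite (K.T a n) := ⟨_, .single a n⟩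

/-- Where a marked factor of a composite is relative to a factorization in three parts. -/
theorem factor_cases {N' Ξ M' N M : C ⥤ C} {a : A} {k : ℤ} (hN' : K.IsComposite N')
    (hΞ : K.IsComposite Ξ) (hM' : K.IsComposite M') (hN : K.IsComposite N) (hM : K.IsComposite M)
    (e : N' ⋙ Ξ ⋙ M' = N ⋙ K.T a k ⋙ M) :
    (∃ X, K.IsComposite X ∧ M' = X ⋙ K.T a k ⋙ M ∧ N = N' ⋙ Ξ ⋙ X) ∨
    (∃ X Y, K.IsComposite X ∧ K.IsComposite Y ∧ Ξ = X ⋙ K.T a k ⋙ Y ∧ N = N' ⋙ X ∧ M = Y ⋙ M') ∨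
    ∃ X, K.IsComposite X ∧ N' = N ⋙ K.T a k ⋙ X ∧ M = X ⋙ Ξ ⋙ M' := by
  obtain ⟨n', hn'⟩ := hN'
  obtain ⟨ξ, hξ⟩ := hΞ
  obtain ⟨m', hm'⟩ := hM'
  obtain ⟨n, hn⟩ := hN
  obtain ⟨m, hm⟩ := hM
  have h₁ : IsWord K.T (m' ++ (ξ ++ n')) (N' ⋙ Ξ ⋙ M') := hm'.append (hξ.append hn')
  have h₂ : IsWord K.T (m ++ (a, k) :: n) (N ⋙ K.T a k ⋙ M) := hm.append (.cons a k hn)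
  rcases List.append_append_eq_append_cons (K.unique h₁ (e ▸ h₂)) with
    ⟨x, rfl, rfl⟩ | ⟨x, y, rfl, rfl, rfl⟩ | ⟨x, rfl, rfl⟩
  · obtain ⟨M₁, N₁, hM₁, hN₁, rfl⟩ := hm'.exists_append
    obtain rfl := hM₁.eq hm
    obtain ⟨X, hX, rfl⟩ := hN₁.exists_cons
    exact .inl ⟨X, ⟨x, hX⟩, rfl, hn.eq (hX.append (hξ.append hn'))⟩
  · obtain ⟨Y, X, hY, hX, rfl⟩ := hξ.exists_append
    obtain ⟨X', hX', rfl⟩ := hX.exists_cons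
    exact .inr (.inl ⟨X', Y, ⟨_, hX'⟩, ⟨_, hY⟩, rfl, hn.eq (hX'.append hn'),
      hm.eq (hm'.append hY)⟩)
  · obtain ⟨X, N₁, hX, hN₁, rfl⟩ := hn'.exists_append
    obtain ⟨N₂, hN₂, rfl⟩ := hN₁.exists_cons
    obtain rfl := hN₂.eq hn
    exact .inr (.inr ⟨X, ⟨x, hX⟩, rfl, hm.eq (hm'.append (hξ.append hX))⟩)

end AdjointChains

/-! ### Boxes and their states -/

namespace AdjointChains

variable {A : Type*} {C : Type u} [Category.{v} C] {K : AdjointChains A C}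

theorem eq_id_of_comp {Y M : C ⥤ C} (hY : K.IsComposite Y) (hM : K.IsComposite M)
    (e : 𝟭 C = Y ⋙ M) : Y = 𝟭 C ∧ M = 𝟭 C := by
  obtain ⟨y, hy⟩ := hY
  obtain ⟨m, hm⟩ := hM
  have h := K.unique IsWord.nil (e ▸ hm.append hy)
  obtain ⟨rfl, rfl⟩ := List.append_eq_nil_iff.1 h.symm
  exact ⟨hy.eq_of_nil, hm.eq_of_nil⟩

theorem comp_T_cancel {Ψ Ψ' : C ⥤ C} {a a' : A} {k k' : ℤ} (hΨ : K.IsComposite Ψ)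
    (hΨ' : K.IsComposite Ψ') (e : Ψ' ⋙ K.T a' k' = Ψ ⋙ K.T a k) : a' = a ∧ k' = k ∧ Ψ' = Ψ := by
  obtain ⟨l, hl⟩ := hΨ
  obtain ⟨l', hl'⟩ := hΨ'
  have h' : IsWord K.T ((a', k') :: l') (Ψ ⋙ K.T a k) := e ▸ .cons a' k' hl'
  have h := K.unique h' (.cons a k hl)
  injection h with h₁ h₂
  injection h₁ with h₁ h₃
  subst h₁ h₂ h₃
  exact ⟨rfl, rfl, hl'.eq hl⟩

theorem T_comp_cancel {Ψ Ψ' : C ⥤ C} {a a' : A} {k k' : ℤ} (hΨ : K.IsComposite Ψ)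
    (hΨ' : K.IsComposite Ψ') (e : K.T a' k' ⋙ Ψ' = K.T a k ⋙ Ψ) : a' = a ∧ k' = k ∧ Ψ' = Ψ := by
  obtain ⟨l, hl⟩ := hΨ
  obtain ⟨l', hl'⟩ := hΨ'
  have h' : IsWord K.T (l' ++ [(a', k')]) (K.T a k ⋙ Ψ) := e ▸ hl'.append (.single a' k')
  have h := K.unique h' (hl.append (.single a k))
  obtain ⟨h₁, h₂⟩ := List.append_inj' h rfl
  injection h₂ with h₂
  injection h₂ with h₂ h₃
  subst h₁ h₂ h₃
  exact ⟨rfl, rfl, hl'.eq hl⟩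

variable (K) in
/-- Boxes with one output `x` and a nonempty string of inputs. A box `y₁ … yₙ → x` is given by its
mate `T x 1 ⟶ T y₁ 1 ⋯ T yₙ 1`, where the factor of `yₙ` is the outermost one. Degrees which are
definitionally successors are written as such, here `0 + 1`, to match the type of `adj`. -/
structure Boxes where
  rel : ∀ (x : A) (Φ : C ⥤ C), (K.T x (0 + 1) ⟶ Φ) → Prop
  legs : ∀ {x : A} {Φ : C ⥤ C} {α : K.T x (0 + 1) ⟶ Φ}, rel x Φ α →
    ∃ l, IsWord K.T l Φ ∧ l ≠ [] ∧ ∀ p ∈ l, p.2 = 1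

variable (B : Boxes K)

/-- The states obtained from boxes by repeatedly moving the outermost leg to the innermost place,
which lowers its degree by `2`. -/
inductive StateF : ∀ F : C ⥤ C, (𝟭 C ⟶ F) → Prop
  | base {x : A} {Φ : C ⥤ C} {α : K.T x (0 + 1) ⟶ Φ} : B.rel x Φ α →
      StateF (K.T x 0 ⋙ Φ) (bendR (K.adj x 0) Φ α)
  | turn {Ψ : C ⥤ C} {a : A} {n : ℤ} {s : 𝟭 C ⟶ Ψ ⋙ K.T a (n + 1 + 1)} :
      K.IsComposite Ψ → StateF (Ψ ⋙ K.T a (n + 1 + 1)) s →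
      StateF (K.T a n ⋙ Ψ) (rotate (K.adj a n) (K.adj a (n + 1)) Ψ s)

/-- The states obtained from boxes by repeatedly moving the innermost leg to the outermost place,
which raises its degree by `2`. -/
inductive StateB : ∀ F : C ⥤ C, (𝟭 C ⟶ F) → Prop
  | base {x : A} {Φ : C ⥤ C} {α : K.T x (0 + 1) ⟶ Φ} : B.rel x Φ α →
      StateB (K.T x 0 ⋙ Φ) (bendR (K.adj x 0) Φ α)
  | turn {Ψ : C ⥤ C} {a : A} {n : ℤ} {s : 𝟭 C ⟶ K.T a n ⋙ Ψ} :
      K.IsComposite Ψ → StateB (K.T a n ⋙ Ψ) s →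
      StateB (Ψ ⋙ K.T a (n + 1 + 1)) ((rotate (K.adj a n) (K.adj a (n + 1)) Ψ).symm s)

/-- The states of boxes, in all rotated positions. -/
def State (F : C ⥤ C) (s : 𝟭 C ⟶ F) : Prop := StateF B F s ∨ StateB B F s

variable {B}

theorem StateF.cast {F F' : C ⥤ C} {s : 𝟭 C ⟶ F} {s' : 𝟭 C ⟶ F'} (h : StateF B F s) (e : F = F')
    (hs : HEq s s') : StateF B F' s' := by
  subst e
  obtain rfl := eq_of_heq hs
  exact h

theorem StateB.cast {F F' : C ⥤ C} {s : 𝟭 C ⟶ F} {s' : 𝟭 C ⟶ F'} (h : StateB B F s) (e : F = F')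
    (hs : HEq s s') : StateB B F' s' := by
  subst e
  obtain rfl := eq_of_heq hs
  exact h

theorem Boxes.isComposite {x : A} {Φ : C ⥤ C} {α : K.T x (0 + 1) ⟶ Φ} (h : B.rel x Φ α) :
    K.IsComposite Φ :=
  let ⟨l, hl, _⟩ := B.legs h
  ⟨l, hl⟩

theorem StateB.turn_back {F : C ⥤ C} {s : 𝟭 C ⟶ F} (h : StateB B F s) {Ψ : C ⥤ C} {a : A} {n : ℤ}
    (hΨ : K.IsComposite Ψ) (e : F = Ψ ⋙ K.T a (n + 1 + 1)) {s' : 𝟭 C ⟶ Ψ ⋙ K.T a (n + 1 + 1)}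
    (hs : HEq s s') : State B (K.T a n ⋙ Ψ) (rotate (K.adj a n) (K.adj a (n + 1)) Ψ s') := by
  cases h with
  | base h => exact .inl (.turn hΨ ((StateF.base h).cast e hs))
  | turn hΨ' h =>
    obtain ⟨rfl, hk, rfl⟩ := comp_T_cancel hΨ hΨ' e
    obtain rfl : _ = n := by simpa using hk
    obtain rfl := eq_of_heq hs
    rw [Equiv.apply_symm_apply]
    exact .inr h

theorem StateF.turn_back {F : C ⥤ C} {s : 𝟭 C ⟶ F} (h : StateF B F s) {Ψ : C ⥤ C} {a : A} {n : ℤ}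
    (hΨ : K.IsComposite Ψ) (e : F = K.T a n ⋙ Ψ) {s' : 𝟭 C ⟶ K.T a n ⋙ Ψ} (hs : HEq s s') :
    State B (Ψ ⋙ K.T a (n + 1 + 1)) ((rotate (K.adj a n) (K.adj a (n + 1)) Ψ).symm s') := by
  cases h with
  | base h => exact .inr (.turn hΨ ((StateB.base h).cast e hs))
  | turn hΨ' h =>
    obtain ⟨rfl, rfl, rfl⟩ := T_comp_cancel hΨ hΨ' e
    obtain rfl := eq_of_heq hs
    rw [Equiv.symm_apply_apply]
    exact .inl h

theorem State.turn {Ψ : C ⥤ C} {a : A} {n : ℤ} {s : 𝟭 C ⟶ Ψ ⋙ K.T a (n + 1 + 1)}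
    (h : State B (Ψ ⋙ K.T a (n + 1 + 1)) s) (hΨ : K.IsComposite Ψ) :
    State B (K.T a n ⋙ Ψ) (rotate (K.adj a n) (K.adj a (n + 1)) Ψ s) :=
  h.elim (fun h => .inl (.turn hΨ h)) (fun h => h.turn_back hΨ rfl .rfl)

theorem State.turn_symm {Ψ : C ⥤ C} {a : A} {n : ℤ} {s : 𝟭 C ⟶ K.T a n ⋙ Ψ}
    (h : State B (K.T a n ⋙ Ψ) s) (hΨ : K.IsComposite Ψ) :
    State B (Ψ ⋙ K.T a (n + 1 + 1)) ((rotate (K.adj a n) (K.adj a (n + 1)) Ψ).symm s) :=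
  h.elim (fun h => h.turn_back hΨ rfl .rfl) (fun h => .inr (.turn hΨ h))

variable (K) in
/-- All factors of the composite `F` have a degree satisfying `P`. -/
def Degrees (P : ℤ → Prop) (F : C ⥤ C) : Prop := ∃ l, IsWord K.T l F ∧ ∀ p ∈ l, P p.2

theorem Degrees.isComposite {P : ℤ → Prop} {F : C ⥤ C} (h : K.Degrees P F) : K.IsComposite F :=
  let ⟨l, hl, _⟩ := h
  ⟨l, hl⟩

theorem Degrees.mono {P Q : ℤ → Prop} {F : C ⥤ C} (h : K.Degrees P F) (hPQ : ∀ n, P n → Q n) :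
    K.Degrees Q F :=
  let ⟨l, hl, h⟩ := h
  ⟨l, hl, fun p hp => hPQ _ (h p hp)⟩

theorem degrees_comp {P : ℤ → Prop} {N M : C ⥤ C} (hN : K.IsComposite N) (hM : K.IsComposite M) :
    K.Degrees P (N ⋙ M) ↔ K.Degrees P N ∧ K.Degrees P M := by
  obtain ⟨n, hn⟩ := hN
  obtain ⟨m, hm⟩ := hM
  constructor
  · rintro ⟨l, hl, h⟩
    obtain rfl := K.unique hl (hm.append hn)
    exact ⟨⟨n, hn, fun p hp => h p (List.mem_append_right _ hp)⟩,
      ⟨m, hm, fun p hp => h p (List.mem_append_left _ hp)⟩⟩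
  · rintro ⟨⟨n', hn', h'⟩, ⟨m', hm', h''⟩⟩
    refine ⟨_, hm'.append hn', fun p hp => ?_⟩
    rcases List.mem_append.1 hp with hp | hp
    exacts [h'' p hp, h' p hp]

theorem degrees_T {P : ℤ → Prop} {a : A} {n : ℤ} : K.Degrees P (K.T a n) ↔ P n := by
  constructor
  · rintro ⟨l, hl, h⟩
    obtain rfl := K.unique hl (.single a n)
    exact h (a, n) (by simp)
  · intro h
    exact ⟨_, .single a n, by simpa using h⟩

variable (B) in
/-- The state of a box, in its original position. -/
def IsBase (F : C ⥤ C) (s : 𝟭 C ⟶ F) : Prop :=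
  ∃ (x : A) (Φ : C ⥤ C) (α : K.T x (0 + 1) ⟶ Φ), B.rel x Φ α ∧ F = K.T x 0 ⋙ Φ ∧
    HEq s (bendR (K.adj x 0) Φ α)

theorem StateF.degrees {F : C ⥤ C} {s : 𝟭 C ⟶ F} (h : StateF B F s) :
    K.Degrees (· ≤ 1) F ∧
      (IsBase B F s ∨
        ∃ (a : A) (n : ℤ) (Ψ : C ⥤ C), n ≤ -1 ∧ K.IsComposite Ψ ∧ F = K.T a n ⋙ Ψ) := by
  induction h with
  | @base x Φ α h =>
    obtain ⟨l, hl, _, h'⟩ := B.legs h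
    exact ⟨(degrees_comp (isComposite_T _ _) ⟨l, hl⟩).2
      ⟨degrees_T.2 (by decide), l, hl, fun p hp => (h' p hp).le⟩, .inl ⟨x, Φ, α, h, rfl, .rfl⟩⟩
  | @turn Ψ a n s hΨ _ ih =>
    obtain ⟨h₁, h₂⟩ := (degrees_comp hΨ (isComposite_T _ _)).1 ih.1
    rw [degrees_T] at h₂
    exact ⟨(degrees_comp (isComposite_T _ _) hΨ).2 ⟨degrees_T.2 (by omega), h₁⟩,
      .inr ⟨a, n, Ψ, by omega, hΨ, rfl⟩⟩

theorem StateB.degrees {F : C ⥤ C} {s : 𝟭 C ⟶ F} (h : StateB B F s) :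
    IsBase B F s ∨ K.Degrees (1 ≤ ·) F := by
  induction h with
  | @base x Φ α h => exact .inl ⟨x, Φ, α, h, rfl, .rfl⟩
  | @turn Ψ a n s hΨ h ih =>
    have key : 0 ≤ n ∧ K.Degrees (1 ≤ ·) Ψ := by
      rcases ih with ⟨x, Φ, α, h, e, -⟩ | ih
      · obtain ⟨rfl, rfl, rfl⟩ := T_comp_cancel (Boxes.isComposite h) hΨ e
        obtain ⟨l, hl, _, h'⟩ := B.legs h
        exact ⟨le_rfl, l, hl, fun p hp => (h' p hp).ge⟩
      · obtain ⟨h₁, h₂⟩ := (degrees_comp (isComposite_T _ _) hΨ).1 ih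
        exact ⟨by linarith [degrees_T.1 h₁], h₂⟩
    exact .inr ((degrees_comp hΨ (isComposite_T _ _)).2 ⟨key.2, degrees_T.2 (by omega)⟩)

/-- A state whose innermost leg has degree `0` is in its original position. -/
theorem State.isBase {a : A} {Ψ : C ⥤ C} (hΨ : K.IsComposite Ψ) {s : 𝟭 C ⟶ K.T a 0 ⋙ Ψ}
    (h : State B (K.T a 0 ⋙ Ψ) s) : IsBase B (K.T a 0 ⋙ Ψ) s := by
  rcases h with h | h
  · rcases h.degrees.2 with h | ⟨b, n, Ψ', hn, hΨ', e⟩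
    · exact h
    · obtain ⟨-, rfl, -⟩ := T_comp_cancel hΨ' hΨ e
      omega
  · rcases h.degrees with h | h
    · exact h
    · have := degrees_T.1 ((degrees_comp (isComposite_T _ _) hΨ).1 h).1
      omega

variable (B) in
/-- The transformation `α` replaces a leg of degree `n + 1` by the legs of `Φ`, and is a rotated
box: bending its domain up gives a state of a box, with `T a n` as its innermost leg. -/
def Op (a : A) (n : ℤ) (Φ : C ⥤ C) (α : K.T a (n + 1) ⟶ Φ) : Prop :=
  State B (K.T a n ⋙ Φ) (bendR (K.adj a n) Φ α)

theorem Op.rel {a : A} {Φ : C ⥤ C} {α : K.T a (0 + 1) ⟶ Φ} (hΦ : K.IsComposite Φ)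
    (h : Op B a 0 Φ α) : B.rel a Φ α := by
  obtain ⟨x, Φ', α', h, e, hs⟩ := State.isBase hΦ h
  obtain ⟨rfl, -, rfl⟩ := T_comp_cancel hΦ (Boxes.isComposite h) e.symm
  rwa [(bendR _ _).injective (eq_of_heq hs)]

/-- The operation on the outermost leg of the result of an operation. -/
theorem Op.outer {d a : A} {k n : ℤ} {Φ : C ⥤ C} {α : K.T d (k + 1) ⟶ Φ ⋙ K.T a (n + 1 + 1)}
    (h : Op B d k (Φ ⋙ K.T a (n + 1 + 1)) α) (hΦ : K.IsComposite Φ) :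
    Op B a n (K.T d k ⋙ Φ)
      ((bendL (K.adj a (n + 1)) (K.T d k ⋙ Φ)).symm (bendR (K.adj d k) _ α)) :=
  State.turn (Ψ := K.T d k ⋙ Φ) h ((isComposite_T _ _).comp hΦ)

/-- The operation on the innermost leg of the result of an operation. -/
theorem Op.inner {d a : A} {k n : ℤ} {Φ : C ⥤ C} {α : K.T d (k + 1) ⟶ K.T a n ⋙ Φ}
    (h : Op B d k (K.T a n ⋙ Φ) α) (hΦ : K.IsComposite Φ) :
    Op B a n (Φ ⋙ K.T d (k + 1 + 1))
      ((bendR (K.adj a n) (Φ ⋙ K.T d (k + 1 + 1))).symm (bendL (K.adj d (k + 1)) _ α)) := by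
  have := State.turn_symm h ((isComposite_T _ _).comp hΦ)
  simp only [rotate, Equiv.symm_trans_apply, Equiv.symm_apply_apply, Equiv.symm_symm] at this
  unfold Op
  rw [Equiv.apply_symm_apply]
  exact this

/-! ### Shapes of degrees -/

variable (K) in
/-- The degrees of the factors of `F` are `e + 1, …, e + 1, e, e - 1, …, e - 1`, where `e` is
even, from the outermost to the innermost factor. -/
def HasShape (e : ℤ) (F : C ⥤ C) : Prop :=
  Even e ∧ ∃ L x R, K.Degrees (· = e + 1) L ∧ K.Degrees (· = e - 1) R ∧ F = R ⋙ K.T x e ⋙ L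

/-- A marked factor of a composite which has a shape. -/
theorem HasShape.factor {e : ℤ} {N M : C ⥤ C} {a : A} {k : ℤ}
    (h : K.HasShape e (N ⋙ K.T a k ⋙ M)) (hN : K.IsComposite N) (hM : K.IsComposite M) :
    (k = e + 1 ∧ K.Degrees (· = e + 1) M ∧ K.HasShape e N) ∨
    (k = e ∧ K.Degrees (· = e + 1) M ∧ K.Degrees (· = e - 1) N) ∨
    (k = e - 1 ∧ K.HasShape e M ∧ K.Degrees (· = e - 1) N) := by
  obtain ⟨he, L, x, R, hL, hR, e'⟩ := h
  rcases factor_cases hR.isComposite (isComposite_T _ _) hL.isComposite hN hM e'.symm with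
    ⟨X, hX, rfl, rfl⟩ | ⟨X, Y, hX, hY, e₁, rfl, rfl⟩ | ⟨X, hX, rfl, rfl⟩
  · obtain ⟨h₁, h₂⟩ := (degrees_comp hX ((isComposite_T _ _).comp hM)).1 hL
    obtain ⟨h₂, h₃⟩ := (degrees_comp (isComposite_T _ _) hM).1 h₂
    exact .inl ⟨(degrees_T (P := (· = e + 1))).1 h₂, h₃, he, X, x, R, h₁, hR, rfl⟩
  · obtain ⟨l, hl⟩ := hX
    obtain ⟨l', hl'⟩ := hY
    have h₁ : IsWord K.T (l' ++ (a, k) :: l) (K.T x e) := e₁ ▸ hl'.append (.cons a k hl)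
    have h₂ := K.unique h₁ (.single x e)
    cases l' with
    | nil =>
      simp only [List.nil_append, List.cons.injEq, Prod.mk.injEq] at h₂
      obtain ⟨⟨rfl, rfl⟩, rfl⟩ := h₂
      obtain rfl := hl.eq_of_nil
      obtain rfl := hl'.eq_of_nil
      exact .inr (.inl ⟨rfl, hL, hR⟩)
    | cons p l' => simp at h₂
  · obtain ⟨h₁, h₂⟩ := (degrees_comp hN ((isComposite_T _ _).comp hX)).1 hR
    obtain ⟨h₂, h₃⟩ := (degrees_comp (isComposite_T _ _) hX).1 h₂
    exact .inr (.inr ⟨(degrees_T (P := (· = e - 1))).1 h₂, ⟨he, L, x, X, hL, h₃, rfl⟩, h₁⟩)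

theorem HasShape.comp_left {e : ℤ} {N M : C ⥤ C} (h : K.HasShape e M)
    (hN : K.Degrees (· = e - 1) N) : K.HasShape e (N ⋙ M) := by
  obtain ⟨he, L, x, R, hL, hR, rfl⟩ := h
  exact ⟨he, L, x, N ⋙ R, hL, (degrees_comp hN.isComposite hR.isComposite).2 ⟨hN, hR⟩, rfl⟩

theorem HasShape.comp_right {e : ℤ} {N M : C ⥤ C} (h : K.HasShape e N)
    (hM : K.Degrees (· = e + 1) M) : K.HasShape e (N ⋙ M) := by
  obtain ⟨he, L, x, R, hL, hR, rfl⟩ := h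
  exact ⟨he, L ⋙ M, x, R, (degrees_comp hL.isComposite hM.isComposite).2 ⟨hL, hM⟩, hR, rfl⟩

theorem degrees_id {P : ℤ → Prop} : K.Degrees P (𝟭 C) := ⟨[], .nil, by simp⟩

/-- Moving a leg of the outermost degree `e + 1` yields `e - 1`; if there is none, the leg of degree
`e` is moved, and `e - 2` is the new even degree. -/
theorem hasShape_turn {Ψ : C ⥤ C} {a : A} {n e : ℤ} (hΨ : K.IsComposite Ψ)
    (h : K.HasShape e (Ψ ⋙ K.T a (n + 1 + 1))) : ∃ e', K.HasShape e' (K.T a n ⋙ Ψ) := by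
  rcases HasShape.factor (M := 𝟭 C) h hΨ isComposite_id with
    ⟨h₁, -, h₂⟩ | ⟨rfl, -, h₂⟩ | ⟨-, ⟨-, L, x, R, hL, hR, e'⟩, -⟩
  · exact ⟨e, h₂.comp_left (degrees_T.2 (by omega))⟩
  · refine ⟨n, ?_, Ψ, a, 𝟭 C, h₂.mono fun k hk => by omega, degrees_id, rfl⟩
    simpa [Int.even_add_one] using h.1
  · obtain ⟨-, h'⟩ := eq_id_of_comp hR.isComposite ((isComposite_T _ _).comp hL.isComposite) e'
    obtain ⟨l, hl, -⟩ := hL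
    have h₁ : IsWord K.T (l ++ [(x, e)]) (𝟭 C) := h' ▸ hl.append (.single x e)
    simpa using K.unique h₁ .nil

theorem hasShape_turn_symm {Ψ : C ⥤ C} {a : A} {n e : ℤ} (hΨ : K.IsComposite Ψ)
    (h : K.HasShape e (K.T a n ⋙ Ψ)) : ∃ e', K.HasShape e' (Ψ ⋙ K.T a (n + 1 + 1)) := by
  rcases HasShape.factor (N := 𝟭 C) h isComposite_id hΨ with
    ⟨-, -, ⟨-, L, x, R, hL, hR, e'⟩⟩ | ⟨rfl, h₂, -⟩ | ⟨h₁, h₂, -⟩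
  · obtain ⟨-, h'⟩ := eq_id_of_comp hR.isComposite ((isComposite_T _ _).comp hL.isComposite) e'
    obtain ⟨l, hl, -⟩ := hL
    have h₁ : IsWord K.T (l ++ [(x, e)]) (𝟭 C) := h' ▸ hl.append (.single x e)
    simpa using K.unique h₁ .nil
  · refine ⟨n + 1 + 1, ?_, 𝟭 C, a, Ψ, degrees_id, h₂.mono fun k hk => by omega, rfl⟩
    simpa [Int.even_add_one] using h.1
  · exact ⟨e, h₂.comp_right (degrees_T.2 (by omega))⟩

theorem State.hasShape {F : C ⥤ C} {s : 𝟭 C ⟶ F} (h : State B F s) : ∃ e, K.HasShape e F := by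
  have base : ∀ {x Φ} {α : K.T x (0 + 1) ⟶ Φ}, B.rel x Φ α → K.HasShape 0 (K.T x 0 ⋙ Φ) := by
    intro x Φ α h
    obtain ⟨l, hl, -, h⟩ := B.legs h
    exact ⟨Even.zero, Φ, x, 𝟭 C, ⟨l, hl, h⟩, degrees_id, rfl⟩
  rcases h with h | h
  · induction h with
    | base h => exact ⟨0, base h⟩
    | turn hΨ _ ih =>
      obtain ⟨e, h⟩ := ih
      exact hasShape_turn hΨ h
  · induction h with
    | base h => exact ⟨0, base h⟩
    | turn hΨ _ ih =>
      obtain ⟨e, h⟩ := ih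
      exact hasShape_turn_symm hΨ h

/-- A box has an input and an output, hence at least two legs. -/
theorem State.ne_T {F : C ⥤ C} {s : 𝟭 C ⟶ F} (h : State B F s) (a : A) (n : ℤ) : F ≠ K.T a n := by
  have key : ∃ l, IsWord K.T l F ∧ 2 ≤ l.length := by
    have base : ∀ {x Φ} {α : K.T x (0 + 1) ⟶ Φ}, B.rel x Φ α →
        ∃ l, IsWord K.T l (K.T x 0 ⋙ Φ) ∧ 2 ≤ l.length := by
      intro x Φ α h
      obtain ⟨l, hl, h, -⟩ := B.legs h
      refine ⟨_, hl.append (.single x 0), ?_⟩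
      have := List.length_pos_of_ne_nil h
      simp only [List.length_append, List.length_cons, List.length_nil]
      omega
    rcases h with h | h
    · induction h with
      | base h => exact base h
      | @turn Ψ a n s hΨ _ ih =>
        obtain ⟨ψ, hψ⟩ := hΨ
        obtain ⟨l, hl, h⟩ := ih
        obtain rfl := K.unique hl (.cons a _ hψ)
        exact ⟨_, hψ.append (.single a n), by simpa using h⟩
    · induction h with
      | base h => exact base h
      | @turn Ψ a n s hΨ _ ih =>
        obtain ⟨ψ, hψ⟩ := hΨ
        obtain ⟨l, hl, h⟩ := ih
        obtain rfl := K.unique hl (hψ.append (.single a n))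
        exact ⟨_, .cons a _ hψ, by simpa using h⟩
  rintro rfl
  obtain ⟨l, hl, h⟩ := key
  obtain rfl := K.unique hl (.single a n)
  simp at h

theorem Op.ne_id {a : A} {n : ℤ} {Φ : C ⥤ C} {α : K.T a (n + 1) ⟶ Φ} (h : Op B a n Φ α) :
    Φ ≠ 𝟭 C := by
  rintro rfl
  exact h.ne_T a n rfl

/-- The effect of an operation on degrees. -/
theorem Op.shape {a : A} {n : ℤ} {Φ : C ⥤ C} {α : K.T a (n + 1) ⟶ Φ} (h : Op B a n Φ α)
    (hΦ : K.IsComposite Φ) :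
    (Even (n + 1) ∧ K.HasShape (n + 1) Φ) ∨ (¬ Even (n + 1) ∧ K.Degrees (· = n + 1) Φ) := by
  obtain ⟨e, h⟩ := State.hasShape h
  rcases HasShape.factor (N := 𝟭 C) h isComposite_id hΦ with
    ⟨-, -, ⟨-, L, x, R, hL, hR, e'⟩⟩ | ⟨rfl, h₂, -⟩ | ⟨h₁, h₂, -⟩
  · obtain ⟨-, h'⟩ := eq_id_of_comp hR.isComposite ((isComposite_T _ _).comp hL.isComposite) e'
    obtain ⟨l, hl, -⟩ := hL
    have h₁ : IsWord K.T (l ++ [(x, e)]) (𝟭 C) := h' ▸ hl.append (.single x e)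
    simpa using K.unique h₁ .nil
  · refine .inr ⟨?_, h₂⟩
    simpa [Int.even_add_one] using h.1
  · obtain rfl : e = n + 1 := by omega
    exact .inl ⟨h.1, h₂⟩

end AdjointChains

/-! ### Joining transformations along a leg -/

namespace Bending

variable {C : Type u} [Category.{v} C]

theorem whisker_exchange (N X M : C ⥤ C) {F F' H H' : C ⥤ C} (γ : H ⟶ H') (α : F ⟶ F') :
    whisker N γ (X ⋙ F ⋙ M) ≫ whisker (N ⋙ H' ⋙ X) α M =
      whisker (N ⋙ H ⋙ X) α M ≫ whisker N γ (X ⋙ F' ⋙ M) := by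
  ext Z
  simp [← Functor.map_comp]

/-- A transformation `α` applied to the outer leg of the state of `γ`, the new outer leg being bent
down: this is `γ` applied to a leg of `α` which is turned round. -/
theorem bendL_symm_bendL_comp {F G F' G' N X : C ⥤ C} (adj : F ⊣ G) (adj' : F' ⊣ G') (γ : F ⟶ N)
    (α : G ⟶ X ⋙ G') :
    (bendL adj' (N ⋙ X)).symm (bendL adj N γ ≫ Functor.whiskerLeft N α) =
      (bendL adj' (F ⋙ X)).symm (bendR adj _ α) ≫ Functor.whiskerRight γ X := by
  ext Z
  have h := α.naturality (γ.app Z)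
  have h' := adj'.counit.naturality (X.map (γ.app Z))
  simp only [Functor.comp_obj, Functor.comp_map, Functor.id_obj, Functor.id_map] at h h'
  simp only [bendL_symm_app, bendR_app, NatTrans.comp_app, bendL_app, Functor.whiskerLeft_app,
    Functor.whiskerRight_app, Functor.comp_obj, Functor.id_obj, Category.assoc, ← h', h]
  simp only [← Functor.map_comp_assoc, Category.assoc]

/-- The mirror image of `bendL_symm_bendL_comp`. -/
theorem bendR_symm_bendR_comp {F G F' G' M Y : C ⥤ C} (adj : F ⊣ G) (adj' : F' ⊣ G') (γ : G ⟶ M)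
    (α : F ⟶ F' ⋙ Y) :
    (bendR adj' (Y ⋙ M)).symm (bendR adj M γ ≫ Functor.whiskerRight α M) =
      (bendR adj' (Y ⋙ G)).symm (bendL adj _ α) ≫ Functor.whiskerLeft Y γ := by
  ext Z
  simp

/-- Inserting a state between an inner functor `N` and an outer functor `M`. -/
abbrev insertion (N : C ⥤ C) {Ξ : C ⥤ C} (c : 𝟭 C ⟶ Ξ) (M : C ⥤ C) : N ⋙ M ⟶ N ⋙ Ξ ⋙ M :=
  whisker N c M

/-- Contracting two adjacent functors between an inner functor `N` and an outer functor `M`. -/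
abbrev contraction (N : C ⥤ C) {Ξ : C ⥤ C} (c : Ξ ⟶ 𝟭 C) (M : C ⥤ C) : N ⋙ Ξ ⋙ M ⟶ N ⋙ M :=
  whisker N c M

end Bending

namespace AdjointChains

variable {A : Type*} {C : Type u} [Category.{v} C] {K : AdjointChains A C} (B : Boxes K)

/-! ### Connected components -/

/-- The transformation `β : G ⟶ F` is a composite of boxes, each of which is applied to a single
leg. -/
inductive Grow (G : C ⥤ C) : ∀ F : C ⥤ C, (G ⟶ F) → Prop
  | refl : Grow G G (𝟙 G)
  | step {N M Φ : C ⥤ C} {a : A} {n : ℤ} {β : G ⟶ N ⋙ K.T a (n + 1) ⋙ M} {α : K.T a (n + 1) ⟶ Φ} :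
      K.IsComposite N → K.IsComposite M → K.IsComposite Φ →
      Grow G (N ⋙ K.T a (n + 1) ⋙ M) β → Op B a n Φ α → Grow G (N ⋙ Φ ⋙ M) (β ≫ whisker N α M)

variable {B}

theorem Grow.cast {G F : C ⥤ C} {β β' : G ⟶ F} (h : Grow B G F β) (e : β = β') :
    Grow B G F β' :=
  e ▸ h

theorem Grow.isComposite {G F : C ⥤ C} {β : G ⟶ F} (hG : K.IsComposite G) (h : Grow B G F β) :
    K.IsComposite F := by
  cases h with
  | refl => exact hG
  | step hN hM hΦ => exact hN.comp (hΦ.comp hM)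

theorem Grow.trans {G : C ⥤ C} {a : A} {n : ℤ} {N M : C ⥤ C} (hN : K.IsComposite N)
    (hM : K.IsComposite M) {β : G ⟶ N ⋙ K.T a n ⋙ M} (h : Grow B G (N ⋙ K.T a n ⋙ M) β) {Φ : C ⥤ C}
    {γ : K.T a n ⟶ Φ} (hγ : Grow B (K.T a n) Φ γ) :
    Grow B G (N ⋙ Φ ⋙ M) (β ≫ whisker N γ M) := by
  induction hγ with
  | refl =>
    have : β ≫ whisker N (𝟙 (K.T a n)) M = β := by
      ext Z; simp
    rw [this]
    exact h
  | @step N' M' Φ' b k γ' α hN' hM' hΦ _ hα ih =>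
    exact (Grow.step (N := N ⋙ N') (M := M' ⋙ M) (hN.comp hN') (hM'.comp hM) hΦ ih hα).cast
      (by ext Z; simp)

theorem Grow.op {a : A} {n : ℤ} {Φ : C ⥤ C} {α : K.T a (n + 1) ⟶ Φ} (hΦ : K.IsComposite Φ)
    (h : Op B a n Φ α) :
    Grow B (K.T a (n + 1)) Φ α := by
  have h' := Grow.step (N := 𝟭 C) (M := 𝟭 C) isComposite_id isComposite_id hΦ Grow.refl h
  have e : 𝟙 (K.T a (n + 1)) ≫ whisker (𝟭 C) α (𝟭 C) = α := by
    apply NatTrans.ext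
    funext Z
    simp
  exact Grow.cast (F := Φ) h' e

theorem not_id_eq {Y M N : C ⥤ C} (hN : K.IsComposite N) (hY : K.IsComposite Y)
    (hM : K.IsComposite M) (hne : Y ≠ 𝟭 C) (e : 𝟭 C = N ⋙ Y ⋙ M) : False :=
  hne (eq_id_of_comp hY hM (eq_id_of_comp hN (hY.comp hM) e).2.symm).1

/-- Bending down the outermost leg of a component: the rest of the component grows out of it. -/
theorem Grow.cut_outer {b : A} {m : ℤ} {F : C ⥤ C} {β : K.T b m ⋙ K.T b (m + 1) ⟶ F}
    (h : Grow B (K.T b m ⋙ K.T b (m + 1)) F β) {Ψ : C ⥤ C} {a : A} {n : ℤ} (hΨ : K.IsComposite Ψ)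
    (e : F = Ψ ⋙ K.T a (n + 1)) {c : 𝟭 C ⟶ Ψ ⋙ K.T a (n + 1)}
    (hc : HEq ((K.adj b m).unit ≫ β) c) :
    Grow B (K.T a n) Ψ ((bendL (K.adj a n) Ψ).symm c) := by
  induction h generalizing Ψ a n with
  | refl =>
    obtain ⟨rfl, hk, rfl⟩ := comp_T_cancel hΨ (isComposite_T _ _) e
    obtain rfl : m = n := by omega
    obtain rfl := eq_of_heq hc
    rw [Category.comp_id, ← bendL_id, Equiv.symm_apply_apply]
    exact .refl
  | @step N M Φ d k β α hN hM hΦ hβ hα ih =>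
    rcases factor_cases (M := 𝟭 C) hN hΦ hM hΨ isComposite_id e with
      ⟨X, hX, rfl, rfl⟩ | ⟨X, Y, hX, hY, rfl, rfl, e₁⟩ | ⟨X, hX, rfl, e₁⟩
    · obtain rfl := eq_of_heq hc
      refine (Grow.step hN hX hΦ
        (ih (Ψ := N ⋙ K.T d (k + 1) ⋙ X) (a := a) (n := n)
          (hN.comp ((isComposite_T _ _).comp hX)) rfl .rfl) hα).cast ?_
      rw [← bendL_symm_comp]
      exact congrArg _ (Category.assoc _ _ _)
    -- the leg belongs to the last box, which is turned round; the rest grows out of its old input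
    · obtain ⟨rfl, rfl⟩ := eq_id_of_comp hY hM e₁
      obtain rfl := eq_of_heq hc
      obtain ⟨n, rfl⟩ : ∃ n', n = n' + 1 := ⟨n - 1, by omega⟩
      have h₁ := ih (Ψ := N) (a := d) (n := k) hN rfl .rfl
      have h₂ := Grow.op ((isComposite_T _ _).comp hX) (Op.outer (Φ := X) hα hX)
      refine (Grow.trans (N := 𝟭 C) (M := X) isComposite_id hX h₂ h₁).cast ?_
      obtain ⟨γ, hγ⟩ := (bendL (K.adj d k) N).surjective ((K.adj b m).unit ≫ β)
      have h₃ := bendL_symm_bendL_comp (K.adj d k) (K.adj a (n + 1)) γ (X := X) α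
      rw [hγ] at h₃
      rw [← hγ, Equiv.symm_apply_apply]
      rw [Category.assoc] at h₃
      exact h₃.symm
    · exact (not_id_eq hX hΦ hM hα.ne_id e₁).elim

/-- Bending down the innermost leg of a component: the rest of the component grows out of it. -/
theorem Grow.cut_inner {b : A} {m : ℤ} {F : C ⥤ C} {β : K.T b m ⋙ K.T b (m + 1) ⟶ F}
    (h : Grow B (K.T b m ⋙ K.T b (m + 1)) F β) {Ψ : C ⥤ C} {a : A} {n : ℤ} (hΨ : K.IsComposite Ψ)
    (e : F = K.T a n ⋙ Ψ) {c : 𝟭 C ⟶ K.T a n ⋙ Ψ}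
    (hc : HEq ((K.adj b m).unit ≫ β) c) :
    Grow B (K.T a (n + 1)) Ψ ((bendR (K.adj a n) Ψ).symm c) := by
  induction h generalizing Ψ a n with
  | refl =>
    obtain ⟨rfl, rfl, rfl⟩ := T_comp_cancel hΨ (isComposite_T _ _) e
    obtain rfl := eq_of_heq hc
    rw [Category.comp_id, ← bendR_id, Equiv.symm_apply_apply]
    exact .refl
  | @step N M Φ d k β α hN hM hΦ hβ hα ih =>
    rcases factor_cases (N := 𝟭 C) hN hΦ hM isComposite_id hΨ e with
      ⟨X, hX, rfl, e₁⟩ | ⟨X, Y, hX, hY, rfl, e₁, rfl⟩ | ⟨X, hX, rfl, rfl⟩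
    · exact (not_id_eq hN hΦ hX hα.ne_id e₁).elim
    · obtain ⟨rfl, rfl⟩ := eq_id_of_comp hN hX e₁
      obtain rfl := eq_of_heq hc
      have h₁ := ih (Ψ := M) (a := d) (n := k + 1) hM rfl .rfl
      have h₂ := Grow.op (hY.comp (isComposite_T _ _)) (Op.inner (Φ := Y) hα hY)
      refine (Grow.trans (N := Y) (M := 𝟭 C) hY isComposite_id h₂ h₁).cast ?_
      obtain ⟨γ, hγ⟩ := (bendR (K.adj d (k + 1)) M).surjective ((K.adj b m).unit ≫ β)
      have h₃ := bendR_symm_bendR_comp (K.adj d (k + 1)) (K.adj a n) γ (Y := Y) α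
      rw [hγ] at h₃
      rw [← hγ, Equiv.symm_apply_apply]
      rw [Category.assoc] at h₃
      exact h₃.symm
    · obtain rfl := eq_of_heq hc
      refine (Grow.step hX hM hΦ
        (ih (Ψ := X ⋙ K.T d (k + 1) ⋙ M) (a := a) (n := n)
          (hX.comp ((isComposite_T _ _).comp hM)) rfl .rfl) hα).cast ?_
      rw [← bendR_symm_comp]
      exact congrArg _ (Category.assoc _ _ _)

theorem Grow.hasShape {G F : C ⥤ C} {β : G ⟶ F} {e : ℤ} (hG : K.HasShape e G)
    (h : Grow B G F β) : K.HasShape e F := by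
  induction h with
  | refl => exact hG
  | @step N M Φ a n β α hN hM hΦ _ hα ih =>
    have he := ih.1
    rcases ih.factor hN hM with ⟨h₁, h₂, h₃⟩ | ⟨h₁, h₂, h₃⟩ | ⟨h₁, h₂, h₃⟩
    · rcases hα.shape hΦ with ⟨h, -⟩ | ⟨-, h⟩
      · rw [h₁] at h
        exact absurd h (by simpa [Int.even_add_one] using he)
      · rw [h₁] at h
        exact h₃.comp_right ((degrees_comp hΦ hM).2 ⟨h, h₂⟩)
    · rcases hα.shape hΦ with ⟨-, h⟩ | ⟨h, -⟩
      · rw [h₁] at h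
        exact (h.comp_right h₂).comp_left h₃
      · exact absurd (h₁ ▸ he) h
    · rcases hα.shape hΦ with ⟨h, -⟩ | ⟨-, h⟩
      · rw [h₁] at h
        exact absurd h (by simpa [Int.even_sub_one] using he)
      · rw [h₁] at h
        exact (h₂.comp_left h).comp_left h₃

/-- The shape of a cap: of its degrees `m` and `m + 1`, exactly one is even. -/
theorem hasShape_cap (b : A) (m : ℤ) : ∃ e, K.HasShape e (K.T b m ⋙ K.T b (m + 1)) := by
  rcases Int.even_or_odd m with h | h
  · exact ⟨m, h, K.T b (m + 1), b, 𝟭 C, degrees_T.2 rfl, degrees_id, rfl⟩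
  · exact ⟨m + 1, h.add_one, 𝟭 C, b, K.T b m, degrees_id, degrees_T.2 (by omega), rfl⟩

/-- Two adjacent legs of the same component cannot be contracted with each other. -/
theorem HasShape.not_ascending {e : ℤ} {N M : C ⥤ C} {a : A} {n : ℤ}
    (hN : K.IsComposite N) (hM : K.IsComposite M)
    (h : K.HasShape e (N ⋙ K.T a (n + 1) ⋙ K.T a n ⋙ M)) : False := by
  have aux : ∀ {P : ℤ → Prop} {Q : Prop}, K.Degrees P (N ⋙ K.T a (n + 1)) → (P (n + 1) → Q) → Q :=
    fun h hQ => hQ (degrees_T.1 ((degrees_comp hN (isComposite_T _ _)).1 h).2)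
  have he := h.1
  rcases HasShape.factor (N := N ⋙ K.T a (n + 1)) h (hN.comp (isComposite_T _ _)) hM with
    ⟨h₁, h₂, h₃⟩ | ⟨h₁, h₂, h₃⟩ | ⟨h₁, h₂, h₃⟩
  · rcases HasShape.factor (M := 𝟭 C) h₃ hN isComposite_id with ⟨h, -⟩ | ⟨h, -⟩ | ⟨h, -⟩ <;> omega
  · exact aux h₃ fun h => by omega
  · exact aux h₃ fun h => by omega

theorem Grow.ne_id {b : A} {m : ℤ} {F : C ⥤ C} {β : K.T b m ⋙ K.T b (m + 1) ⟶ F}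
    (h : Grow B (K.T b m ⋙ K.T b (m + 1)) F β) : F ≠ 𝟭 C := by
  rintro rfl
  obtain ⟨e, he⟩ := hasShape_cap (K := K) b m
  obtain ⟨-, L, x, R, hL, hR, e'⟩ := h.hasShape he
  obtain ⟨-, h'⟩ := eq_id_of_comp hR.isComposite ((isComposite_T _ _).comp hL.isComposite) e'
  obtain ⟨l, hl, -⟩ := hL
  have h₁ : IsWord K.T (l ++ [(x, e)]) (𝟭 C) := h' ▸ hl.append (.single x e)
  simpa using K.unique h₁ .nil

/-! ### Normal forms of states -/

variable (B) in
/-- The states obtained by inserting connected components one after the other, each component being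
a cap to which boxes are applied. -/
inductive Good : ∀ F : C ⥤ C, (𝟭 C ⟶ F) → Prop
  | nil : Good (𝟭 C) (𝟙 (𝟭 C))
  | insert {N M Ξ : C ⥤ C} {b : A} {m : ℤ} {g : 𝟭 C ⟶ N ⋙ M} {β : K.T b m ⋙ K.T b (m + 1) ⟶ Ξ} :
      K.IsComposite N → K.IsComposite M → Good (N ⋙ M) g → Grow B (K.T b m ⋙ K.T b (m + 1)) Ξ β →
      Good (N ⋙ Ξ ⋙ M) (g ≫ insertion N ((K.adj b m).unit ≫ β) M)

theorem Good.cast {F : C ⥤ C} {s s' : 𝟭 C ⟶ F} (h : Good B F s) (hs : s = s') : Good B F s' :=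
  hs ▸ h

theorem Good.cap {N M : C ⥤ C} {g : 𝟭 C ⟶ N ⋙ M} (h : Good B (N ⋙ M) g) (hN : K.IsComposite N)
    (hM : K.IsComposite M) (a : A) (n : ℤ) :
    Good B (N ⋙ (K.T a n ⋙ K.T a (n + 1)) ⋙ M) (g ≫ insertion N (K.adj a n).unit M) :=
  (Good.insert hN hM h .refl).cast (by simp)

theorem isComposite_grow {b : A} {m : ℤ} {Ξ : C ⥤ C} {β : K.T b m ⋙ K.T b (m + 1) ⟶ Ξ}
    (h : Grow B (K.T b m ⋙ K.T b (m + 1)) Ξ β) : K.IsComposite Ξ :=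
  h.isComposite ((isComposite_T _ _).comp (isComposite_T _ _))

/-- A box is applied to a leg of one of the components, which it extends. -/
theorem Good.op_aux {F : C ⥤ C} {g : 𝟭 C ⟶ F} (h : Good B F g) {N M Φ : C ⥤ C} {a : A} {n : ℤ}
    {α : K.T a (n + 1) ⟶ Φ} (hN : K.IsComposite N) (hM : K.IsComposite M) (hΦ : K.IsComposite Φ)
    (hα : Op B a n Φ α) (e : F = N ⋙ K.T a (n + 1) ⋙ M) {g' : 𝟭 C ⟶ N ⋙ K.T a (n + 1) ⋙ M}
    (hg : HEq g g') : Good B (N ⋙ Φ ⋙ M) (g' ≫ whisker N α M) := by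
  induction h generalizing N M with
  | nil =>
    obtain ⟨-, h'⟩ := eq_id_of_comp hN ((isComposite_T _ _).comp hM) e
    obtain ⟨m, hm⟩ := hM
    have h₁ : IsWord K.T (m ++ [(a, n + 1)]) (𝟭 C) := h' ▸ hm.append (.single a (n + 1))
    simpa using K.unique h₁ .nil
  | @insert N' M' Ξ b m g₀ β hN' hM' _ hβ ih =>
    rcases factor_cases hN' (isComposite_grow hβ) hM' hN hM e with
      ⟨X, hX, rfl, rfl⟩ | ⟨X, Y, hX, hY, rfl, rfl, rfl⟩ | ⟨X, hX, rfl, rfl⟩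
    · obtain rfl := eq_of_heq hg
      refine (Good.insert hN' (hX.comp (hΦ.comp hM))
        (ih (N := N' ⋙ X) (hN'.comp hX) hM rfl .rfl) hβ).cast ?_
      have := whisker_exchange N' X M ((K.adj b m).unit ≫ β) α
      exact (Category.assoc _ _ _).trans ((g₀ ≫= this.symm).trans (Category.assoc _ _ _).symm)
    · obtain rfl := eq_of_heq hg
      refine (Good.insert hN' hM' ‹_› (Grow.step hX hY hΦ hβ hα)).cast ?_
      ext Z
      simp
    · obtain rfl := eq_of_heq hg
      refine (Good.insert (N := N ⋙ Φ ⋙ X) (hN.comp (hΦ.comp hX)) hM'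
        (ih (N := N) (M := X ⋙ M') hN (hX.comp hM') rfl .rfl) hβ).cast ?_
      have := whisker_exchange N X M' α ((K.adj b m).unit ≫ β)
      exact (Category.assoc _ _ _).trans ((g₀ ≫= this).trans (Category.assoc _ _ _).symm)

theorem Good.op {N M Φ : C ⥤ C} {a : A} {n : ℤ} {g : 𝟭 C ⟶ N ⋙ K.T a (n + 1) ⋙ M}
    (h : Good B (N ⋙ K.T a (n + 1) ⋙ M) g) {α : K.T a (n + 1) ⟶ Φ} (hN : K.IsComposite N)
    (hM : K.IsComposite M) (hΦ : K.IsComposite Φ) (hα : Op B a n Φ α) :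
    Good B (N ⋙ Φ ⋙ M) (g ≫ whisker N α M) :=
  h.op_aux hN hM hΦ hα rfl .rfl

theorem Good.grow {a : A} {n : ℤ} {Φ : C ⥤ C} {γ : K.T a n ⟶ Φ} (hγ : Grow B (K.T a n) Φ γ)
    {N M : C ⥤ C} {g : 𝟭 C ⟶ N ⋙ K.T a n ⋙ M} (h : Good B (N ⋙ K.T a n ⋙ M) g)
    (hN : K.IsComposite N) (hM : K.IsComposite M) : Good B (N ⋙ Φ ⋙ M) (g ≫ whisker N γ M) := by
  induction hγ with
  | refl => exact h.cast (by ext Z; simp)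
  | @step N' M' Φ' b k γ' α hN' hM' hΦ _ hα ih =>
    exact (Good.op (N := N ⋙ N') (M := M' ⋙ M) ih (hN.comp hN') (hM'.comp hM) hΦ hα).cast
      (by ext Z; simp)

/-- Two adjacent marked factors of a composite, relative to a factorization in three parts. -/
theorem pair_cases {N' Ξ M' N M : C ⥤ C} {a : A} {n : ℤ} (hN' : K.IsComposite N')
    (hΞ : K.IsComposite Ξ) (hM' : K.IsComposite M') (hN : K.IsComposite N) (hM : K.IsComposite M)
    (hne : Ξ ≠ 𝟭 C) (e : N' ⋙ Ξ ⋙ M' = N ⋙ K.T a (n + 1) ⋙ K.T a n ⋙ M) :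
    (∃ X, K.IsComposite X ∧ M' = X ⋙ K.T a (n + 1) ⋙ K.T a n ⋙ M ∧ N = N' ⋙ Ξ ⋙ X) ∨
    (∃ X, K.IsComposite X ∧ M' = K.T a n ⋙ M ∧ Ξ = X ⋙ K.T a (n + 1) ∧ N = N' ⋙ X) ∨
    (∃ X Y, K.IsComposite X ∧ K.IsComposite Y ∧ Ξ = X ⋙ K.T a (n + 1) ⋙ K.T a n ⋙ Y) ∨
    (∃ X, K.IsComposite X ∧ N' = N ⋙ K.T a (n + 1) ∧ Ξ = K.T a n ⋙ X ∧ M = X ⋙ M') ∨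
    ∃ X, K.IsComposite X ∧ N' = N ⋙ K.T a (n + 1) ⋙ K.T a n ⋙ X ∧ M = X ⋙ Ξ ⋙ M' := by
  rcases factor_cases (N := N ⋙ K.T a (n + 1)) hN' hΞ hM' (hN.comp (isComposite_T _ _)) hM e with
    ⟨X, hX, rfl, e₁⟩ | ⟨X, Y, hX, hY, rfl, e₁, rfl⟩ | ⟨X, hX, rfl, rfl⟩
  · rcases factor_cases (M := 𝟭 C) hN' hΞ hX hN isComposite_id e₁.symm with
      ⟨X', hX', rfl, rfl⟩ | ⟨X', Y', hX', hY', rfl, rfl, e₂⟩ | ⟨X', hX', -, e₂⟩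
    · exact .inl ⟨X', hX', rfl, rfl⟩
    · obtain ⟨rfl, rfl⟩ := eq_id_of_comp hY' hX e₂
      exact .inr (.inl ⟨X', hX', rfl, rfl, rfl⟩)
    · exact (not_id_eq hX' hΞ hX hne e₂).elim
  · rcases factor_cases (M := 𝟭 C) (N' := N') (Ξ := X) (M' := 𝟭 C) hN' hX isComposite_id hN
      isComposite_id e₁.symm with
      ⟨X', hX', e₂, rfl⟩ | ⟨X', Y', hX', hY', rfl, rfl, e₂⟩ | ⟨X', hX', rfl, e₂⟩
    · obtain ⟨-, e₃⟩ := eq_id_of_comp hX' ((isComposite_T _ _).comp isComposite_id) e₂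
      exact ((not_id_eq isComposite_id (isComposite_T a (n + 1)) isComposite_id · e₃.symm)
        fun h => by
          have h₁ : IsWord K.T [(a, n + 1)] (𝟭 C) := h ▸ .single a (n + 1)
          simpa using K.unique h₁ .nil).elim
    · obtain ⟨rfl, -⟩ := eq_id_of_comp hY' isComposite_id e₂
      exact .inr (.inr (.inl ⟨X', Y, hX', hY, rfl⟩))
    · obtain ⟨rfl, e₃⟩ := eq_id_of_comp hX' (hX.comp isComposite_id) e₂
      obtain ⟨rfl, -⟩ := eq_id_of_comp hX isComposite_id e₃.symm
      exact .inr (.inr (.inr (.inl ⟨Y, hY, rfl, rfl, rfl⟩)))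
  · exact .inr (.inr (.inr (.inr ⟨X, hX, rfl, rfl⟩)))

/-- A cup joins legs of different components: the component inserted last is bent down at one of
the legs, and grows out of the other one. -/
theorem Good.cup_aux {F : C ⥤ C} {g : 𝟭 C ⟶ F} (h : Good B F g) {N M : C ⥤ C} {a : A} {n : ℤ}
    (hN : K.IsComposite N) (hM : K.IsComposite M) (e : F = N ⋙ K.T a (n + 1) ⋙ K.T a n ⋙ M)
    {g' : 𝟭 C ⟶ N ⋙ (K.T a (n + 1) ⋙ K.T a n) ⋙ M} (hg : HEq g g') :
    Good B (N ⋙ M) (g' ≫ contraction N (K.adj a n).counit M) := by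
  induction h generalizing N M with
  | nil =>
    obtain ⟨-, h'⟩ := eq_id_of_comp hN ((isComposite_T _ _).comp ((isComposite_T _ _).comp hM)) e
    obtain ⟨m, hm⟩ := hM
    have h₁ : IsWord K.T (m ++ [(a, n), (a, n + 1)]) (𝟭 C) :=
      h' ▸ hm.append ((IsWord.single a n).append (.single a (n + 1)))
    simpa using K.unique h₁ .nil
  | @insert N' M' Ξ b m g₀ β hN' hM' h₀ hβ ih =>
    have hΞ := isComposite_grow hβ
    rcases pair_cases hN' hΞ hM' hN hM hβ.ne_id e with
      ⟨X, hX, rfl, rfl⟩ | ⟨X, hX, rfl, rfl, rfl⟩ | ⟨X, Y, hX, hY, rfl⟩ | ⟨X, hX, rfl, rfl, rfl⟩ |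
      ⟨X, hX, rfl, rfl⟩
    · obtain rfl := eq_of_heq hg
      refine (Good.insert hN' (hX.comp hM)
        (ih (N := N' ⋙ X) (hN'.comp hX) hM rfl .rfl) hβ).cast ?_
      have := whisker_exchange N' X M ((K.adj b m).unit ≫ β) (K.adj a n).counit
      exact (Category.assoc _ _ _).trans ((g₀ ≫= this.symm).trans (Category.assoc _ _ _).symm)
    -- the outermost leg of the last component is joined to a leg of an earlier one
    · obtain rfl := eq_of_heq hg
      refine (Good.grow (hβ.cut_outer hX rfl .rfl) h₀ hN' hM).cast ?_
      ext Z
      simp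
    -- both legs would belong to the last component
    · obtain ⟨e, he⟩ := hasShape_cap (K := K) b m
      exact (HasShape.not_ascending hX hY (hβ.hasShape he)).elim
    -- the innermost leg of the last component is joined to a leg of an earlier one
    · obtain rfl := eq_of_heq hg
      refine (Good.grow (N := N) (M := M') (hβ.cut_inner hX rfl .rfl) h₀ hN hM').cast ?_
      ext Z
      simp
    · obtain rfl := eq_of_heq hg
      refine (Good.insert (N := N ⋙ X) (hN.comp hX) hM'
        (ih (N := N) (M := X ⋙ M') hN (hX.comp hM') rfl .rfl) hβ).cast ?_
      have := whisker_exchange N X M' (K.adj a n).counit ((K.adj b m).unit ≫ β)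
      exact (Category.assoc _ _ _).trans ((g₀ ≫= this).trans (Category.assoc _ _ _).symm)

theorem Good.cup {N M : C ⥤ C} {a : A} {n : ℤ} {g : 𝟭 C ⟶ N ⋙ (K.T a (n + 1) ⋙ K.T a n) ⋙ M}
    (h : Good B (N ⋙ (K.T a (n + 1) ⋙ K.T a n) ⋙ M) g) (hN : K.IsComposite N)
    (hM : K.IsComposite M) : Good B (N ⋙ M) (g ≫ contraction N (K.adj a n).counit M) :=
  h.cup_aux hN hM rfl .rfl

end AdjointChains

/-! ### States with at most one leg of even degree -/

namespace AdjointChains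

variable {A : Type*} {C : Type u} [Category.{v} C] {K : AdjointChains A C} {B : Boxes K}

theorem T_ne_id (a : A) (n : ℤ) : K.T a n ≠ 𝟭 C := by
  intro h
  have h₁ : IsWord K.T [(a, n)] (𝟭 C) := h ▸ .single a n
  simpa using K.unique h₁ .nil

theorem HasShape.not_odd {e : ℤ} {F : C ⥤ C} (h : K.HasShape e F) (hF : K.Degrees Odd F) :
    False := by
  obtain ⟨he, L, x, R, hL, hR, rfl⟩ := h
  have h₁ := ((degrees_comp hR.isComposite ((isComposite_T _ _).comp hL.isComposite)).1 hF).2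
  have h₂ := degrees_T.1 ((degrees_comp (isComposite_T _ _) hL.isComposite).1 h₁).1
  exact Int.not_even_iff_odd.2 h₂ he

theorem Grow.not_odd {b : A} {m : ℤ} {F : C ⥤ C} {β : K.T b m ⋙ K.T b (m + 1) ⟶ F}
    (h : Grow B (K.T b m ⋙ K.T b (m + 1)) F β) (hF : K.Degrees Odd F) : False := by
  obtain ⟨e, he⟩ := hasShape_cap (K := K) b m
  exact (h.hasShape he).not_odd hF

/-- A good state all of whose legs have odd degree is trivial, since every component has a leg of
even degree. -/
theorem Good.eq_id {F : C ⥤ C} {g : 𝟭 C ⟶ F} (h : Good B F g) (hF : K.Degrees Odd F) :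
    F = 𝟭 C ∧ HEq g (𝟙 (𝟭 C)) := by
  cases h with
  | nil => exact ⟨rfl, .rfl⟩
  | insert hN hM _ hβ =>
    have hΞ := isComposite_grow hβ
    exact (hβ.not_odd ((degrees_comp hΞ hM).1 ((degrees_comp hN (hΞ.comp hM)).1 hF).2).1).elim

/-- A state with a single leg of even degree consists of a single component, which grows out of
that leg. -/
theorem Good.grow_of_odd {F : C ⥤ C} {g : 𝟭 C ⟶ F} (h : Good B F g) {a : A} {n : ℤ} {O : C ⥤ C}
    (hO : K.Degrees Odd O) (e : F = K.T a n ⋙ O) {g' : 𝟭 C ⟶ K.T a n ⋙ O} (hg : HEq g g') :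
    Grow B (K.T a (n + 1)) O ((bendR (K.adj a n) O).symm g') := by
  cases h with
  | nil =>
    exact (T_ne_id a n (eq_id_of_comp (isComposite_T _ _) hO.isComposite e).1).elim
  | @insert N M Ξ b m g₀ β hN hM h₀ hβ =>
    have hΞ := isComposite_grow hβ
    rcases factor_cases (N := 𝟭 C) hN hΞ hM isComposite_id hO.isComposite e with
      ⟨X, hX, rfl, e₁⟩ | ⟨X, Y, hX, hY, rfl, e₁, rfl⟩ | ⟨X, hX, rfl, rfl⟩
    · exact (not_id_eq hN hΞ hX hβ.ne_id e₁).elim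
    · obtain ⟨rfl, rfl⟩ := eq_id_of_comp hN hX e₁
      obtain ⟨hOY, hOM⟩ := (degrees_comp hY hM).1 hO
      obtain ⟨e₂, hg₀⟩ := h₀.eq_id hOM
      obtain rfl : M = 𝟭 C := e₂
      obtain rfl := eq_of_heq hg₀
      refine hβ.cut_inner hY rfl (HEq.trans (heq_of_eq ?_) hg)
      apply NatTrans.ext
      funext Z
      simp
    · exact (hβ.not_odd ((degrees_comp hΞ hM).1 ((degrees_comp hX (hΞ.comp hM)).1 hO).2).1).elim

/-! ### Types as endofunctors -/

/-- The composite of functors of the chains which interprets a pregroup type. The order of the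
factors of a tensor product is reversed in the dual types; the flag tells which order is meant, and
the integer is the degree of the basic types. -/
def E (K : AdjointChains A C) : PregroupType A → Bool → ℤ → C ⥤ C
  | .of a, _, n => K.T a n
  | .unit, _, _ => 𝟭 C
  | .tensor X Y, false, n => E K Y false n ⋙ E K X false n
  | .tensor X Y, true, n => E K X true n ⋙ E K Y true n
  | .left X, b, n => E K X (!b) (n - 1)
  | .right X, b, n => E K X (!b) (n + 1)

/-- Consecutive interpretations of a type are adjoint. -/
def adjE (K : AdjointChains A C) :
    ∀ (X : PregroupType A) (b : Bool) (n m : ℤ), m = n + 1 → (K.E X b n ⊣ K.E X (!b) m)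
  | .of a, _, n, _, h => h ▸ K.adj a n
  | .unit, _, _, _, _ => Adjunction.id
  | .tensor X Y, false, n, m, h => (adjE K Y false n m h).comp (adjE K X false n m h)
  | .tensor X Y, true, n, m, h => (adjE K X true n m h).comp (adjE K Y true n m h)
  | .left X, b, n, m, h => adjE K X (!b) (n - 1) (m - 1) (by omega)
  | .right X, b, n, m, h => adjE K X (!b) (n + 1) (m + 1) (by omega)

theorem isComposite_E (X : PregroupType A) (b : Bool) (n : ℤ) : K.IsComposite (K.E X b n) := by
  induction X generalizing b n with
  | of a => exact isComposite_T a n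
  | unit => exact isComposite_id
  | tensor X Y ihX ihY => cases b with
    | false => exact (ihY _ _).comp (ihX _ _)
    | true => exact (ihX _ _).comp (ihY _ _)
  | left X ih => exact ih _ _
  | right X ih => exact ih _ _

/-- The cap of a type is a nest of caps of basic types. -/
theorem Good.capE (X : PregroupType A) {b : Bool} {n m : ℤ} (e : m = n + 1) {N M : C ⥤ C}
    {g : 𝟭 C ⟶ N ⋙ M} (h : Good B (N ⋙ M) g) (hN : K.IsComposite N) (hM : K.IsComposite M) :
    Good B (N ⋙ (K.E X b n ⋙ K.E X (!b) m) ⋙ M) (g ≫ insertion N (K.adjE X b n m e).unit M) := by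
  induction X generalizing b n m N M with
  | of a =>
    subst e
    exact h.cap hN hM a n
  | unit =>
    refine Good.cast (F := N ⋙ M) h ?_
    ext Z
    simp only [adjE, NatTrans.comp_app]
    exact ((g.app Z ≫= M.map_id _).trans (Category.comp_id _)).symm
  | tensor X Y ihX ihY => cases b with
    | false =>
      have h₁ := ihY (b := false) e h hN hM
      have h₂ := ihX (b := false) (N := N ⋙ K.E Y false n) (M := K.E Y true m ⋙ M) e h₁
        (hN.comp (isComposite_E _ _ _)) ((isComposite_E _ _ _).comp hM)
      refine h₂.cast ?_
      ext Z
      simp only [adjE, NatTrans.comp_app, Adjunction.comp_unit_app, Functor.whiskerLeft_app,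
        Functor.whiskerRight_app, Category.assoc]
      exact congrArg (fun k => g.app Z ≫ k) (M.map_comp _ _).symm
    | true =>
      have h₁ := ihX (b := true) e h hN hM
      have h₂ := ihY (b := true) (N := N ⋙ K.E X true n) (M := K.E X false m ⋙ M) e h₁
        (hN.comp (isComposite_E _ _ _)) ((isComposite_E _ _ _).comp hM)
      refine h₂.cast ?_
      ext Z
      simp only [adjE, NatTrans.comp_app, Adjunction.comp_unit_app, Functor.whiskerLeft_app,
        Functor.whiskerRight_app, Category.assoc]
      exact congrArg (fun k => g.app Z ≫ k) (M.map_comp _ _).symm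
  | left X ih => exact ih _ h hN hM
  | right X ih => exact ih _ h hN hM

/-- The cup of a type is a nest of cups of basic types. -/
theorem Good.cupE (X : PregroupType A) {b : Bool} {n m : ℤ} (e : m = n + 1) {N M : C ⥤ C}
    {g : 𝟭 C ⟶ N ⋙ (K.E X (!b) m ⋙ K.E X b n) ⋙ M}
    (h : Good B (N ⋙ (K.E X (!b) m ⋙ K.E X b n) ⋙ M) g) (hN : K.IsComposite N)
    (hM : K.IsComposite M) : Good B (N ⋙ M) (g ≫ contraction N (K.adjE X b n m e).counit M) := by
  induction X generalizing b n m N M with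
  | of a =>
    subst e
    exact h.cup hN hM
  | unit =>
    refine Good.cast (F := N ⋙ M) h ?_
    ext Z
    simp only [adjE, NatTrans.comp_app]
    exact ((g.app Z ≫= M.map_id _).trans (Category.comp_id _)).symm
  | tensor X Y ihX ihY => cases b with
    | false =>
      have h₁ := ihY (N := N ⋙ K.E X true m) (M := K.E X false n ⋙ M) e h
        (hN.comp (isComposite_E _ _ _)) ((isComposite_E _ _ _).comp hM)
      have h₂ := ihX (N := N) (M := M) e h₁ hN hM
      refine h₂.cast ?_
      ext Z
      simp only [adjE, Adjunction.comp_counit_app, NatTrans.comp_app, Functor.whiskerLeft_app,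
        Functor.whiskerRight_app]
      change (g.app Z ≫ M.map ((K.E X false n).map ((K.adjE Y false n m e).counit.app
        ((K.E X true m).obj (N.obj Z))))) ≫ _ = _
      exact (Category.assoc _ _ _).trans (congrArg (fun k => g.app Z ≫ k) (M.map_comp _ _).symm)
    | true =>
      have h₁ := ihX (N := N ⋙ K.E Y false m) (M := K.E Y true n ⋙ M) e h
        (hN.comp (isComposite_E _ _ _)) ((isComposite_E _ _ _).comp hM)
      have h₂ := ihY (N := N) (M := M) e h₁ hN hM
      refine h₂.cast ?_
      ext Z
      simp only [adjE, Adjunction.comp_counit_app, NatTrans.comp_app, Functor.whiskerLeft_app,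
        Functor.whiskerRight_app]
      change (g.app Z ≫ M.map ((K.E Y true n).map ((K.adjE X true n m e).counit.app
        ((K.E Y false m).obj (N.obj Z))))) ≫ _ = _
      exact (Category.assoc _ _ _).trans (congrArg (fun k => g.app Z ≫ k) (M.map_comp _ _).symm)
  | left X ih => exact ih _ h hN hM
  | right X ih => exact ih _ h hN hM

end AdjointChains

/-! ### Tensoring in the free rigid category -/

namespace RigidSignature

open MonoidalCategory AdjointChains

variable {A : Type u} (S : RigidSignature.{u, v} A)

/-- The iterated right adjoints of a basic type, or left adjoints in negative degrees. -/
def iterated (a : A) : ℤ → PregroupType A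
  | .ofNat n => PregroupType.right^[n] (.of a)
  | .negSucc n => PregroupType.left^[n + 1] (.of a)

/-- Recovers a basic type and a degree from an iterated adjoint. -/
def degree : PregroupType A → Option (A × ℤ)
  | .of a => some (a, 0)
  | .unit => none
  | .tensor _ _ => none
  | .left t => (degree t).map fun p => (p.1, p.2 - 1)
  | .right t => (degree t).map fun p => (p.1, p.2 + 1)

theorem degree_iterated (a : A) (n : ℤ) : degree (iterated a n) = some (a, n) := by
  cases n with
  | ofNat n =>
    show degree (PregroupType.right^[n] (.of a)) = some (a, (n : ℤ))
    induction n with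
    | zero => rfl
    | succ n ih => simp [Function.iterate_succ_apply', degree, ih]
  | negSucc n =>
    show degree (PregroupType.left^[n + 1] (.of a)) = _
    induction n with
    | zero => rfl
    | succ n ih =>
      rw [Function.iterate_succ_apply', degree, ih]
      simp [Int.negSucc_eq]
      omega

/-- Tensoring with `X` is left adjoint to tensoring with `Xʳ`. -/
def tensorRightDual (X : FreeRigid S) :
    tensorLeft X ⊣ tensorLeft (C := FreeRigid S) (PregroupType.right X) :=
  tensorLeftAdjunction (C := FreeRigid S) (HasLeftDual.leftDual X) X

/-- Tensoring with `Xˡ` is left adjoint to tensoring with `X`. -/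
def tensorLeftDual (X : FreeRigid S) :
    tensorLeft (C := FreeRigid S) (PregroupType.left X) ⊣ tensorLeft X :=
  tensorLeftAdjunction (C := FreeRigid S) X (HasRightDual.rightDual X)

theorem iterated_right (a : A) (n : ℕ) :
    iterated a (Int.ofNat n + 1) = .right (iterated a (.ofNat n)) :=
  Function.iterate_succ_apply' _ _ _

theorem iterated_left (a : A) (n : ℕ) :
    iterated a (.negSucc n) = .left (iterated a (Int.negSucc n + 1)) := by
  cases n with
  | zero => rfl
  | succ n => exact Function.iterate_succ_apply' _ _ _

/-- The functors of tensoring with iterated adjoints of basic types. -/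
def chain (a : A) (n : ℤ) : FreeRigid S ⥤ FreeRigid S :=
  tensorLeft (C := FreeRigid S) (iterated a n)

theorem isWord_chain_obj {l : List (A × ℤ)} {F : FreeRigid S ⥤ FreeRigid S}
    (h : IsWord S.chain l F) :
    F.obj (PregroupType.unit : PregroupType A) =
      l.foldr (fun p t => PregroupType.tensor (iterated p.1 p.2) t) .unit := by
  induction h with
  | nil => rfl
  | cons a n _ ih => exact congrArg (PregroupType.tensor (iterated a n)) ih

/-- The chains of functors of tensoring with iterated adjoints of basic types. A composite of them
has a unique factorization, since its value at the unit is the iterated tensor product of types. -/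
def chains : AdjointChains A (FreeRigid S) where
  T := S.chain
  adj a n := match n with
    | .ofNat n =>
      (S.tensorRightDual (iterated a (.ofNat n))).ofNatIsoRight
        (eqToIso (congrArg (tensorLeft (C := FreeRigid S)) (iterated_right a n).symm))
    | .negSucc n =>
      (S.tensorLeftDual (iterated a (Int.negSucc n + 1))).ofNatIsoLeft
        (eqToIso (congrArg (tensorLeft (C := FreeRigid S)) (iterated_left a n).symm))
  unique {l l' F} h h' := by
    have e := (S.isWord_chain_obj h).symm.trans (S.isWord_chain_obj h')
    clear h h'
    induction l generalizing l' with
    | nil => cases l' with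
      | nil => rfl
      | cons p l' => simp at e
    | cons p l ih => cases l' with
      | nil => simp at e
      | cons p' l' =>
        obtain ⟨e₁, e₂⟩ := PregroupType.tensor.inj e
        have h := congrArg degree e₁
        simp only [degree_iterated, Option.some.injEq] at h
        exact congrArg₂ List.cons h (ih e₂)

/-- Tensoring with a type is isomorphic to the composite of functors that interprets the type. -/
def interp : ∀ X : PregroupType A, tensorLeft (C := FreeRigid S) X ≅ S.chains.E X false 0
  | .of a => Iso.refl (S.chain a 0)
  | .unit => leftUnitorNatIso (FreeRigid S)
  | .tensor X Y => tensorLeftTensor (C := FreeRigid S) X Y ≪≫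
      Functor.isoWhiskerRight (interp Y) (tensorLeft (C := FreeRigid S) X) ≪≫
      Functor.isoWhiskerLeft (S.chains.E Y false 0) (interp X)
  | .left X => (conjugateIsoEquiv (S.chains.adjE X true (0 - 1) 0 rfl) (S.tensorLeftDual X)).symm
      (interp X).symm
  | .right X => conjugateIsoEquiv (S.tensorRightDual X) (S.chains.adjE X false 0 (0 + 1) rfl)
      (interp X).symm

end RigidSignature

/-! ### Morphisms as transformations of endofunctors -/

namespace RigidSignature

open MonoidalCategory AdjointChains

/-! The following equations in a monoidal category are the naturality squares of `hat_eq` for the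
structural morphisms, for tensor products, and for cups and caps. -/

section

variable {D : Type u} [Category.{v} D] [MonoidalCategory D]

theorem interp_aux_tensor {X Y X' Y' Z P Q R T U : D} {f : X ⟶ Y} {g : X' ⟶ Y'} {a : X' ⊗ Z ⟶ P}
    {b : X ⊗ P ⟶ R} {a' : Y' ⊗ Z ⟶ Q} {b' : Y ⊗ P ⟶ T} {c : Y ⊗ Q ⟶ U} {k : R ⟶ T} {m : P ⟶ Q}
    {n : T ⟶ U} (h₃ : f ▷ P ≫ b' = b ≫ k) (h₄ : Y ◁ m ≫ c = b' ≫ n) (h₅ : g ▷ Z ≫ a' = a ≫ m) :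
    (f ⊗ₘ g) ▷ Z ≫ (α_ Y Y' Z).hom ≫ Y ◁ a' ≫ c =
      ((α_ X X' Z).hom ≫ X ◁ a ≫ b) ≫ k ≫ n := by
  simp only [Category.assoc]
  rw [← reassoc_of% h₃, ← h₄, ← whisker_exchange_assoc, ← whiskerLeft_comp_assoc, ← h₅,
    whisker_exchange_assoc]
  simp [MonoidalCategory.tensorHom_def]

theorem interp_aux_assoc {X Y Z W P Q R : D} (p : Z ⊗ W ⟶ P) (q : Y ⊗ P ⟶ Q) (r : X ⊗ Q ⟶ R) :
    (α_ X Y Z).hom ▷ W ≫ (α_ X (Y ⊗ Z) W).hom ≫ X ◁ ((α_ Y Z W).hom ≫ Y ◁ p ≫ q) ≫ r =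
      ((α_ (X ⊗ Y) Z W).hom ≫ (X ⊗ Y) ◁ p ≫ (α_ X Y P).hom ≫ X ◁ q ≫ r) ≫ 𝟙 _ := by
  simp

theorem interp_aux_left {X Z P : D} (x : X ⊗ Z ⟶ P) :
    (λ_ X).hom ▷ Z ≫ x = ((α_ (𝟙_ D) X Z).hom ≫ 𝟙_ D ◁ x ≫ (λ_ P).hom) ≫ 𝟙 _ := by
  simp

theorem interp_aux_right {X Z P : D} (x : X ⊗ Z ⟶ P) :
    (ρ_ X).hom ▷ Z ≫ x = ((α_ X (𝟙_ D) Z).hom ≫ X ◁ (λ_ Z).hom ≫ x) ≫ 𝟙 _ := by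
  simp

theorem interp_aux_cupLeft {L X Z P Q : D} {e : L ⊗ X ⟶ 𝟙_ D} {i : X ⊗ Z ≅ P} {j : L ⊗ P ⟶ Q}
    {c : Q ⟶ Z}
    (h : L ◁ i.inv ≫ (α_ L X Z).inv ≫ e ▷ Z ≫ (λ_ Z).hom = j ≫ c) :
    e ▷ Z ≫ (λ_ Z).hom = ((α_ L X Z).hom ≫ L ◁ i.hom ≫ j) ≫ c := by
  simp only [Category.assoc, ← h]
  simp

theorem interp_aux_capLeft {L X Z P Q : D} {e : 𝟙_ D ⟶ X ⊗ L} {i : X ⊗ P ≅ Q} {j : L ⊗ Z ⟶ P}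
    {c : Z ⟶ Q}
    (h : c ≫ i.inv = ((λ_ Z).inv ≫ e ▷ Z ≫ (α_ X L Z).hom) ≫ X ◁ j) :
    e ▷ Z ≫ (α_ X L Z).hom ≫ X ◁ j ≫ i.hom = (λ_ Z).hom ≫ c := by
  rw [Iso.comp_inv_eq] at h
  simp [h]

theorem interp_aux_cupRight {R X Z P Q T : D} {e : X ⊗ R ⟶ 𝟙_ D} {j : R ⊗ Z ⟶ P} {i : X ⊗ P ⟶ Q}
    {c : Q ⟶ Z} {i' : X ⊗ R ⊗ Z ≅ T} {k : T ⟶ Q} (hn : X ◁ j ≫ i = i'.hom ≫ k)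
    (h : k ≫ c = i'.inv ≫ (α_ X R Z).inv ≫ e ▷ Z ≫ (λ_ Z).hom) :
    e ▷ Z ≫ (λ_ Z).hom = ((α_ X R Z).hom ≫ X ◁ j ≫ i) ≫ c := by
  simp [hn, h]

theorem interp_aux_capRight {R X Z P Q T : D} {e : 𝟙_ D ⟶ R ⊗ X} {i : X ⊗ Z ≅ P} {j : R ⊗ P ⟶ Q}
    {c : Z ⟶ Q} {j' : R ⊗ X ⊗ Z ⟶ T} {k : Q ⟶ T} (hk : IsIso k) (hn : R ◁ i.inv ≫ j' = j ≫ k)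
    (h : ((λ_ Z).inv ≫ e ▷ Z ≫ (α_ R X Z).hom) ≫ j' = c ≫ k) :
    e ▷ Z ≫ (α_ R X Z).hom ≫ R ◁ i.hom ≫ j = (λ_ Z).hom ≫ c := by
  rw [← cancel_mono k]
  simp [← hn, ← h]

end

variable {A : Type u} {S : RigidSignature.{u, v} A}

/-- A morphism `f`, in the form `f ⊗ -`, as a natural transformation between the functors which
interpret its domain and codomain. -/
def hat {X Y : FreeRigid S} (f : X ⟶ Y) : S.chains.E X false 0 ⟶ S.chains.E Y false 0 :=
  (S.interp X).inv ≫ (curriedTensor (FreeRigid S)).map f ≫ (S.interp Y).hom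

theorem hat_eq {X Y : FreeRigid S} {f : X ⟶ Y}
    {θ : S.chains.E X false 0 ⟶ S.chains.E Y false 0}
    (h : ∀ Z, f ▷ Z ≫ (S.interp Y).hom.app Z = (S.interp X).hom.app Z ≫ θ.app Z) : hat f = θ := by
  rw [hat, Iso.inv_comp_eq]
  ext Z
  exact h Z

theorem whiskerRight_interp {X Y : FreeRigid S} (f : X ⟶ Y) (Z : FreeRigid S) :
    f ▷ Z ≫ (S.interp Y).hom.app Z = (S.interp X).hom.app Z ≫ (hat f).app Z := by
  have h : (curriedTensor (FreeRigid S)).map f ≫ (S.interp Y).hom = (S.interp X).hom ≫ hat f := by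
    simp [hat]
  exact congrArg (fun α => α.app Z) h

theorem hat_injective {X Y : FreeRigid S} {f g : X ⟶ Y} (h : hat f = hat g) : f = g := by
  have h₁ : f ▷ 𝟙_ (FreeRigid S) = g ▷ 𝟙_ (FreeRigid S) := by
    rw [← cancel_mono ((S.interp Y).hom.app (𝟙_ (FreeRigid S))), whiskerRight_interp, h,
      whiskerRight_interp]
  simpa using h₁

theorem hat_id (X : FreeRigid S) : hat (𝟙 X) = 𝟙 _ := by
  simp [hat]

theorem hat_comp {X Y Z : FreeRigid S} (f : X ⟶ Y) (g : Y ⟶ Z) : hat (f ≫ g) = hat f ≫ hat g := by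
  simp [hat]

theorem hat_tensor {X Y X' Y' : FreeRigid S} (f : X ⟶ Y) (g : X' ⟶ Y') :
    hat (f ⊗ₘ g) = hat g ◫ hat f := by
  apply hat_eq
  intro Z
  exact interp_aux_tensor (whiskerRight_interp f ((S.chains.E X' false 0).obj Z))
    ((S.interp Y).hom.naturality ((hat g).app Z)) (whiskerRight_interp g Z)

theorem hat_assocHom (X Y Z : FreeRigid S) :
    hat (α_ X Y Z).hom =
      𝟙 (S.chains.E Z false 0 ⋙ S.chains.E Y false 0 ⋙ S.chains.E X false 0) := by
  apply hat_eq
  intro W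
  exact interp_aux_assoc ((S.interp Z).hom.app W) ((S.interp Y).hom.app _)
    ((S.interp X).hom.app _)

theorem hat_assocInv (X Y Z : FreeRigid S) :
    hat (α_ X Y Z).inv =
      𝟙 (S.chains.E Z false 0 ⋙ S.chains.E Y false 0 ⋙ S.chains.E X false 0) := by
  have h := hat_comp (α_ X Y Z).hom (α_ X Y Z).inv
  rw [Iso.hom_inv_id, hat_id, hat_assocHom] at h
  exact ((Category.id_comp _).symm.trans h.symm)

theorem hat_leftUnitHom (X : FreeRigid S) : hat (λ_ X).hom = 𝟙 (S.chains.E X false 0) := by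
  apply hat_eq
  intro Z
  exact interp_aux_left ((S.interp X).hom.app Z)

theorem hat_leftUnitInv (X : FreeRigid S) : hat (λ_ X).inv = 𝟙 (S.chains.E X false 0) := by
  have h := hat_comp (λ_ X).hom (λ_ X).inv
  rw [Iso.hom_inv_id, hat_id, hat_leftUnitHom] at h
  exact ((Category.id_comp _).symm.trans h.symm)

theorem hat_rightUnitHom (X : FreeRigid S) : hat (ρ_ X).hom = 𝟙 (S.chains.E X false 0) := by
  apply hat_eq
  intro Z
  exact interp_aux_right ((S.interp X).hom.app Z)

theorem hat_rightUnitInv (X : FreeRigid S) : hat (ρ_ X).inv = 𝟙 (S.chains.E X false 0) := by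
  have h := hat_comp (ρ_ X).hom (ρ_ X).inv
  rw [Iso.hom_inv_id, hat_id, hat_rightUnitHom] at h
  exact ((Category.id_comp _).symm.trans h.symm)

theorem tensorLeftDual_counit (X Z : FreeRigid S) :
    (S.tensorLeftDual X).counit.app Z =
      (α_ (Xᘁ) X Z).inv ≫ (ε_ X (Xᘁ)) ▷ Z ≫ (λ_ Z).hom := by
  simp [tensorLeftDual, tensorLeftAdjunction, tensorLeftHomEquiv]

theorem tensorLeftDual_unit (X Z : FreeRigid S) :
    (S.tensorLeftDual X).unit.app Z =
      (λ_ Z).inv ≫ (η_ X (Xᘁ)) ▷ Z ≫ (α_ X (Xᘁ) Z).hom := by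
  simp [tensorLeftDual, tensorLeftAdjunction, tensorLeftHomEquiv]
  exact _ ≫= ((_ ≫= whiskerLeft_id X _).trans (Category.comp_id _))

theorem tensorRightDual_counit (X Z : FreeRigid S) :
    (S.tensorRightDual X).counit.app Z =
      (α_ X (ᘁX) Z).inv ≫ (ε_ (ᘁX) X) ▷ Z ≫ (λ_ Z).hom := by
  simp [tensorRightDual, tensorLeftAdjunction, tensorLeftHomEquiv]

theorem tensorRightDual_unit (X Z : FreeRigid S) :
    (S.tensorRightDual X).unit.app Z =
      (λ_ Z).inv ≫ (η_ (ᘁX) X) ▷ Z ≫ (α_ (ᘁX) X Z).hom := by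
  simp [tensorRightDual, tensorLeftAdjunction, tensorLeftHomEquiv]

theorem hat_cupLeft (X : PregroupType A) :
    hat (S := S) (Hom.mk (Term.cupLeft X)) = (S.chains.adjE X true (0 - 1) 0 rfl).counit := by
  apply hat_eq
  intro Z
  have h := conjugateEquiv_counit_symm (S.chains.adjE X true (0 - 1) 0 rfl) (S.tensorLeftDual X)
    (S.interp X).inv Z
  exact interp_aux_cupLeft (i := (S.interp X).app Z)
    ((_ ≫= (tensorLeftDual_counit X Z).symm).trans h)

theorem hat_cupRight (X : PregroupType A) :
    hat (S := S) (Hom.mk (Term.cupRight X)) = (S.chains.adjE X false 0 (0 + 1) rfl).counit := by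
  apply hat_eq
  intro Z
  have h := conjugateEquiv_counit (S.tensorRightDual X) (S.chains.adjE X false 0 (0 + 1) rfl)
    (S.interp X).inv Z
  exact interp_aux_cupRight (i' := (S.interp X).app _)
    ((S.interp X).hom.naturality ((S.interp (PregroupType.right X)).hom.app Z))
    (h.trans (_ ≫= tensorRightDual_counit X Z))

theorem hat_capLeft (X : PregroupType A) :
    hat (S := S) (Hom.mk (Term.capLeft X)) = (S.chains.adjE X true (0 - 1) 0 rfl).unit := by
  apply hat_eq
  intro Z
  have h := unit_conjugateEquiv_symm (S.chains.adjE X true (0 - 1) 0 rfl) (S.tensorLeftDual X)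
    (S.interp X).inv Z
  exact interp_aux_capLeft (i := (S.interp X).app _)
    (h.trans (tensorLeftDual_unit X Z =≫ _))

theorem hat_capRight (X : PregroupType A) :
    hat (S := S) (Hom.mk (Term.capRight X)) = (S.chains.adjE X false 0 (0 + 1) rfl).unit := by
  apply hat_eq
  intro Z
  have h := unit_conjugateEquiv (S.tensorRightDual X) (S.chains.adjE X false 0 (0 + 1) rfl)
    (S.interp X).inv Z
  have hi : IsIso ((S.interp X).inv.app Z) := ((S.interp X).symm.app Z).isIso_hom
  have hk : IsIso ((S.chains.E (PregroupType.right X) false 0).map ((S.interp X).inv.app Z)) :=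
    Functor.map_isIso _ _
  exact interp_aux_capRight (i := (S.interp X).app Z)
    hk
    ((S.interp (PregroupType.right X)).hom.naturality ((S.interp X).inv.app Z))
    (((tensorRightDual_unit X Z).symm =≫ _).trans h)

end RigidSignature

/-! ### Transformations that preserve good states -/

namespace Bending

variable {C : Type u} [Category.{v} C]

theorem bendR_conjugateEquiv {F G F' G' : C ⥤ C} (adj : F ⊣ G) (adj' : F' ⊣ G') (μ : F' ⟶ F) :
    bendR adj G' (conjugateEquiv adj adj' μ) = bendL adj' F μ := by
  ext Z
  exact unit_conjugateEquiv adj adj' μ Z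

theorem rotate_bendL {F G K H : C ⥤ C} (adj : F ⊣ G) (adj' : G ⊣ K) (μ : G ⟶ H) :
    rotate adj adj' H (bendL adj' H μ) = bendR adj H μ := by
  simp [rotate]

theorem bendL_comp {F G F' G' H : C ⥤ C} (adj : F ⊣ G) (adj' : F' ⊣ G') (μ : F ⋙ F' ⟶ H) :
    bendL (adj.comp adj') H μ = bendL adj (H ⋙ G') (curry adj' F H μ) := by
  ext Z
  simp

/-- A transformation `l` with values in a composite with adjoints on both sides is recovered from
the result of contracting these. -/
theorem bendR_curry_contract {L E₁ W W' X E₂ O : C ⥤ C} (adjL : L ⊣ E₁) (adjW : W ⊣ W')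
    (adjR : E₂ ⊣ O) (l : W ⟶ L ⋙ X ⋙ O) :
    bendR adjL (X ⋙ O ⋙ W') (curry (adjW.comp adjR) E₁ X
      (whisker E₁ l E₂ ≫ Functor.whiskerRight adjL.counit (X ⋙ O ⋙ E₂) ≫
        Functor.whiskerLeft X adjR.counit)) =
      bendL adjW (L ⋙ X ⋙ O) l := by
  ext Z
  have h := l.naturality (adjL.unit.app Z)
  have h' := adjW.unit.naturality (adjL.unit.app Z)
  simp only [Functor.comp_obj, Functor.comp_map, Functor.id_obj, Functor.id_map] at h h'
  have key : adjR.unit.app (W.obj (E₁.obj (L.obj Z))) ≫ O.map (E₂.map (l.app (E₁.obj (L.obj Z)))) ≫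
      O.map (adjR.counit.app (X.obj (L.obj (E₁.obj (L.obj Z))))) = l.app (E₁.obj (L.obj Z)) := by
    simp
  simp only [bendR_app, curry_app, Adjunction.comp_unit_app, Functor.comp_obj, Functor.comp_map,
    NatTrans.comp_app, Functor.whiskerLeft_app, Functor.whiskerRight_app, Functor.id_obj,
    Functor.map_comp, Category.assoc, bendL_app]
  rw [reassoc_of% h']
  simp only [← Functor.map_comp]
  rw [Adjunction.counit_naturality, O.map_comp, O.map_comp, reassoc_of% key, reassoc_of% h]
  simp [← Functor.map_comp]

theorem rotate_id (H : C ⥤ C) (s : 𝟭 C ⟶ H ⋙ 𝟭 C) :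
    rotate Adjunction.id Adjunction.id H s = s := by
  ext Z
  simp [rotate]

theorem rotate_comp {L₁ E₁ O₁ L₂ E₂ O₂ : C ⥤ C} (a₁ : L₁ ⊣ E₁) (b₁ : E₁ ⊣ O₁) (a₂ : L₂ ⊣ E₂)
    (b₂ : E₂ ⊣ O₂) (H : C ⥤ C) (s : 𝟭 C ⟶ H ⋙ O₁ ⋙ O₂) :
    rotate (a₁.comp a₂) (b₂.comp b₁) H s = rotate a₁ b₁ (L₂ ⋙ H) (rotate a₂ b₂ (H ⋙ O₁) s) := by
  ext Z
  simp [rotate]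

end Bending

namespace AdjointChains

variable {A : Type*} {C : Type u} [Category.{v} C] {K : AdjointChains A C} {B : Boxes K}

variable (B) in
/-- The transformation `α`, applied in any context, preserves good states. -/
def Preserves {F H : C ⥤ C} (α : F ⟶ H) : Prop :=
  ∀ ⦃N M : C ⥤ C⦄ ⦃g : 𝟭 C ⟶ N ⋙ F ⋙ M⦄, K.IsComposite N → K.IsComposite M →
    Good B (N ⋙ F ⋙ M) g → Good B (N ⋙ H ⋙ M) (g ≫ whisker N α M)

theorem preserves_id (F : C ⥤ C) : Preserves B (𝟙 F) := by
  intro N M g _ _ h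
  exact h.cast (by ext Z; simp)

theorem Preserves.comp {F H J : C ⥤ C} {α : F ⟶ H} {β : H ⟶ J} (hα : Preserves B α)
    (hβ : Preserves B β) : Preserves B (α ≫ β) := by
  intro N M g hN hM h
  exact (hβ hN hM (hα hN hM h)).cast (by ext Z; simp)

theorem Preserves.hcomp {F H F' H' : C ⥤ C} {α : F ⟶ H} {β : F' ⟶ H'} (hα : Preserves B α)
    (hβ : Preserves B β) (hF : K.IsComposite F) (hH' : K.IsComposite H') :
    Preserves B (α ◫ β) := by
  intro N M g hN hM h
  have h₁ := hβ (N := N ⋙ F) (M := M) (hN.comp hF) hM h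
  exact (hα (N := N) (M := H' ⋙ M) hN (hH'.comp hM) h₁).cast (by ext Z; simp)

/-! ### Lists of basic types -/

variable {D : Type*} (f : D → A)

/-- The adjunction between a string and its right adjoint. -/
def adjR (K : AdjointChains A C) :
    ∀ y : List D, K.E ((PregroupType.ofList y).map f) false 0 ⊣
      K.E ((PregroupType.rightList y).map f) false 0
  | [] => Adjunction.id
  | b :: y => (adjR K y).comp (K.adjE (.of (f b)) false 0 (0 + 1) rfl)

/-- The adjunction between the left adjoint of a string and the string. -/
def adjL (K : AdjointChains A C) :
    ∀ z : List D, K.E ((PregroupType.leftList z).map f) false 0 ⊣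
      K.E ((PregroupType.ofList z).map f) false 0
  | [] => Adjunction.id
  | b :: z => (K.adjE (.of (f b)) true (0 - 1) 0 rfl).comp (adjL K z)

theorem State.cast {F : C ⥤ C} {s s' : 𝟭 C ⟶ F} (h : State B F s) (e : s = s') : State B F s' :=
  e ▸ h

/-- Moving the outermost legs of a state, given by a list, to the innermost place. -/
theorem State.turnList (z : List D) {Ψ : C ⥤ C} (hΨ : K.IsComposite Ψ)
    {s : 𝟭 C ⟶ Ψ ⋙ K.E ((PregroupType.rightList z).map f) false 0} (h : State B _ s) :
    State B (K.E ((PregroupType.leftList z).map f) false 0 ⋙ Ψ)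
      (rotate (K.adjL f z) (K.adjR f z) Ψ s) := by
  induction z generalizing Ψ with
  | nil =>
    exact State.cast h (rotate_id Ψ s).symm
  | cons b z ih =>
    have h₁ := ih (Ψ := Ψ ⋙ K.T (f b) (0 + 1)) (hΨ.comp (isComposite_T _ _)) h
    have h₂ := State.turn (n := 0 - 1) (a := f b)
      (Ψ := K.E ((PregroupType.leftList z).map f) false 0 ⋙ Ψ) h₁ ((isComposite_E _ _ _).comp hΨ)
    exact h₂.cast (rotate_comp _ _ _ _ Ψ s).symm

end AdjointChains

namespace RigidSignature

open MonoidalCategory AdjointChains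

variable {A : Type u} {S : RigidSignature.{u, v} A} {B : Boxes S.chains}

/-- Structural morphisms become identities, cups and caps preserve good states, and so do all
morphisms as soon as the generators do. -/
theorem preserves_hat (hB : ∀ g : S.Gen, Preserves B (hat (S := S) (Hom.mk (Term.gen g))))
    {X Y : PregroupType A} (f : Term S X Y) : Preserves B (hat (S := S) (Hom.mk f)) := by
  induction f with
  | gen g => exact hB g
  | id X => exact (hat_id (S := S) X) ▸ preserves_id _
  | comp f g hf hg => exact (hat_comp (S := S) (Hom.mk f) (Hom.mk g)) ▸ hf.comp hg
  | tensor f g hf hg =>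
    exact (hat_tensor (S := S) (Hom.mk f) (Hom.mk g)) ▸
      hg.hcomp hf (isComposite_E _ _ _) (isComposite_E _ _ _)
  | assocHom X Y Z => exact (hat_assocHom (S := S) X Y Z) ▸ preserves_id _
  | assocInv X Y Z => exact (hat_assocInv (S := S) X Y Z) ▸ preserves_id _
  | leftUnitHom X => exact (hat_leftUnitHom (S := S) X) ▸ preserves_id _
  | leftUnitInv X => exact (hat_leftUnitInv (S := S) X) ▸ preserves_id _
  | rightUnitHom X => exact (hat_rightUnitHom (S := S) X) ▸ preserves_id _
  | rightUnitInv X => exact (hat_rightUnitInv (S := S) X) ▸ preserves_id _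
  | cupLeft X =>
    rw [hat_cupLeft]
    intro N M g hN hM h
    exact Good.cupE X (b := true) rfl h hN hM
  | capLeft X =>
    rw [hat_capLeft]
    intro N M g hN hM h
    exact Good.capE X (b := true) rfl h hN hM
  | cupRight X =>
    rw [hat_cupRight]
    intro N M g hN hM h
    exact Good.cupE X (b := false) rfl h hN hM
  | capRight X =>
    rw [hat_capRight]
    intro N M g hN hM h
    exact Good.capE X (b := false) rfl h hN hM

end RigidSignature

/-! ### The transformations of cups and of linked words -/

namespace Bending

variable {C : Type u} [Category.{v} C]

theorem counit_comp_of_cups {E O T T' : C ⥤ C} (adj : E ⊣ O) (adj' : T ⊣ T') :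
    𝟙 ((T' ⋙ O ⋙ E) ⋙ T) ≫
      ((𝟙 (T' ⋙ O ⋙ E) ≫ (𝟙 T' ◫ adj.counit) ≫ 𝟙 T') ◫ 𝟙 T) ≫ adj'.counit =
      (adj.comp adj').counit := by
  ext Z
  simp

theorem counit_comp_of_cups' {L E T T' : C ⥤ C} (adj : L ⊣ E) (adj' : T ⊣ T') :
    𝟙 ((E ⋙ T' ⋙ T) ⋙ L) ≫
      ((𝟙 (E ⋙ T' ⋙ T) ≫ (𝟙 E ◫ adj'.counit) ≫ 𝟙 E) ◫ 𝟙 L) ≫ adj.counit =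
      (adj'.comp adj).counit := by
  ext Z
  simp

theorem contraction_of_link {L E X O E' W : C ⥤ C} (l : W ⟶ L ⋙ X ⋙ O) (c : E ⋙ L ⟶ 𝟭 C)
    (d : O ⋙ E' ⟶ 𝟭 C) :
    ((𝟙 E ◫ l) ◫ 𝟙 E') ≫
      ((𝟙 ((E ⋙ L ⋙ X) ⋙ O) ≫ ((𝟙 ((E ⋙ L) ⋙ X) ≫ (c ◫ 𝟙 X) ≫ 𝟙 X) ◫ 𝟙 O)) ◫ 𝟙 E') ≫
      𝟙 (X ⋙ O ⋙ E') ≫ (𝟙 X ◫ d) ≫ 𝟙 X =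
    whisker E l E' ≫ Functor.whiskerRight c (X ⋙ O ⋙ E') ≫ Functor.whiskerLeft X d := by
  ext Z
  simp

end Bending

namespace DependencyGrammar

open MonoidalCategory AdjointChains RigidSignature

variable {V : Type u} {B : Type v} (G : DependencyGrammar V B) {B' : Type v} (ι : B → B') (s : B')

/-- The word `w`, with arguments on both sides, is linked to its arguments. -/
def linkWord {w : V} {x : B} {y z : List B} (hII : (w, x) ∈ G.typeII) (hI : (x, y, z) ∈ G.typeI) :
    (G.pregroup ι s).Tm (.tensor (PregroupGrammar.ob (.ofList (y.map ι)))
      (.tensor (.of (.inr w)) (PregroupGrammar.ob (.ofList (z.map ι)))))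
      (PregroupGrammar.ob (.of (ι x))) :=
  .comp (.tensor (.id _) (.tensor
    ((G.pregroup ι s).lex w (.operadic (y.map ι) (ι x) (z.map ι)) ⟨x, y, z, hII, hI, rfl⟩) (.id _)))
    ((G.pregroup ι s).link (y.map ι) (ι x) (z.map ι))

/-- The rigid signature of the pregroup grammar of `G`. -/
abbrev sig : RigidSignature (B' ⊕ V) := (G.pregroup ι s).signature

/-- The chains of endofunctors of the free rigid category of `G`. -/
abbrev K : AdjointChains (B' ⊕ V) (FreeRigid (G.sig ι s)) := (G.sig ι s).chains

/-- The natural transformation of a formal morphism. -/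
abbrev hatT {X Y : PregroupType (B' ⊕ V)} (f : (G.pregroup ι s).Tm X Y) :
    (G.K ι s).E X false 0 ⟶ (G.K ι s).E Y false 0 :=
  hat (S := G.sig ι s) (Hom.mk f)

variable {G ι s}

theorem hatT_comp {X Y Z : PregroupType (B' ⊕ V)} {f : (G.pregroup ι s).Tm X Y}
    {g : (G.pregroup ι s).Tm Y Z} {α β} (hf : G.hatT ι s f = α) (hg : G.hatT ι s g = β) :
    G.hatT ι s (.comp f g) = α ≫ β := by
  subst hf hg
  exact hat_comp (S := G.sig ι s) (Hom.mk f) (Hom.mk g)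

theorem hatT_tensor {X Y X' Y' : PregroupType (B' ⊕ V)} {f : (G.pregroup ι s).Tm X Y}
    {g : (G.pregroup ι s).Tm X' Y'} {α β} (hf : G.hatT ι s f = α) (hg : G.hatT ι s g = β) :
    G.hatT ι s (.tensor f g) = β ◫ α := by
  subst hf hg
  exact hat_tensor (S := G.sig ι s) (Hom.mk f) (Hom.mk g)

variable (G ι s)

theorem hatT_id (X : PregroupType (B' ⊕ V)) : G.hatT ι s (.id X) = 𝟙 _ :=
  hat_id (S := G.sig ι s) X

theorem hatT_assocHom (X Y Z : PregroupType (B' ⊕ V)) :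
    G.hatT ι s (.assocHom X Y Z) =
      𝟙 ((G.K ι s).E Z false 0 ⋙ (G.K ι s).E Y false 0 ⋙ (G.K ι s).E X false 0) :=
  hat_assocHom (S := G.sig ι s) X Y Z

theorem hatT_assocInv (X Y Z : PregroupType (B' ⊕ V)) :
    G.hatT ι s (.assocInv X Y Z) =
      𝟙 ((G.K ι s).E Z false 0 ⋙ (G.K ι s).E Y false 0 ⋙ (G.K ι s).E X false 0) :=
  hat_assocInv (S := G.sig ι s) X Y Z

theorem hatT_leftUnitHom (X : PregroupType (B' ⊕ V)) :
    G.hatT ι s (.leftUnitHom X) = 𝟙 ((G.K ι s).E X false 0) :=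
  hat_leftUnitHom (S := G.sig ι s) X

theorem hatT_leftUnitInv (X : PregroupType (B' ⊕ V)) :
    G.hatT ι s (.leftUnitInv X) = 𝟙 ((G.K ι s).E X false 0) :=
  hat_leftUnitInv (S := G.sig ι s) X

theorem hatT_rightUnitHom (X : PregroupType (B' ⊕ V)) :
    G.hatT ι s (.rightUnitHom X) = 𝟙 ((G.K ι s).E X false 0) :=
  hat_rightUnitHom (S := G.sig ι s) X

theorem hatT_cupsR (y : List B') :
    G.hatT ι s ((G.pregroup ι s).cupsR y) = ((G.K ι s).adjR Sum.inl y).counit := by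
  induction y with
  | nil => exact G.hatT_leftUnitHom ι s _
  | cons b y ih =>
    have h₁ := hatT_tensor ih (G.hatT_id ι s (.right (.of (Sum.inl b))))
    have h₂ := hatT_comp h₁ (G.hatT_leftUnitHom ι s _)
    have h₃ := hatT_comp (G.hatT_assocInv ι s (PregroupGrammar.ob (.ofList y))
      (PregroupGrammar.ob (.rightList y)) (.right (.of (Sum.inl b)))) h₂
    have h₄ := hatT_tensor (G.hatT_id ι s (.of (Sum.inl b))) h₃
    have h₅ := hatT_comp h₄ (hat_cupRight (.of (Sum.inl b)))
    have h₆ := hatT_comp (G.hatT_assocHom ι s (.of (Sum.inl b)) (PregroupGrammar.ob (.ofList y))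
      (PregroupGrammar.ob (.rightList (b :: y)))) h₅
    exact h₆.trans (counit_comp_of_cups ((G.K ι s).adjR Sum.inl y)
      ((G.K ι s).adjE (.of (Sum.inl b)) false 0 (0 + 1) rfl))

theorem hatT_cupsL (z : List B') :
    G.hatT ι s ((G.pregroup ι s).cupsL z) = ((G.K ι s).adjL Sum.inl z).counit := by
  induction z with
  | nil => exact G.hatT_leftUnitHom ι s _
  | cons b y ih =>
    have h₁ := hatT_tensor (hat_cupLeft (.of (Sum.inl b)))
      (G.hatT_id ι s (PregroupGrammar.ob (.ofList y)))
    have h₂ := hatT_comp h₁ (G.hatT_leftUnitHom ι s _)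
    have h₃ := hatT_comp (G.hatT_assocInv ι s (.left (.of (Sum.inl b))) (.of (Sum.inl b))
      (PregroupGrammar.ob (.ofList y))) h₂
    have h₄ := hatT_tensor (G.hatT_id ι s (PregroupGrammar.ob (.leftList y))) h₃
    have h₅ := hatT_comp h₄ ih
    have h₆ := hatT_comp (G.hatT_assocHom ι s (PregroupGrammar.ob (.leftList y))
      (.left (.of (Sum.inl b))) (PregroupGrammar.ob (.ofList (b :: y)))) h₅
    exact h₆.trans (counit_comp_of_cups' ((G.K ι s).adjL Sum.inl y)
      ((G.K ι s).adjE (.of (Sum.inl b)) true (0 - 1) 0 rfl))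

theorem hatT_linkWord {w : V} {x : B} {y z : List B} (hII : (w, x) ∈ G.typeII)
    (hI : (x, y, z) ∈ G.typeI) :
    G.hatT ι s (G.linkWord ι s hII hI) =
      whisker ((G.K ι s).E ((PregroupType.ofList (z.map ι)).map Sum.inl) false 0)
        (F := (G.K ι s).T (Sum.inr w) 0)
        (G := (G.K ι s).E ((PregroupType.leftList (z.map ι)).map Sum.inl) false 0 ⋙
          (G.K ι s).T (Sum.inl (ι x)) 0 ⋙
          (G.K ι s).E ((PregroupType.rightList (y.map ι)).map Sum.inl) false 0)
        (G.hatT ι s ((G.pregroup ι s).lex w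
          (.operadic (y.map ι) (ι x) (z.map ι)) ⟨x, y, z, hII, hI, rfl⟩))
        ((G.K ι s).E ((PregroupType.ofList (y.map ι)).map Sum.inl) false 0) ≫
      Functor.whiskerRight ((G.K ι s).adjL Sum.inl (z.map ι)).counit
        ((G.K ι s).T (Sum.inl (ι x)) 0 ⋙
          (G.K ι s).E ((PregroupType.rightList (y.map ι)).map Sum.inl) false 0 ⋙
          (G.K ι s).E ((PregroupType.ofList (y.map ι)).map Sum.inl) false 0) ≫
      Functor.whiskerLeft ((G.K ι s).T (Sum.inl (ι x)) 0)
        ((G.K ι s).adjR Sum.inl (y.map ι)).counit := by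
  let P := G.pregroup ι s
  let Y := PregroupGrammar.ob (V := V) (.ofList (y.map ι))
  let Y' := PregroupGrammar.ob (V := V) (.rightList (y.map ι))
  let X := PregroupGrammar.ob (V := V) (.of (ι x))
  let Z := PregroupGrammar.ob (V := V) (.ofList (z.map ι))
  let Z' := PregroupGrammar.ob (V := V) (.leftList (z.map ι))
  have h₁ := hatT_comp (hatT_tensor (G.hatT_id ι s X) (G.hatT_cupsL ι s (z.map ι)))
    (G.hatT_rightUnitHom ι s X)
  have h₂ := hatT_comp (G.hatT_assocHom ι s X Z' Z) h₁
  have h₃ := hatT_comp (G.hatT_assocHom ι s Y' (.tensor X Z') Z)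
    (hatT_tensor (G.hatT_id ι s Y') h₂)
  have h₄ := hatT_comp (hatT_tensor (G.hatT_cupsR ι s (y.map ι)) (G.hatT_id ι s X))
    (G.hatT_leftUnitHom ι s X)
  have h₅ := hatT_comp (G.hatT_assocInv ι s Y Y' X) h₄
  have h₆ := hatT_comp (hatT_tensor (G.hatT_id ι s Y) h₃) h₅
  have h₇ := hatT_comp (hatT_tensor (G.hatT_id ι s Y) (hatT_tensor (f := P.lex w
    (.operadic (y.map ι) (ι x) (z.map ι)) ⟨x, y, z, hII, hI, rfl⟩) rfl (G.hatT_id ι s Z))) h₆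
  exact h₇.trans (contraction_of_link _ _ _)

end DependencyGrammar

/-! ### The boxes of a dependency grammar -/

namespace AdjointChains

variable {A : Type*} {C : Type u} [Category.{v} C] {K : AdjointChains A C}

theorem degrees_rightList {D : Type*} (f : D → A) (y : List D) :
    K.Degrees (· = 1) (K.E ((PregroupType.rightList y).map f) false 0) := by
  induction y with
  | nil => exact degrees_id
  | cons b y ih =>
    exact (degrees_comp (isComposite_T _ _) (isComposite_E _ _ _)).2
      ⟨degrees_T.2 (show (0 + 1 : ℤ) = 1 from rfl), ih⟩

theorem degrees_words {D : Type*} (f : D → A) (y : List D) :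
    K.Degrees (· = 1) (K.E (PregroupType.ofList (y.map f)) true (0 + 1)) := by
  induction y with
  | nil => exact degrees_id
  | cons b y ih =>
    exact (degrees_comp (isComposite_T _ _) (isComposite_E _ _ _)).2
      ⟨degrees_T.2 (show (0 + 1 : ℤ) = 1 from rfl), ih⟩

end AdjointChains

namespace DependencyGrammar

open MonoidalCategory AdjointChains RigidSignature

variable {V : Type u} {B : Type v} (G : DependencyGrammar V B) {B' : Type v} (ι : B → B') (s : B')

/-- The transformation of the lexical entry of a word. -/
def hatLex {w : V} {x : B} {y z : List B} (hII : (w, x) ∈ G.typeII) (hI : (x, y, z) ∈ G.typeI) :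
    (G.K ι s).T (Sum.inr w) 0 ⟶
      (G.K ι s).E ((PregroupType.leftList (z.map ι)).map Sum.inl) false 0 ⋙
        (G.K ι s).T (Sum.inl (ι x)) 0 ⋙
        (G.K ι s).E ((PregroupType.rightList (y.map ι)).map Sum.inl) false 0 :=
  G.hatT ι s ((G.pregroup ι s).lex w (.operadic (y.map ι) (ι x) (z.map ι)) ⟨x, y, z, hII, hI, rfl⟩)

/-- The transformation of a word which is linked to its arguments. -/
def hatLink {w : V} {x : B} {y z : List B} (hII : (w, x) ∈ G.typeII) (hI : (x, y, z) ∈ G.typeI) :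
    (G.K ι s).E ((PregroupType.ofList (z.map ι)).map Sum.inl) false 0 ⋙ (G.K ι s).T (Sum.inr w) 0 ⋙
      (G.K ι s).E ((PregroupType.ofList (y.map ι)).map Sum.inl) false 0 ⟶
      (G.K ι s).T (Sum.inl (ι x)) 0 :=
  G.hatT ι s (G.linkWord ι s hII hI)

theorem hatLink_eq {w : V} {x : B} {y z : List B} (hII : (w, x) ∈ G.typeII)
    (hI : (x, y, z) ∈ G.typeI) :
    G.hatLink ι s hII hI =
      whisker ((G.K ι s).E ((PregroupType.ofList (z.map ι)).map Sum.inl) false 0)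
        (G.hatLex ι s hII hI)
        ((G.K ι s).E ((PregroupType.ofList (y.map ι)).map Sum.inl) false 0) ≫
      Functor.whiskerRight ((G.K ι s).adjL Sum.inl (z.map ι)).counit
        ((G.K ι s).T (Sum.inl (ι x)) 0 ⋙
          (G.K ι s).E ((PregroupType.rightList (y.map ι)).map Sum.inl) false 0 ⋙
          (G.K ι s).E ((PregroupType.ofList (y.map ι)).map Sum.inl) false 0) ≫
      Functor.whiskerLeft ((G.K ι s).T (Sum.inl (ι x)) 0)
        ((G.K ι s).adjR Sum.inl (y.map ι)).counit :=
  G.hatT_linkWord ι s hII hI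

/-- The transformation of an induced step. -/
def hatStep {x : B} (hx : x ∈ G.typeIII) :
    (G.K ι s).T (Sum.inl (ι x)) 0 ⟶ (G.K ι s).T (Sum.inl s) 0 :=
  G.hatT ι s ((G.pregroup ι s).step (ι x) s ⟨x, hx, rfl⟩)

/-- The transformation of a reduction. -/
def hatReduction {u : List V}
    (f : (G.pregroup ι s).Tm (PregroupGrammar.words u) (PregroupGrammar.ob (.of s))) :
    (G.K ι s).E (PregroupGrammar.words u) false 0 ⟶ (G.K ι s).T (Sum.inl s) 0 :=
  G.hatT ι s f

/-- The right adjoint of the string `y w z`. -/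
def adjWord (w : V) (y z : List B') :
    (G.K ι s).E ((PregroupType.ofList z).map Sum.inl) false 0 ⋙ (G.K ι s).T (Sum.inr w) 0 ⋙
      (G.K ι s).E ((PregroupType.ofList y).map Sum.inl) false 0 ⊣
    ((G.K ι s).E ((PregroupType.rightList y).map Sum.inl) false 0 ⋙
      (G.K ι s).T (Sum.inr w) (0 + 1)) ⋙
      (G.K ι s).E ((PregroupType.rightList z).map Sum.inl) false 0 :=
  ((G.K ι s).adjR Sum.inl z).comp
    (((G.K ι s).adj (Sum.inr w) 0).comp ((G.K ι s).adjR Sum.inl y))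

/-- The mates of the basic reductions: a word of type `x` linked to its arguments, and an induced
step. -/
inductive BoxRel : ∀ (a : B' ⊕ V) (Φ : FreeRigid (G.sig ι s) ⥤ FreeRigid (G.sig ι s)),
    ((G.K ι s).T a (0 + 1) ⟶ Φ) → Prop
  | word {w : V} {x : B} {y z : List B} (hII : (w, x) ∈ G.typeII) (hI : (x, y, z) ∈ G.typeI) :
      BoxRel (Sum.inl (ι x)) _
        (conjugateEquiv ((G.K ι s).adj (Sum.inl (ι x)) 0) (G.adjWord ι s w (y.map ι) (z.map ι))
          (G.hatLink ι s hII hI))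
  | root {x : B} (hx : x ∈ G.typeIII) :
      BoxRel (Sum.inl s) _
        (conjugateEquiv ((G.K ι s).adj (Sum.inl s) 0) ((G.K ι s).adj (Sum.inl (ι x)) 0)
          (G.hatStep ι s hx))

/-- The basic reductions as boxes. -/
def boxes : Boxes (G.K ι s) where
  rel := G.BoxRel ι s
  legs := by
    intro x Φ α h
    cases h with
    | @word w x y z hII hI =>
      obtain ⟨l, hl, h⟩ := degrees_rightList (K := G.K ι s) (D := B') Sum.inl (y.map ι)
      obtain ⟨l', hl', h'⟩ := degrees_rightList (K := G.K ι s) (D := B') Sum.inl (z.map ι)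
      refine ⟨_, hl'.append (.cons _ _ hl), by simp, fun p hp => ?_⟩
      rcases List.mem_append.1 hp with hp | hp
      · exact h' p hp
      · rcases List.mem_cons.1 hp with rfl | hp
        exacts [rfl, h p hp]
    | root hx => exact ⟨_, .single _ _, by simp, by simp⟩

theorem state_base {a : B' ⊕ V} {Φ : FreeRigid (G.sig ι s) ⥤ FreeRigid (G.sig ι s)}
    {α : (G.K ι s).T a (0 + 1) ⟶ Φ} (h : G.BoxRel ι s a Φ α) :
    State (G.boxes ι s) ((G.K ι s).T a 0 ⋙ Φ) (bendR ((G.K ι s).adj a 0) Φ α) :=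
  .inl (.base h)

/-- A lexical entry is the box of a linked word, turned round so that it is applied to the leg of
the word. -/
theorem op_lex {w : V} {x : B} {y z : List B} (hII : (w, x) ∈ G.typeII)
    (hI : (x, y, z) ∈ G.typeI) :
    Op (G.boxes ι s) (Sum.inr w) (-1)
      ((G.K ι s).E ((PregroupType.leftList (z.map ι)).map Sum.inl) false 0 ⋙
          (G.K ι s).T (Sum.inl (ι x)) 0 ⋙
          (G.K ι s).E ((PregroupType.rightList (y.map ι)).map Sum.inl) false 0)
      (by exact G.hatLex ι s hII hI) := by
  have h := G.state_base ι s (.word hII hI)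
  rw [bendR_conjugateEquiv, hatLink_eq, adjWord, bendL_comp] at h
  have hO := isComposite_E (K := G.K ι s)
    ((PregroupType.rightList (y.map ι)).map Sum.inl) false 0
  have hL := isComposite_E (K := G.K ι s)
    ((PregroupType.leftList (z.map ι)).map Sum.inl) false 0
  have h₁ := h.turnList (Sum.inl (β := V)) (z.map ι)
    (Ψ := (G.K ι s).T (Sum.inl (ι x)) 0 ⋙
      (G.K ι s).E ((PregroupType.rightList (y.map ι)).map Sum.inl) false 0 ⋙
      (G.K ι s).T (Sum.inr w) (0 + 1))
    ((isComposite_T _ _).comp (hO.comp (isComposite_T _ _)))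
  rw [rotate_bendL, bendR_curry_contract] at h₁
  have h₂ := State.turn (a := Sum.inr w) (n := -1) h₁ (hL.comp ((isComposite_T _ _).comp hO))
  exact h₂.cast (rotate_bendL _ _ _)

theorem op_step {x : B} (hx : x ∈ G.typeIII) :
    Op (G.boxes ι s) (Sum.inl (ι x)) (-1) ((G.K ι s).T (Sum.inl s) 0)
      (by exact G.hatStep ι s hx) := by
  have h := G.state_base ι s (.root hx)
  rw [bendR_conjugateEquiv] at h
  have h₂ := State.turn (a := Sum.inl (ι x)) (n := -1) h (isComposite_T _ _)
  exact h₂.cast (rotate_bendL _ _ _)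

theorem preserves_hatT {X Y : PregroupType (B' ⊕ V)} (f : (G.pregroup ι s).Tm X Y) :
    Preserves (G.boxes ι s) (G.hatT ι s f) := by
  apply preserves_hat
  rintro (⟨⟨w, t⟩, x, y, z, hII, hI, rfl : t = _⟩ | ⟨⟨x', s'⟩, x, hx, e⟩)
  · intro N M g hN hM h
    exact Good.op (n := -1) h hN hM ((isComposite_E _ _ _).comp
      ((isComposite_T _ _).comp (isComposite_E _ _ _))) (G.op_lex ι s hII hI)
  · obtain ⟨rfl, rfl⟩ := Prod.mk.inj e
    intro N M g hN hM h
    exact Good.op (n := -1) h hN hM (isComposite_T _ _) (G.op_step ι s' hx)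

/-- A reduction of a string to the sentence type, bent into a transformation out of the right
adjoint of the sentence type, is a composite of basic reductions. -/
theorem grow_of_reduction (u : List V)
    (f : (G.pregroup ι s).Tm (PregroupGrammar.words u) (PregroupGrammar.ob (.of s))) :
    Grow (G.boxes ι s) ((G.K ι s).T (Sum.inl s) (0 + 1))
      ((G.K ι s).E (PregroupGrammar.words u) true (0 + 1))
      (conjugateEquiv ((G.K ι s).adj (Sum.inl s) 0)
        ((G.K ι s).adjE (PregroupGrammar.words u) false 0 (0 + 1) rfl) (G.hatReduction ι s f)) := by
  -- the reduction, applied to one half of a cap of the string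
  have h₀ : Good (G.boxes ι s) _ _ := Good.nil
  have h₁ := Good.capE (PregroupGrammar.words u) (b := false) (n := 0) (m := 0 + 1) rfl
    (N := 𝟭 _) (M := 𝟭 _) h₀ isComposite_id isComposite_id
  have h₂ := G.preserves_hatT ι s f (N := 𝟭 _)
    (M := (G.K ι s).E (PregroupGrammar.words u) true (0 + 1)) isComposite_id
    (isComposite_E _ _ _) h₁
  -- the leg of the sentence type is the only one of even degree
  have h₃ := Good.grow_of_odd (a := Sum.inl s) (n := 0)
    (O := (G.K ι s).E (PregroupGrammar.words u) true (0 + 1)) h₂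
    ((degrees_words Sum.inr u).mono fun n hn => hn ▸ odd_one) rfl .rfl
  refine Grow.cast (F := (G.K ι s).E (PregroupGrammar.words u) true (0 + 1)) h₃ ?_
  refine (Equiv.symm_apply_eq _).2 (Eq.trans ?_ (bendR_conjugateEquiv _ _ _).symm)
  ext Z
  simp [hatReduction]
  rfl

end DependencyGrammar

/-! ### The transformation of a dependency forest -/

namespace Bending

variable {C : Type u} [Category.{v} C]

theorem conjugateEquiv_contract {L R L' R' W : C ⥤ C} (adj : L ⊣ R) (adj' : L' ⊣ R') (μ : L' ⟶ L)
    (δ : W ⟶ L') :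
    Functor.whiskerRight (conjugateEquiv adj adj' μ) W ≫ Functor.whiskerLeft R' δ ≫ adj'.counit =
      Functor.whiskerLeft R (δ ≫ μ) ≫ adj.counit := by
  ext Z
  have h := δ.naturality ((conjugateEquiv adj adj' μ).app Z)
  have h' := conjugateEquiv_counit adj adj' μ Z
  simp only [NatTrans.comp_app, Functor.whiskerRight_app, Functor.whiskerLeft_app, Category.assoc]
  rw [reassoc_of% h]
  exact _ ≫= h'

theorem contract_injective {F G W : C ⥤ C} (adj : F ⊣ G) {d d' : W ⟶ F}
    (h : Functor.whiskerLeft G d ≫ adj.counit = Functor.whiskerLeft G d' ≫ adj.counit) :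
    d = d' := by
  have key : ∀ e : W ⟶ F, ∀ Z, e.app Z =
      W.map (adj.unit.app Z) ≫ (Functor.whiskerLeft G e ≫ adj.counit).app (F.obj Z) := by
    intro e Z
    simp
  ext Z
  rw [key d, key d', h]

theorem eqToHom_hcomp_id {F F' T : C ⥤ C} (h : F = F') :
    (eqToHom h ◫ 𝟙 T) ≫ 𝟙 (F' ⋙ T) = eqToHom (congrArg (· ⋙ T) h) := by
  subst h
  ext Z
  simp

theorem hcomp_of_split {W₁ W₂ Wl Wr Wt T L R X H Y : C ⥤ C} (e₂ : W₂ = Wt ⋙ Wr)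
    (e₁ : W₁ = (W₂ ⋙ T) ⋙ Wl) (e : W₁ = Wt ⋙ Wr ⋙ T ⋙ Wl) (dt : Wt ⟶ H) (dr : Wr ⟶ R)
    (dl : Wl ⟶ L) (l : T ⟶ Y) (μ : R ⋙ Y ⋙ L ⟶ X) :
    eqToHom e₁ ≫ (((eqToHom e₂ ≫ (dt ◫ dr)) ◫ l) ◫ dl) ≫
      (𝟙 ((H ⋙ R) ⋙ Y) ◫ 𝟙 L : ((H ⋙ R) ⋙ Y) ⋙ L ⟶ ((H ⋙ R) ⋙ Y) ⋙ L) ≫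
      𝟙 (((H ⋙ R) ⋙ Y) ⋙ L) ≫ (𝟙 H ◫ μ : H ⋙ R ⋙ Y ⋙ L ⟶ H ⋙ X) =
    eqToHom e ≫ (dt ◫ ((dr ◫ (𝟙 T ◫ dl) : Wr ⋙ T ⋙ Wl ⟶ R ⋙ T ⋙ L) ≫
      ((𝟙 R ◫ l) ◫ 𝟙 L : (R ⋙ T) ⋙ L ⟶ (R ⋙ Y) ⋙ L) ≫ μ) :
        Wt ⋙ Wr ⋙ T ⋙ Wl ⟶ H ⋙ X) := by
  subst e₂ e₁
  ext Z
  have h₁ := l.naturality (dr.app (Wt.obj Z))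
  have h₂ := μ.naturality (dt.app Z)
  simp only [Functor.comp_obj, Functor.comp_map] at h₁ h₂
  have h₃ := congrArg L.map h₁
  rw [L.map_comp, L.map_comp] at h₃
  simp [h₂, reassoc_of% h₃]

end Bending

namespace DependencyGrammar

open MonoidalCategory AdjointChains RigidSignature

variable {V : Type u} {B : Type v} (G : DependencyGrammar V B) {B' : Type v} (ι : B → B') (s : B')

/-- The functor of a string of words. -/
abbrev wordsE (u : List V) : FreeRigid (G.sig ι s) ⥤ FreeRigid (G.sig ι s) :=
  (G.K ι s).E (PregroupGrammar.words u) false 0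

theorem wordsE_append (u u' : List V) :
    G.wordsE ι s (u ++ u') = G.wordsE ι s u' ⋙ G.wordsE ι s u := by
  induction u with
  | nil => rfl
  | cons w u ih => exact congrArg (· ⋙ (G.K ι s).T (Sum.inr w) 0) ih

theorem hatT_split (u u' : List V) :
    G.hatT ι s ((G.pregroup ι s).split u u') = eqToHom (G.wordsE_append ι s u u') := by
  induction u with
  | nil => exact G.hatT_leftUnitInv ι s _
  | cons w u ih =>
    have h := hatT_comp (hatT_tensor (G.hatT_id ι s (.of (Sum.inr w))) ih)
      (G.hatT_assocInv ι s (.of (Sum.inr w)) (PregroupGrammar.words u) (PregroupGrammar.words u'))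
    exact h.trans (eqToHom_hcomp_id (T := (G.K ι s).T (Sum.inr w) 0) (G.wordsE_append ι s u u'))

/-- The transformation of a forest of dependency trees. -/
def hatForest {xs : List B} (f : G.Forest xs) : G.wordsE ι s f.yield ⟶
    (G.K ι s).E ((PregroupType.ofList (xs.map ι)).map Sum.inl) false 0 :=
  G.hatT ι s (f.toTerm ι s)

/-- The transformation of a dependency tree, in terms of those of the dependents of the root. -/
def hatNode {w : V} {x : B} {y z : List B} (hII : (w, x) ∈ G.typeII) (hI : (x, y, z) ∈ G.typeI)
    {Wl Wr : FreeRigid (G.sig ι s) ⥤ FreeRigid (G.sig ι s)}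
    (dl : Wl ⟶ (G.K ι s).E ((PregroupType.ofList (y.map ι)).map Sum.inl) false 0)
    (dr : Wr ⟶ (G.K ι s).E ((PregroupType.ofList (z.map ι)).map Sum.inl) false 0) :
    Wr ⋙ (G.K ι s).T (Sum.inr w) 0 ⋙ Wl ⟶ (G.K ι s).T (Sum.inl (ι x)) 0 :=
  (dr ◫ (𝟙 _ ◫ dl)) ≫ G.hatLink ι s hII hI

theorem wordsE_cons (w : V) (u u' u'' : List V) :
    G.wordsE ι s (u ++ w :: (u' ++ u'')) =
      G.wordsE ι s u'' ⋙ G.wordsE ι s u' ⋙ (G.K ι s).T (Sum.inr w) 0 ⋙ G.wordsE ι s u :=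
  (G.wordsE_append ι s _ _).trans
    (congrArg (fun F => (F ⋙ (G.K ι s).T (Sum.inr w) 0) ⋙ G.wordsE ι s u)
      (G.wordsE_append ι s u' u''))

theorem hatForest_cons {w : V} {x : B} {y z : List B} (hII : (w, x) ∈ G.typeII)
    (hI : (x, y, z) ∈ G.typeI) (l : G.Forest y) (r : G.Forest z) {xs : List B} (f : G.Forest xs) :
    G.hatForest ι s (.cons w x y z hII hI l r f) =
      eqToHom (G.wordsE_cons ι s w l.yield r.yield f.yield) ≫
        (G.hatForest ι s f ◫ G.hatNode ι s hII hI (G.hatForest ι s l) (G.hatForest ι s r)) := by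
  let P := G.pregroup ι s
  let Y := PregroupGrammar.ob (V := V) (.ofList (y.map ι))
  let Z := PregroupGrammar.ob (V := V) (.ofList (z.map ι))
  let X := PregroupGrammar.ob (V := V) (.ofList (xs.map ι))
  let t : PregroupType B' := .operadic (y.map ι) (ι x) (z.map ι)
  have h₁ := hatT_comp (G.hatT_split ι s r.yield f.yield)
    (hatT_tensor (rfl : _ = G.hatForest ι s r) (rfl : _ = G.hatForest ι s f))
  have h₂ := hatT_tensor (rfl : _ = G.hatForest ι s l)
    (hatT_tensor (rfl : _ = G.hatT ι s (P.lex w t ⟨x, y, z, hII, hI, rfl⟩)) h₁)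
  have h₃ := hatT_tensor (rfl : _ = G.hatT ι s (P.link (y.map ι) (ι x) (z.map ι)))
    (G.hatT_id ι s X)
  have h₄ := hatT_comp (G.hatT_assocInv ι s Y (.tensor (PregroupGrammar.ob t) Z) X) h₃
  have h₅ := hatT_comp (hatT_tensor (G.hatT_id ι s Y)
    (G.hatT_assocInv ι s (PregroupGrammar.ob t) Z X)) h₄
  have h₆ := hatT_comp (G.hatT_split ι s l.yield (w :: (r.yield ++ f.yield))) (hatT_comp h₂ h₅)
  have h₇ := hatT_comp (hatT_tensor (G.hatT_id ι s Y) (hatT_tensor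
    (rfl : _ = G.hatT ι s (P.lex w t ⟨x, y, z, hII, hI, rfl⟩)) (G.hatT_id ι s Z)))
    (rfl : _ = G.hatT ι s (P.link (y.map ι) (ι x) (z.map ι)))
  have h₈ := hcomp_of_split (T := (G.K ι s).T (Sum.inr w) 0)
    (Y := (G.K ι s).E (PregroupGrammar.ob t) false 0) (X := (G.K ι s).T (Sum.inl (ι x)) 0)
    (L := (G.K ι s).E Y false 0) (R := (G.K ι s).E Z false 0) (H := (G.K ι s).E X false 0)
    (G.wordsE_append ι s r.yield f.yield)
    (G.wordsE_append ι s l.yield (w :: (r.yield ++ f.yield)))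
    (G.wordsE_cons ι s w l.yield r.yield f.yield) (G.hatForest ι s f) (G.hatForest ι s r)
    (G.hatForest ι s l) (G.hatT ι s (P.lex w t ⟨x, y, z, hII, hI, rfl⟩))
    (G.hatT ι s (P.link (y.map ι) (ι x) (z.map ι)))
  refine h₆.trans (h₈.trans ?_)
  rw [hatNode, hatLink]
  exact congrArg (fun k => eqToHom (G.wordsE_cons ι s w l.yield r.yield f.yield) ≫
    (G.hatForest ι s f ◫ ((G.hatForest ι s r ◫ (𝟙 ((G.K ι s).T (Sum.inr w) 0) ◫
      G.hatForest ι s l)) ≫ k))) h₇.symm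

end DependencyGrammar

/-! ### Closing legs by dependency trees -/

namespace DependencyGrammar

open MonoidalCategory AdjointChains RigidSignature

variable {V : Type u} {B : Type v} (G : DependencyGrammar V B) {B' : Type v} (ι : B → B') (s : B')

/-- The renaming `ι` is injective, and the sentence symbol `s` is distinct from all symbols which
occur in rules of type I and from those which govern a sentence. -/
structure Fresh : Prop where
  injective : Function.Injective ι
  head : ∀ {x y z}, (x, y, z) ∈ G.typeI → ι x ≠ s
  left : ∀ {x y z}, (x, y, z) ∈ G.typeI → ∀ b ∈ y, ι b ≠ s
  right : ∀ {x y z}, (x, y, z) ∈ G.typeI → ∀ b ∈ z, ι b ≠ s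
  root : ∀ x ∈ G.typeIII, ι x ≠ s

/-- The transformation `d` is that of a forest of dependency trees with roots of types `xs`, whose
string of words is `v`. -/
def IsForest (xs : List B) (v : List V) (W : FreeRigid (G.sig ι s) ⥤ FreeRigid (G.sig ι s))
    (d : W ⟶ (G.K ι s).E ((PregroupType.ofList (xs.map ι)).map Sum.inl) false 0) : Prop :=
  ∃ f : G.Forest xs, f.yield = v ∧
    ∃ e : W = G.wordsE ι s f.yield, d = eqToHom e ≫ G.hatForest ι s f

variable {G ι s}

theorem hcomp_eqToHom {C : Type*} [Category C] {W W' W'' F F' : C ⥤ C} (e : W' = W'') (d : W ⟶ F)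
    (d' : W'' ⟶ F') : HEq (d ◫ (𝟙 W' ≫ eqToHom e ≫ d')) (d ◫ d') := by
  subst e
  simp

theorem id_hcomp {C : Type*} [Category C] {F F' : C ⥤ C} (d : F ⟶ F') : 𝟙 (𝟭 C) ◫ d = d := by
  ext Z
  simp

theorem IsForest.cast {xs : List B} {v v' : List V}
    {W W' : FreeRigid (G.sig ι s) ⥤ FreeRigid (G.sig ι s)} {d d'} (h : G.IsForest ι s xs v W d)
    (hv : v = v') (hW : W = W') (hd : HEq d d') : G.IsForest ι s xs v' W' d' := by
  subst hv hW
  obtain rfl := eq_of_heq hd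
  exact h

theorem isForest_nil : G.IsForest ι s [] [] (𝟭 _) (𝟙 (𝟭 _)) :=
  ⟨.nil, rfl, rfl, (G.hatT_id ι s .unit).symm.trans (Category.id_comp _).symm⟩

theorem isForest_cons {w : V} {x : B} {y z xs : List B} (hII : (w, x) ∈ G.typeII)
    (hI : (x, y, z) ∈ G.typeI) {vl vr v : List V}
    {Wl Wr W : FreeRigid (G.sig ι s) ⥤ FreeRigid (G.sig ι s)} {dl dr d}
    (hl : G.IsForest ι s y vl Wl dl) (hr : G.IsForest ι s z vr Wr dr)
    (h : G.IsForest ι s xs v W d) :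
    G.IsForest ι s (x :: xs) (vl ++ w :: (vr ++ v)) (W ⋙ Wr ⋙ (G.K ι s).T (Sum.inr w) 0 ⋙ Wl)
      (d ◫ G.hatNode ι s hII hI dl dr) := by
  obtain ⟨l, rfl, rfl, rfl⟩ := hl
  obtain ⟨r, rfl, rfl, rfl⟩ := hr
  obtain ⟨f, rfl, rfl, rfl⟩ := h
  refine ⟨.cons w x y z hII hI l r f, rfl, (G.wordsE_cons ι s _ _ _ _).symm, ?_⟩
  simp only [eqToHom_refl, Category.id_comp, hatForest_cons]
  exact ((eqToHom_trans_assoc _ _ _).trans (Category.id_comp _)).symm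

theorem isForest_append {x : B} {xs : List B} {v v' : List V}
    {W W' : FreeRigid (G.sig ι s) ⥤ FreeRigid (G.sig ι s)} {d}
    {d' : W' ⟶ (G.K ι s).T (Sum.inl (ι x)) 0} (h : G.IsForest ι s xs v W d)
    (h' : G.IsForest ι s [x] v' W' d') :
    G.IsForest ι s (x :: xs) (v' ++ v) (W ⋙ W') (d ◫ d') := by
  obtain ⟨f', rfl, rfl, rfl⟩ := h'
  cases f' with
  | cons w x y z hII hI l r f₀ =>
    cases f₀
    have h₁ := isForest_cons hII hI ⟨l, rfl, rfl, (Category.id_comp _).symm⟩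
      ⟨r, rfl, rfl, (Category.id_comp _).symm⟩ h
    have e : G.hatForest ι s .nil ◫ G.hatNode ι s hII hI (G.hatForest ι s l) (G.hatForest ι s r) =
        G.hatNode ι s hII hI (G.hatForest ι s l) (G.hatForest ι s r) := by
      have e₀ : G.hatForest ι s .nil = 𝟙 (𝟭 _) := G.hatT_id ι s .unit
      rw [e₀]
      exact id_hcomp (C := FreeRigid (G.sig ι s)) _
    refine h₁.cast (by simp [Forest.yield])
      (congrArg (fun F => W ⋙ F) (G.wordsE_cons ι s w l.yield r.yield []).symm) ?_
    rw [hatForest_cons, e]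
    exact (hcomp_eqToHom (C := FreeRigid (G.sig ι s))
      (G.wordsE_cons ι s w l.yield r.yield []) d _).symm

/-- The transformation `d` is that of a word, of a dependency tree, or of a dependency tree followed
by an induced step. -/
inductive IsTree : ∀ (a : B' ⊕ V) (_ : List V) (W : FreeRigid (G.sig ι s) ⥤ FreeRigid (G.sig ι s)),
    (W ⟶ (G.K ι s).T a 0) → Prop
  | word (w : V) : IsTree (Sum.inr w) [w] ((G.K ι s).T (Sum.inr w) 0) (𝟙 _)
  | tree {x : B} {v : List V} {W} {d : W ⟶ (G.K ι s).T (Sum.inl (ι x)) 0} :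
      G.IsForest ι s [x] v W d → IsTree (Sum.inl (ι x)) v W d
  | root {x : B} (hx : x ∈ G.typeIII) {v : List V} {W}
      {d : W ⟶ (G.K ι s).T (Sum.inl (ι x)) 0} :
      G.IsForest ι s [x] v W d → IsTree (Sum.inl s) v W (d ≫ G.hatStep ι s hx)

variable (G ι s) in
/-- The transformation `κ` contracts each factor of `F` with a tree; the words of these trees
form the string `v`. -/
inductive IsClosing : ∀ (_ : List V) (W F : FreeRigid (G.sig ι s) ⥤ FreeRigid (G.sig ι s)),
    (F ⋙ W ⟶ 𝟭 _) → Prop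
  | nil : IsClosing [] (𝟭 _) (𝟭 _) (𝟙 (𝟭 _))
  | cons {a : B' ⊕ V} {v v' : List V} {W W' F} {d : W ⟶ (G.K ι s).T a 0} {κ : F ⋙ W' ⟶ 𝟭 _} :
      IsTree a v W d → (G.K ι s).IsComposite F → IsClosing v' W' F κ →
      IsClosing (v ++ v') (W' ⋙ W) ((G.K ι s).T a (0 + 1) ⋙ F)
        (whisker ((G.K ι s).T a (0 + 1)) κ W ≫ Functor.whiskerLeft ((G.K ι s).T a (0 + 1)) d ≫
          ((G.K ι s).adj a 0).counit)

theorem IsClosing.cast {v v' : List V} {W F W' F' : FreeRigid (G.sig ι s) ⥤ FreeRigid (G.sig ι s)}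
    {κ : F ⋙ W ⟶ 𝟭 _} {κ' : F' ⋙ W' ⟶ 𝟭 _} (h : IsClosing G ι s v W F κ) (hv : v = v')
    (hW : W = W') (hF : F = F') (hκ : HEq κ κ') : IsClosing G ι s v' W' F' κ' := by
  subst hv hW hF
  obtain rfl := eq_of_heq hκ
  exact h

theorem IsClosing.append {v v' : List V}
    {W W' N M : FreeRigid (G.sig ι s) ⥤ FreeRigid (G.sig ι s)} {κ : N ⋙ W ⟶ 𝟭 _}
    {κ' : M ⋙ W' ⟶ 𝟭 _} (h : IsClosing G ι s v W N κ) (h' : IsClosing G ι s v' W' M κ')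
    (hM : (G.K ι s).IsComposite M) :
    IsClosing G ι s (v ++ v') (W' ⋙ W) (N ⋙ M) (whisker N κ' W ≫ κ) := by
  induction h with
  | nil =>
    refine h'.cast rfl rfl rfl (heq_of_eq ?_)
    ext Z
    exact (Category.comp_id _).symm
  | @cons a v₁ v₂ W₁ W₂ F d κ ht hF _ ih =>
    refine (IsClosing.cons ht (hF.comp hM) ih).cast (List.append_assoc _ _ _).symm rfl rfl
      (heq_of_eq ?_)
    ext Z
    simp

theorem IsClosing.split {v : List V} {W F : FreeRigid (G.sig ι s) ⥤ FreeRigid (G.sig ι s)}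
    {κ : F ⋙ W ⟶ 𝟭 _} (h : IsClosing G ι s v W F κ)
    {N M : FreeRigid (G.sig ι s) ⥤ FreeRigid (G.sig ι s)} (hN : (G.K ι s).IsComposite N)
    (hM : (G.K ι s).IsComposite M) (e : F = N ⋙ M) :
    ∃ (v₁ v₂ : List V) (W₁ W₂ : FreeRigid (G.sig ι s) ⥤ FreeRigid (G.sig ι s))
      (κ₁ : N ⋙ W₁ ⟶ 𝟭 _) (κ₂ : M ⋙ W₂ ⟶ 𝟭 _), v = v₁ ++ v₂ ∧ W = W₂ ⋙ W₁ ∧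
      IsClosing G ι s v₁ W₁ N κ₁ ∧ IsClosing G ι s v₂ W₂ M κ₂ ∧
      HEq κ (whisker N κ₂ W₁ ≫ κ₁) := by
  induction h generalizing N with
  | nil =>
    obtain ⟨rfl, rfl⟩ := eq_id_of_comp hN hM e
    refine ⟨[], [], 𝟭 _, 𝟭 _, 𝟙 (𝟭 _), 𝟙 (𝟭 _), rfl, rfl, .nil, .nil, heq_of_eq ?_⟩
    ext Z
    exact (Category.comp_id _).symm
  | @cons a v₁ v₂ W₁ W₂ F d κ ht hF h ih =>
    rcases factor_cases (N := 𝟭 _) (M' := 𝟭 _) hN hM isComposite_id isComposite_id hF e.symm with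
      ⟨X, hX, e₁, -⟩ | ⟨X, Y, hX, hY, rfl, e₁, rfl⟩ | ⟨X, hX, rfl, rfl⟩
    · obtain ⟨-, e₂⟩ := eq_id_of_comp hX ((isComposite_T _ _).comp hF) e₁
      exact (T_ne_id _ _ (eq_id_of_comp (isComposite_T _ _) hF e₂.symm).1).elim
    · obtain ⟨rfl, rfl⟩ := eq_id_of_comp hN hX e₁
      refine ⟨[], _, 𝟭 _, _, 𝟙 (𝟭 _), _, rfl, rfl, .nil, .cons ht hF h, heq_of_eq ?_⟩
      ext Z
      exact (Category.comp_id _).symm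
    · obtain ⟨v₃, v₄, W₃, W₄, κ₃, κ₄, rfl, rfl, h₃, h₄, hκ⟩ := ih hX rfl
      obtain rfl := eq_of_heq hκ
      refine ⟨_, v₄, _, W₄, _, κ₄, (List.append_assoc _ _ _).symm, rfl, .cons ht hX h₃, h₄,
        heq_of_eq ?_⟩
      ext Z
      simp

theorem IsClosing.of_id {v : List V} {W F : FreeRigid (G.sig ι s) ⥤ FreeRigid (G.sig ι s)}
    {κ : F ⋙ W ⟶ 𝟭 _} (h : IsClosing G ι s v W F κ) (e : F = 𝟭 _) :
    v = [] ∧ W = 𝟭 _ ∧ HEq κ (𝟙 (𝟭 (FreeRigid (G.sig ι s)))) := by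
  cases h with
  | nil => exact ⟨rfl, rfl, .rfl⟩
  | cons _ hF _ => exact (T_ne_id _ _ (eq_id_of_comp (isComposite_T _ _) hF e.symm).1).elim

theorem IsClosing.single {v : List V} {W F : FreeRigid (G.sig ι s) ⥤ FreeRigid (G.sig ι s)}
    {κ : F ⋙ W ⟶ 𝟭 _} (h : IsClosing G ι s v W F κ) {a : B' ⊕ V}
    (e : F = (G.K ι s).T a (0 + 1)) {κ' : (G.K ι s).T a (0 + 1) ⋙ W ⟶ 𝟭 _} (hκ : HEq κ κ') :
    ∃ d, IsTree a v W d ∧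
      κ' = Functor.whiskerLeft ((G.K ι s).T a (0 + 1)) d ≫ ((G.K ι s).adj a 0).counit := by
  cases h with
  | nil => exact (T_ne_id _ _ e.symm).elim
  | @cons a' v₁ v₂ W₁ W₂ F d κ ht hF h =>
    obtain ⟨rfl, -, rfl⟩ := T_comp_cancel (Ψ := 𝟭 _) isComposite_id hF e
    obtain ⟨rfl, rfl, hκ₂⟩ := h.of_id rfl
    obtain rfl := eq_of_heq hκ₂
    obtain rfl := eq_of_heq hκ
    refine ⟨d, (List.append_nil v₁).symm ▸ ht, ?_⟩
    ext Z
    simp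

theorem IsClosing.tree {a : B' ⊕ V} {v : List V}
    {W : FreeRigid (G.sig ι s) ⥤ FreeRigid (G.sig ι s)} {d : W ⟶ (G.K ι s).T a 0}
    (h : IsTree a v W d) : IsClosing G ι s v W ((G.K ι s).T a (0 + 1))
      (Functor.whiskerLeft ((G.K ι s).T a (0 + 1)) d ≫ ((G.K ι s).adj a 0).counit) := by
  refine (IsClosing.cons h isComposite_id .nil).cast (List.append_nil _) rfl rfl (heq_of_eq ?_)
  ext Z
  simp

end DependencyGrammar

/-! ### Every reduction comes from a dependency tree -/

namespace Bending

variable {C : Type u} [Category.{v} C]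

theorem contract_comp {E O E' O' W W' : C ⥤ C} (adj : E ⊣ O) (adj' : E' ⊣ O') (d : W ⟶ E)
    (d' : W' ⟶ E') :
    whisker O' (Functor.whiskerLeft O d ≫ adj.counit) W' ≫ Functor.whiskerLeft O' d' ≫
      adj'.counit = Functor.whiskerLeft (O' ⋙ O) (d ◫ d') ≫ (adj.comp adj').counit := by
  ext Z
  simp

theorem conjugateEquiv_contract_id {L R L' R' : C ⥤ C} (adj : L ⊣ R) (adj' : L' ⊣ R')
    (μ : L' ⟶ L) :
    Functor.whiskerRight (conjugateEquiv adj adj' μ) L' ≫ adj'.counit =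
      Functor.whiskerLeft R μ ≫ adj.counit := by
  ext Z
  simp

theorem contract_node {E O T T' E' O' X X' W W' : C ⥤ C} (adj : E ⊣ O) (adjT : T ⊣ T')
    (adj' : E' ⊣ O') (adjX : X ⊣ X') (μ : E ⋙ T ⋙ E' ⟶ X) (d : W ⟶ E) (d' : W' ⟶ E') :
    Functor.whiskerRight (conjugateEquiv adjX (adj.comp (adjT.comp adj')) μ) (W ⋙ T ⋙ W') ≫
      whisker (O' ⋙ T') (Functor.whiskerLeft O d ≫ adj.counit) (T ⋙ W') ≫
        whisker O' (Functor.whiskerLeft T' (𝟙 T) ≫ adjT.counit) W' ≫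
          Functor.whiskerLeft O' d' ≫ adj'.counit =
      Functor.whiskerLeft X' ((d ◫ (𝟙 T ◫ d')) ≫ μ) ≫ adjX.counit := by
  refine Eq.trans ?_ (conjugateEquiv_contract adjX (adj.comp (adjT.comp adj')) μ (d ◫ (𝟙 T ◫ d')))
  congr 1
  ext Z
  simp

theorem whiskerRight_comp_whisker {F N T M Φ W₁ W₃ W₄ : C ⥤ C} (β : F ⟶ N ⋙ T ⋙ M)
    (α : T ⟶ Φ) (κ₁ : N ⋙ W₁ ⟶ 𝟭 C) (κ₃ : Φ ⋙ W₃ ⟶ 𝟭 C) (κ₄ : M ⋙ W₄ ⟶ 𝟭 C) :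
    Functor.whiskerRight β ((W₄ ⋙ W₃) ⋙ W₁) ≫
        whisker N (whisker T κ₄ W₃ ≫ Functor.whiskerRight α W₃ ≫ κ₃) W₁ ≫ κ₁ =
      Functor.whiskerRight (β ≫ whisker N α M) ((W₄ ⋙ W₃) ⋙ W₁) ≫
        whisker N (whisker Φ κ₄ W₃ ≫ κ₃) W₁ ≫ κ₁ := by
  ext Z
  have h := κ₄.naturality (α.app (N.obj Z))
  simp only [Functor.comp_obj, Functor.comp_map, Functor.id_obj, Functor.id_map] at h
  have h' := congrArg (fun k => W₁.map (W₃.map k)) h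
  simp only [Functor.map_comp] at h'
  simp [reassoc_of% h']

theorem contract_words {E O T T' : C ⥤ C} (adj : E ⊣ O) (adjT : T ⊣ T') :
    whisker T' adj.counit T ≫ Functor.whiskerLeft T' (𝟙 T) ≫ adjT.counit =
      (adj.comp adjT).counit := by
  ext Z
  simp

theorem comp_id_comp {W F Y : C ⥤ C} (d : W ⟶ F) (σ : F ⟶ Y) :
    d ≫ 𝟙 F ≫ σ = (𝟙 W ≫ d) ≫ σ := by
  simp

end Bending

namespace DependencyGrammar

open MonoidalCategory AdjointChains RigidSignature

variable {V : Type u} {B : Type v} {G : DependencyGrammar V B} {B' : Type v} {ι : B → B'} {s : B'}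

/-- A tree of a type other than `s` has no induced step at its root. -/
theorem IsTree.forest (H : G.Fresh ι s) {x : B} (hx : ι x ≠ s) {v : List V}
    {W : FreeRigid (G.sig ι s) ⥤ FreeRigid (G.sig ι s)} {a : B' ⊕ V} {d : W ⟶ (G.K ι s).T a 0}
    (h : IsTree a v W d) (e : a = Sum.inl (ι x)) {d' : W ⟶ (G.K ι s).T (Sum.inl (ι x)) 0}
    (hd : HEq d d') : G.IsForest ι s [x] v W d' := by
  cases h with
  | word => cases e
  | tree h =>
    obtain rfl := H.injective (Sum.inl.inj e)
    obtain rfl := eq_of_heq hd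
    exact h
  | root => exact (hx (Sum.inl.inj e).symm).elim

/-- A tree of type `s` has an induced step at its root, since `s` is the type of no word. -/
theorem IsTree.root_of_eq (H : G.Fresh ι s) {v : List V}
    {W : FreeRigid (G.sig ι s) ⥤ FreeRigid (G.sig ι s)} {a : B' ⊕ V} {d : W ⟶ (G.K ι s).T a 0}
    (h : IsTree a v W d) (e : a = Sum.inl s) {d' : W ⟶ (G.K ι s).T (Sum.inl s) 0}
    (hd : HEq d d') : ∃ (x : B) (hx : x ∈ G.typeIII) (d₀ : _), G.IsForest ι s [x] v W d₀ ∧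
      d' = d₀ ≫ G.hatStep ι s hx := by
  cases h with
  | word => cases e
  | @tree x _ _ _ h =>
    obtain ⟨f, -⟩ := h
    cases f with
    | cons w x y z hII hI l r f => exact (H.head hI (Sum.inl.inj e)).elim
  | root hx h =>
    obtain rfl := eq_of_heq hd
    exact ⟨_, hx, _, h, rfl⟩

theorem IsClosing.forest (H : G.Fresh ι s) (y : List B) (hy : ∀ b ∈ y, ι b ≠ s) {v : List V}
    {W : FreeRigid (G.sig ι s) ⥤ FreeRigid (G.sig ι s)}
    {κ : (G.K ι s).E ((PregroupType.rightList (y.map ι)).map Sum.inl) false 0 ⋙ W ⟶ 𝟭 _}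
    (h : IsClosing G ι s v W ((G.K ι s).E ((PregroupType.rightList (y.map ι)).map Sum.inl) false 0)
      κ) :
    ∃ d, G.IsForest ι s y v W d ∧
      κ = Functor.whiskerLeft ((G.K ι s).E ((PregroupType.rightList (y.map ι)).map Sum.inl) false 0)
        d ≫ ((G.K ι s).adjR Sum.inl (y.map ι)).counit := by
  induction y generalizing v W with
  | nil =>
    obtain ⟨rfl, rfl, hκ⟩ := h.of_id rfl
    obtain rfl := eq_of_heq hκ
    refine ⟨_, isForest_nil, ?_⟩
    ext Z
    exact (Category.comp_id _).symm
  | cons b y ih =>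
    obtain ⟨v₁, v₂, W₁, W₂, κ₁, κ₂, rfl, rfl, h₁, h₂, hκ⟩ := h.split
      (N := (G.K ι s).T (Sum.inl (ι b)) (0 + 1)) (isComposite_T _ _) (isComposite_E _ _ _) rfl
    obtain rfl := eq_of_heq hκ
    obtain ⟨d₁, ht, rfl⟩ := h₁.single rfl .rfl
    obtain ⟨d₂, hd₂, rfl⟩ := ih (fun b hb => hy b (List.mem_cons_of_mem _ hb)) h₂
    have hd₁ := ht.forest H (hy b (List.mem_cons_self ..)) rfl .rfl
    exact ⟨_, isForest_append hd₂ hd₁, contract_comp _ _ _ _⟩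

/-- Closing the inputs of a basic reduction by trees amounts to closing its output by a tree. -/
theorem BoxRel.isTree (H : G.Fresh ι s) {a : B' ⊕ V}
    {Φ : FreeRigid (G.sig ι s) ⥤ FreeRigid (G.sig ι s)} {α : (G.K ι s).T a (0 + 1) ⟶ Φ}
    (hα : G.BoxRel ι s a Φ α) {v : List V} {W : FreeRigid (G.sig ι s) ⥤ FreeRigid (G.sig ι s)}
    {κ : Φ ⋙ W ⟶ 𝟭 _} (h : IsClosing G ι s v W Φ κ) :
    ∃ d, IsTree a v W d ∧ Functor.whiskerRight α W ≫ κ =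
      Functor.whiskerLeft ((G.K ι s).T a (0 + 1)) d ≫ ((G.K ι s).adj a 0).counit := by
  cases hα with
  | root hx =>
    obtain ⟨d, ht, rfl⟩ := h.single rfl .rfl
    exact ⟨_, .root hx (ht.forest H (H.root _ hx) rfl .rfl), conjugateEquiv_contract _ _ _ _⟩
  | @word w x y z hII hI =>
    have hO := isComposite_E (K := G.K ι s)
      ((PregroupType.rightList (y.map ι)).map Sum.inl) false 0
    obtain ⟨v₁, vr, W₁, Wr, κ₁, κr, rfl, rfl, h₁, hr, hκ⟩ :=
      h.split (hO.comp (isComposite_T _ _)) (isComposite_E _ _ _) rfl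
    obtain rfl := eq_of_heq hκ
    obtain ⟨vl, v₂, Wl, W₂, κl, κ₂, rfl, rfl, hl, h₂, hκ⟩ := h₁.split hO (isComposite_T _ _) rfl
    obtain rfl := eq_of_heq hκ
    obtain ⟨dl, hdl, rfl⟩ := hl.forest H y (H.left hI)
    obtain ⟨dr, hdr, rfl⟩ := hr.forest H z (H.right hI)
    obtain ⟨d, ht, rfl⟩ := h₂.single rfl .rfl
    cases ht with
    | word =>
      have h₀ := isForest_cons hII hI hdl hdr isForest_nil
      refine ⟨G.hatNode ι s hII hI dl dr, .tree (h₀.cast (by simp) rfl (heq_of_eq ?_)), ?_⟩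
      · exact id_hcomp (C := FreeRigid (G.sig ι s)) _
      · exact contract_node (C := FreeRigid (G.sig ι s)) _ _ _ _ _ _ _

/-- A component which grows out of a leg of degree `1` has only legs of degree `1`, so that all its
boxes are in their original positions; once its legs are closed by trees, it is itself a tree. -/
theorem isClosing_grow (H : G.Fresh ι s) {a : B' ⊕ V}
    {F : FreeRigid (G.sig ι s) ⥤ FreeRigid (G.sig ι s)} {β : (G.K ι s).T a (0 + 1) ⟶ F}
    (hβ : Grow (G.boxes ι s) ((G.K ι s).T a (0 + 1)) F β) :
    (G.K ι s).Degrees (· = 0 + 1) F ∧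
      ∀ {v : List V} {W : FreeRigid (G.sig ι s) ⥤ FreeRigid (G.sig ι s)} {κ : F ⋙ W ⟶ 𝟭 _},
        IsClosing G ι s v W F κ →
        IsClosing G ι s v W ((G.K ι s).T a (0 + 1)) (Functor.whiskerRight β W ≫ κ) := by
  induction hβ with
  | refl =>
    refine ⟨degrees_T.2 rfl, fun h => h.cast rfl rfl rfl (heq_of_eq ?_)⟩
    ext Z
    simp
  | @step N M Φ b n β α hN hM hΦ _ hα ih =>
    obtain ⟨ih₁, ih₂⟩ := ih
    obtain ⟨hdN, hd⟩ := (degrees_comp hN ((isComposite_T _ _).comp hM)).1 ih₁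
    obtain ⟨hdT, hdM⟩ := (degrees_comp (isComposite_T _ _) hM).1 hd
    obtain rfl : n = 0 := by
      have := degrees_T.1 hdT
      omega
    refine ⟨?_, ?_⟩
    · rcases hα.shape hΦ with ⟨h, -⟩ | ⟨-, h⟩
      · exact absurd h (by decide)
      · exact (degrees_comp hN (hΦ.comp hM)).2 ⟨hdN, (degrees_comp hΦ hM).2 ⟨h, hdM⟩⟩
    · intro v W κ h
      obtain ⟨v₁, v₂, W₁, W₂, κ₁, κ₂, rfl, rfl, h₁, h₂, hκ⟩ := h.split hN (hΦ.comp hM) rfl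
      obtain rfl := eq_of_heq hκ
      obtain ⟨v₃, v₄, W₃, W₄, κ₃, κ₄, rfl, rfl, h₃, h₄, hκ⟩ := h₂.split hΦ hM rfl
      obtain rfl := eq_of_heq hκ
      obtain ⟨d, ht, hd⟩ := BoxRel.isTree H (Op.rel hΦ hα) h₃
      have h₅ := ih₂ (h₁.append ((IsClosing.tree ht).append h₄ hM) ((isComposite_T _ _).comp hM))
      refine h₅.cast rfl rfl rfl (heq_of_eq ?_)
      rw [← hd]
      exact whiskerRight_comp_whisker (C := FreeRigid (G.sig ι s)) _ _ _ _ _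

theorem isClosing_words (u : List V) :
    IsClosing G ι s u (G.wordsE ι s u) ((G.K ι s).E (PregroupGrammar.words u) true (0 + 1))
      ((G.K ι s).adjE (PregroupGrammar.words u) false 0 (0 + 1) rfl).counit := by
  induction u with
  | nil => exact .nil
  | cons w u ih =>
    refine (IsClosing.cons (.word w) (isComposite_E _ _ _) ih).cast rfl rfl rfl (heq_of_eq ?_)
    exact contract_words (C := FreeRigid (G.sig ι s)) _ _

/-- Every reduction is that of a dependency tree. -/
theorem exists_toReduction_eq (H : G.Fresh ι s) {u : List V} (f : (G.pregroup ι s).Reduction u) :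
    ∃ t : G.Tree u, t.toReduction ι s = f := by
  induction f using Quotient.inductionOn with
  | h f =>
    -- the bent reduction, whose legs are closed by the words of the string, is a tree
    have h₁ := (isClosing_grow H (G.grow_of_reduction ι s u f)).2 (isClosing_words u)
    have h₂ := conjugateEquiv_contract_id ((G.K ι s).adj (Sum.inl s) 0)
      ((G.K ι s).adjE (PregroupGrammar.words u) false 0 (0 + 1) rfl) (G.hatReduction ι s f)
    obtain ⟨d, ht, hd⟩ := h₁.single rfl .rfl
    have h₃ : d = G.hatReduction ι s f := by
      refine contract_injective ((G.K ι s).adj (Sum.inl s) 0) (hd.symm.trans h₂)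
    clear hd h₂ h₁
    obtain ⟨x, hx, d', ⟨f', rfl, e, rfl⟩, h⟩ := ht.root_of_eq H rfl .rfl
    refine ⟨⟨x, hx, f', rfl⟩, hat_injective (S := G.sig ι s) ?_⟩
    have h₄ := hatT_comp (rfl : _ = G.hatForest ι s f') (hatT_comp
      (G.hatT_rightUnitHom ι s (PregroupGrammar.ob (.of (ι x)))) (rfl : _ = G.hatStep ι s hx))
    refine h₄.trans (Eq.trans ?_ (h.symm.trans h₃))
    exact comp_id_comp (C := FreeRigid (G.sig ι s)) _ _

end DependencyGrammar

/-! ### The interpretation of a rigid signature by relations -/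

namespace RigidSignature

universe w

variable {A : Type u}

/-- The set of values of a type, for given sets of values of the basic types: adjoint types have
the same values, as the category of sets and relations is compact closed. -/
def Val (D : A → Type w) : PregroupType A → Type w
  | .of a => D a
  | .unit => PUnit
  | .tensor X Y => Val D X × Val D Y
  | .left X => Val D X
  | .right X => Val D X

variable {S : RigidSignature.{u, v} A} {D : A → Type w}

/-- The interpretation of formal morphisms in the rigid category of sets and relations. -/
def eval (R : ∀ g : S.Gen, Val D (S.dom g) → Val D (S.cod g) → Prop) :
    ∀ {X Y : PregroupType A}, Term S X Y → Val D X → Val D Y → Prop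
  | _, _, .gen g => R g
  | _, _, .id _ => Eq
  | _, _, .comp f g => fun a c => ∃ b, eval R f a b ∧ eval R g b c
  | _, _, .tensor (X := X) (Y := Y) (X' := X') (Y' := Y') f g =>
    fun (a : Val D X × Val D X') (b : Val D Y × Val D Y') => eval R f a.1 b.1 ∧ eval R g a.2 b.2
  | _, _, .assocHom X Y Z => fun (a : (Val D X × Val D Y) × Val D Z) (b : _ × _ × _) =>
    b.1 = a.1.1 ∧ b.2.1 = a.1.2 ∧ b.2.2 = a.2
  | _, _, .assocInv X Y Z => fun (a : Val D X × Val D Y × Val D Z) (b : (_ × _) × _) =>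
    b.1.1 = a.1 ∧ b.1.2 = a.2.1 ∧ b.2 = a.2.2
  | _, _, .leftUnitHom X => fun (a : PUnit × Val D X) b => b = a.2
  | _, _, .leftUnitInv X => fun a (b : PUnit × Val D X) => b.2 = a
  | _, _, .rightUnitHom X => fun (a : Val D X × PUnit) b => b = a.1
  | _, _, .rightUnitInv X => fun a (b : Val D X × PUnit) => b.1 = a
  | _, _, .cupLeft X => fun (a : Val D X × Val D X) _ => a.1 = a.2
  | _, _, .capLeft X => fun _ (b : Val D X × Val D X) => b.1 = b.2
  | _, _, .cupRight X => fun (a : Val D X × Val D X) _ => a.1 = a.2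
  | _, _, .capRight X => fun _ (b : Val D X × Val D X) => b.1 = b.2

variable {R : ∀ g : S.Gen, Val D (S.dom g) → Val D (S.cod g) → Prop}

theorem Val.tensor_exists {X Y : PregroupType A} {P : Val D (.tensor X Y) → Prop} :
    (∃ p, P p) ↔ ∃ (a : Val D X) (b : Val D Y), P (a, b) := Prod.exists

theorem Val.left_exists {X : PregroupType A} {P : Val D (.left X) → Prop} :
    (∃ p, P p) ↔ ∃ a : Val D X, P a := Iff.rfl

theorem Val.right_exists {X : PregroupType A} {P : Val D (.right X) → Prop} :
    (∃ p, P p) ↔ ∃ a : Val D X, P a := Iff.rfl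

theorem Val.unit_exists {P : Val D (.unit : PregroupType A) → Prop} :
    (∃ p, P p) ↔ P PUnit.unit :=
  ⟨fun ⟨_, h⟩ => h, fun h => ⟨_, h⟩⟩

theorem Val.pair_eq {X Y : PregroupType A} {a a' : Val D X} {b b' : Val D Y} :
    @Eq (Val D (.tensor X Y)) (a, b) (a', b') ↔ a = a' ∧ b = b' := Prod.ext_iff

theorem Val.unit_eq (a b : Val D (.unit : PregroupType A)) : a = b ↔ True := by
  simp [show a = b from rfl]

set_option linter.unusedSimpArgs false in
/-- Relations satisfy the axioms of a rigid category. -/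
theorem eval_congr {X Y : PregroupType A} {f g : Term S X Y} (h : TermEq S f g) :
    eval R f = eval R g := by
  induction h with
  | refl => rfl
  | symm _ ih => exact ih.symm
  | trans _ _ ih₁ ih₂ => exact ih₁.trans ih₂
  | comp _ _ ih₁ ih₂ => simp only [eval, ih₁, ih₂]
  | tensor _ _ ih₁ ih₂ => simp only [eval, ih₁, ih₂]; rfl
  | id_comp f => ext a b; simp [eval]
  | comp_id f => ext a b; simp [eval]
  | assoc f g h => ext a b; simp only [eval]; tauto
  | tensor_id X Y => ext ⟨a, a'⟩ ⟨b, b'⟩; simp only [eval, Val.pair_eq]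
  | tensor_comp f f' g g' =>
    ext ⟨a, a'⟩ ⟨b, b'⟩; simp only [eval, Val.tensor_exists]; tauto
  | assoc_hom_inv X Y Z =>
    ext ⟨⟨a, b⟩, c⟩ ⟨⟨a', b'⟩, c'⟩; simp only [eval, Val.tensor_exists, Val.pair_eq]; grind
  | assoc_inv_hom X Y Z =>
    ext ⟨a, b, c⟩ ⟨a', b', c'⟩; simp only [eval, Val.tensor_exists, Val.pair_eq]; grind
  | assoc_naturality f₁ f₂ f₃ =>
    ext ⟨⟨a, b⟩, c⟩ ⟨a', b', c'⟩; simp only [eval, Val.tensor_exists, Val.pair_eq]; grind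
  | left_hom_inv X =>
    ext ⟨a, b⟩ ⟨a', b'⟩; simp only [eval, Val.pair_eq, Val.unit_eq]; grind
  | left_inv_hom X =>
    ext a b; simp only [eval, Val.tensor_exists, Val.pair_eq, Val.unit_eq, Val.unit_exists]; grind
  | left_naturality f =>
    ext ⟨a, b⟩ c
    simp only [eval, Val.tensor_exists, Val.unit_eq, Val.unit_exists]; grind
  | right_hom_inv X =>
    ext ⟨a, b⟩ ⟨a', b'⟩; simp only [eval, Val.pair_eq, Val.unit_eq]; grind
  | right_inv_hom X =>
    ext a b; simp only [eval, Val.tensor_exists, Val.pair_eq, Val.unit_eq, Val.unit_exists]; grind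
  | right_naturality f =>
    ext ⟨a, b⟩ c
    simp only [eval, Val.tensor_exists, Val.unit_eq, Val.unit_exists]; grind
  | pentagon W X Y Z =>
    ext ⟨⟨⟨a, b⟩, c⟩, d⟩ ⟨a', b', c', d'⟩
    simp only [eval, Val.tensor_exists, Val.pair_eq]; grind
  | triangle X Y =>
    ext ⟨⟨a, b⟩, c⟩ ⟨a', c'⟩
    simp only [eval, Val.tensor_exists, Val.pair_eq, Val.unit_eq, Val.unit_exists]; grind
  | snake_left X =>
    ext ⟨a, b⟩ ⟨a', b'⟩
    simp only [eval, Val.tensor_exists, Val.pair_eq, Val.unit_eq, Val.unit_exists,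
      Val.left_exists]; grind
  | snake_left' X =>
    ext ⟨(a : Val D X), b⟩ ⟨a', (b' : Val D X)⟩
    simp only [eval, Val.tensor_exists, Val.pair_eq, Val.unit_eq, Val.unit_exists,
      Val.left_exists]; grind
  | snake_right X =>
    ext ⟨a, b⟩ ⟨a', b'⟩
    simp only [eval, Val.tensor_exists, Val.pair_eq, Val.unit_eq, Val.unit_exists,
      Val.right_exists]; grind
  | snake_right' X =>
    ext ⟨a, (b : Val D X)⟩ ⟨(a' : Val D X), b'⟩
    simp only [eval, Val.tensor_exists, Val.pair_eq, Val.unit_eq, Val.unit_exists,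
      Val.right_exists]; grind

section

variable {X Y Z X' Y' Z' : PregroupType A}

theorem eval_assocHom_comp {f : Term S (.tensor X (.tensor Y Z)) X'} {a : Val D X} {b : Val D Y}
    {c : Val D Z} {d : Val D X'} :
    eval R (.comp (.assocHom X Y Z) f) ((a, b), c) d ↔ eval R f (a, b, c) d := by
  refine ⟨?_, fun h => ⟨(a, b, c), ⟨rfl, rfl, rfl⟩, h⟩⟩
  rintro ⟨⟨a', b', c'⟩, ⟨h₁, h₂, h₃⟩, h⟩
  obtain rfl : a' = a := h₁
  obtain rfl : b' = b := h₂
  obtain rfl : c' = c := h₃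
  exact h

theorem eval_assocInv_comp {f : Term S (.tensor (.tensor X Y) Z) X'} {a : Val D X} {b : Val D Y}
    {c : Val D Z} {d : Val D X'} :
    eval R (.comp (.assocInv X Y Z) f) (a, b, c) d ↔ eval R f ((a, b), c) d := by
  refine ⟨?_, fun h => ⟨((a, b), c), ⟨rfl, rfl, rfl⟩, h⟩⟩
  rintro ⟨⟨⟨a', b'⟩, c'⟩, ⟨h₁, h₂, h₃⟩, h⟩
  obtain rfl : a' = a := h₁
  obtain rfl : b' = b := h₂
  obtain rfl : c' = c := h₃
  exact h

theorem eval_id_tensor_comp {f : Term S X Y} {g : Term S (.tensor Z Y) Z'} {a : Val D Z}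
    {b : Val D X} {c : Val D Z'} :
    eval R (.comp (.tensor (.id Z) f) g) (a, b) c ↔ ∃ b', eval R f b b' ∧ eval R g (a, b') c := by
  constructor
  · rintro ⟨⟨a', b'⟩, ⟨h₁, h₂⟩, h⟩
    obtain rfl : a = a' := h₁
    exact ⟨b', h₂, h⟩
  · rintro ⟨b', h₂, h⟩
    exact ⟨(a, b'), ⟨rfl, h₂⟩, h⟩

theorem eval_tensor_id_comp {f : Term S X Y} {g : Term S (.tensor Y Z) Z'} {a : Val D Z}
    {b : Val D X} {c : Val D Z'} :
    eval R (.comp (.tensor f (.id Z)) g) (b, a) c ↔ ∃ b', eval R f b b' ∧ eval R g (b', a) c := by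
  constructor
  · rintro ⟨⟨b', a'⟩, ⟨h₂, h₁⟩, h⟩
    obtain rfl : a = a' := h₁
    exact ⟨b', h₂, h⟩
  · rintro ⟨b', h₂, h⟩
    exact ⟨(b', a), ⟨h₂, rfl⟩, h⟩

theorem eval_comp_iff_of_iff {f : Term S X Y} {g : Term S Y Z} {a : Val D X} {c : Val D Z}
    {b : Val D Y} (hf : ∀ b', eval R f a b' ↔ b' = b) :
    eval R (.comp f g) a c ↔ eval R g b c :=
  ⟨fun ⟨b', h, h'⟩ => (hf b').1 h ▸ h', fun h => ⟨b, (hf b).2 rfl, h⟩⟩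

end

end RigidSignature

/-! ### A dependency tree is determined by its reduction -/

namespace PregroupType

variable {A : Type u}

theorem rightList_injective : Function.Injective (rightList : List A → PregroupType A) := by
  intro y
  induction y with
  | nil => rintro (_ | ⟨b, y'⟩) h <;> simp_all [rightList]
  | cons a y ih =>
    rintro (_ | ⟨b, y'⟩) h
    · simp [rightList] at h
    · simp only [rightList, tensor.injEq, right.injEq, of.injEq] at h
      rw [ih h.1, h.2]

theorem leftList_injective : Function.Injective (leftList : List A → PregroupType A) := by
  intro y
  induction y with
  | nil => rintro (_ | ⟨b, y'⟩) h <;> simp_all [leftList]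
  | cons a y ih =>
    rintro (_ | ⟨b, y'⟩) h
    · simp [leftList] at h
    · simp only [leftList, tensor.injEq, left.injEq, of.injEq] at h
      rw [ih h.1, h.2]

end PregroupType

namespace DependencyGrammar

open RigidSignature

variable {V : Type u} {B : Type v} (G : DependencyGrammar V B) {B' : Type v} (ι : B → B') (s : B')

/-- The values of every basic type are all dependency trees, whatever their type. A word has only
one value. -/
def TreeVal (V : Type u) {B : Type v} (G : DependencyGrammar V B) (B' : Type v) :
    B' ⊕ V → Type (max u v)
  | .inl _ => Σ x, G.Forest [x]
  | .inr _ => PUnit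

variable {G}

/-- The value of `yʳ` which corresponds to a value of `y`, with the same entries in reverse order.
-/
def toRight : ∀ y : List B', Val (TreeVal V G B') (PregroupGrammar.ob (.ofList y)) →
    Val (TreeVal V G B') (PregroupGrammar.ob (.rightList y))
  | [], _ => PUnit.unit
  | _ :: y, p => (toRight y p.2, p.1)

/-- The value of `zˡ` which corresponds to a value of `z`, with the same entries in reverse order.
-/
def toLeft : ∀ z : List B', Val (TreeVal V G B') (PregroupGrammar.ob (.ofList z)) →
    Val (TreeVal V G B') (PregroupGrammar.ob (.leftList z))
  | [], _ => PUnit.unit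
  | _ :: z, p => (toLeft z p.2, p.1)

theorem toRight_injective (y : List B') : Function.Injective (toRight (V := V) (G := G) y) := by
  induction y with
  | nil => exact fun _ _ _ => rfl
  | cons b y ih =>
    rintro ⟨a, p⟩ ⟨a', p'⟩ h
    obtain ⟨h₁, h₂⟩ := Prod.mk.inj h
    exact Prod.ext h₂ (ih h₁)

theorem toLeft_injective (y : List B') : Function.Injective (toLeft (V := V) (G := G) y) := by
  induction y with
  | nil => exact fun _ _ _ => rfl
  | cons b y ih =>
    rintro ⟨a, p⟩ ⟨a', p'⟩ h
    obtain ⟨h₁, h₂⟩ := Prod.mk.inj h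
    exact Prod.ext h₂ (ih h₁)

/-- The list of the trees of a forest, as a value of the list of their types. -/
def Forest.val (ι : B → B') : ∀ {xs : List B}, G.Forest xs →
    Val (TreeVal V G B') (PregroupGrammar.ob (.ofList (xs.map ι)))
  | _, .nil => PUnit.unit
  | _, .cons w x y z hII hI l r rest => (⟨x, .cons w x y z hII hI l r .nil⟩, rest.val ι)

theorem Forest.val_injective {xs : List B} :
    Function.Injective (Forest.val (G := G) ι : G.Forest xs → _) := by
  intro f f' h
  induction f with
  | nil => cases f'; rfl
  | cons w x y z hII hI l r f _ _ ih =>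
    cases f' with
    | cons w' _ y' z' hII' hI' l' r' f' =>
      obtain ⟨h₁, h₂⟩ := Prod.mk.inj h
      obtain rfl := ih h₂
      obtain ⟨-, h₁⟩ := Sigma.mk.inj h₁
      obtain ⟨rfl, rfl, rfl, hl, hr, -⟩ := Forest.cons.inj (eq_of_heq h₁)
      obtain rfl := eq_of_heq hl
      obtain rfl := eq_of_heq hr
      rfl

/-- The values of the generators: a word of type `x`, together with dependents of types `y` and `z`,
yields a tree; induced steps do not change the tree. -/
def genVal : ∀ g : (G.pregroup ι s).signature.Gen,
    Val (TreeVal V G B') ((G.pregroup ι s).signature.dom g) →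
      Val (TreeVal V G B') ((G.pregroup ι s).signature.cod g) → Prop
  | .inl e, _, b => ∃ (x : B) (y z : List B) (hII : (e.1.1, x) ∈ G.typeII)
      (hI : (x, y, z) ∈ G.typeI) (l : G.Forest y) (r : G.Forest z),
      e.1.2 = .operadic (y.map ι) (ι x) (z.map ι) ∧
      HEq b (show Val (TreeVal V G B')
        (PregroupGrammar.ob (.operadic (y.map ι) (ι x) (z.map ι))) from
        (toRight _ (l.val ι), ⟨x, .cons e.1.1 x y z hII hI l r .nil⟩, toLeft _ (r.val ι)))
  | .inr _, a, b => @Eq (Σ x, G.Forest [x]) b a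

/-- The interpretation of reductions as relations between lists of dependency trees. -/
abbrev evalT {X Y : PregroupType (B' ⊕ V)} (f : (G.pregroup ι s).Tm X Y) :
    Val (TreeVal V G B') X → Val (TreeVal V G B') Y → Prop :=
  eval (genVal ι s) f

theorem evalT_cupsR (y : List B') (p q) (c) :
    evalT ι s ((G.pregroup ι s).cupsR y) (p, q) c ↔ q = toRight y p := by
  induction y generalizing c with
  | nil => exact iff_of_true rfl rfl
  | cons b y ih =>
    obtain ⟨a, p⟩ := p
    obtain ⟨q, a'⟩ := q
    refine eval_assocHom_comp.trans (eval_id_tensor_comp.trans ?_)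
    constructor
    · rintro ⟨a'', h, h'⟩
      obtain ⟨c', h, h''⟩ := eval_tensor_id_comp.1 (eval_assocInv_comp.1 h)
      exact Prod.ext ((ih _ _ _).1 h) (h''.symm.trans h'.symm)
    · intro h
      obtain ⟨h₁, h₂⟩ := Prod.mk.inj h
      exact ⟨a', eval_assocInv_comp.2 (eval_tensor_id_comp.2 ⟨PUnit.unit, (ih _ _ _).2 h₁, rfl⟩),
        h₂.symm⟩

theorem evalT_cupsL (y : List B') (p q) (c) :
    evalT ι s ((G.pregroup ι s).cupsL y) (q, p) c ↔ q = toLeft y p := by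
  induction y generalizing c with
  | nil => exact iff_of_true rfl rfl
  | cons b y ih =>
    obtain ⟨a, p⟩ := p
    obtain ⟨q, a'⟩ := q
    refine eval_assocHom_comp.trans (eval_id_tensor_comp.trans ?_)
    constructor
    · rintro ⟨p', h, h'⟩
      obtain ⟨c', h₁, h₂⟩ := eval_tensor_id_comp.1 (eval_assocInv_comp.1 h)
      obtain rfl : p' = p := h₂
      exact Prod.ext ((ih _ _ _).1 h') h₁
    · intro h
      obtain ⟨h₁, h₂⟩ := Prod.mk.inj h
      exact ⟨p, eval_assocInv_comp.2 (eval_tensor_id_comp.2 ⟨PUnit.unit, h₂, rfl⟩),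
        (ih _ _ _).2 h₁⟩

theorem evalT_link (y : List B') (x : B') (z : List B') (p p' q q' a b) :
    evalT ι s ((G.pregroup ι s).link y x z) (p, (q, a, q'), p') b ↔
      q = toRight y p ∧ q' = toLeft z p' ∧ b = a := by
  refine eval_id_tensor_comp.trans ?_
  constructor
  · rintro ⟨⟨q₁, a₁⟩, h, h'⟩
    obtain ⟨h₁, h₂⟩ := eval_assocHom_comp.1 h
    obtain ⟨c, h₃, h₄⟩ := eval_id_tensor_comp.1 (eval_assocHom_comp.1 h₂)
    obtain ⟨c', h₅, h₆⟩ := eval_tensor_id_comp.1 (eval_assocInv_comp.1 h')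
    exact ⟨Eq.trans h₁ ((evalT_cupsR ι s y _ _ _).1 h₅), (evalT_cupsL ι s z _ _ _).1 h₃,
      Eq.trans h₆ h₄⟩
  · rintro ⟨h₁, h₂, rfl⟩
    exact ⟨(q, b), eval_assocHom_comp.2 ⟨rfl, eval_assocHom_comp.2 (eval_id_tensor_comp.2
      ⟨PUnit.unit, (evalT_cupsL ι s z _ _ _).2 h₂, rfl⟩)⟩, eval_assocInv_comp.2
      (eval_tensor_id_comp.2 ⟨PUnit.unit, (evalT_cupsR ι s y _ _ _).2 h₁, rfl⟩)⟩

theorem evalT_lex (hι : Function.Injective ι) {w : V} {x : B} {y z : List B}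
    (hII : (w, x) ∈ G.typeII) (hI : (x, y, z) ∈ G.typeI) (c q q' a) :
    evalT ι s ((G.pregroup ι s).lex w (.operadic (y.map ι) (ι x) (z.map ι)) ⟨x, y, z, hII, hI, rfl⟩)
      c (q, a, q') ↔ ∃ (l : G.Forest y) (r : G.Forest z), q = toRight _ (l.val ι) ∧
        q' = toLeft _ (r.val ι) ∧ a = ⟨x, .cons w x y z hII hI l r .nil⟩ := by
  constructor
  · rintro ⟨x', y', z', hII', hI', l, r, h, e⟩
    simp only [PregroupType.operadic, PregroupType.tensor.injEq, PregroupType.of.injEq] at h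
    obtain ⟨h₁, h₂, h₃⟩ := h
    obtain rfl := hι h₂
    obtain rfl := hι.list_map (PregroupType.rightList_injective h₁)
    obtain rfl := hι.list_map (PregroupType.leftList_injective h₃)
    obtain ⟨h₁, h₂⟩ := Prod.mk.inj (eq_of_heq e)
    obtain ⟨h₂, h₃⟩ := Prod.mk.inj h₂
    exact ⟨l, r, h₁, h₃, h₂⟩
  · rintro ⟨l, r, rfl, rfl, rfl⟩
    exact ⟨x, y, z, hII, hI, l, r, rfl, .rfl⟩

/-- The value of a string of words. -/
def wordsVal : ∀ u : List V, Val (TreeVal V G B') (PregroupGrammar.words u)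
  | [] => PUnit.unit
  | _ :: u => (PUnit.unit, wordsVal u)

theorem eq_of_words (u : List V) (a b : Val (TreeVal V G B') (PregroupGrammar.words u)) :
    a = b := by
  induction u with
  | nil => rfl
  | cons w u ih => exact Prod.ext rfl (ih _ _)

theorem evalT_split (u u' : List V) (a b) : evalT ι s ((G.pregroup ι s).split u u') a b := by
  induction u with
  | nil => exact eq_of_words _ _ _
  | cons w u ih =>
    exact ⟨(a.1, b.1.2, b.2), ⟨rfl, ih _ _⟩, rfl, rfl, rfl⟩

/-- The relation of a forest has this forest as its only value. -/
theorem evalT_toTerm (hι : Function.Injective ι) {xs : List B} (f : G.Forest xs) (a b) :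
    evalT ι s (f.toTerm ι s) a b ↔ b = f.val ι := by
  induction f with
  | nil => exact iff_of_true rfl rfl
  | cons w x y z hII hI l r f ihl ihr ih =>
    constructor
    · rintro ⟨⟨a₁, b₁, c₁⟩, -, ⟨p, ⟨q, a₂, q'⟩, p', f'⟩, ⟨hl, hw, ⟨b₃, c₃⟩, -, hr, hf⟩, h⟩
      obtain rfl := (ihl _ _).1 hl
      obtain rfl := (ihr _ _).1 hr
      obtain rfl := (ih _ _).1 hf
      obtain ⟨l', r', rfl, rfl, rfl⟩ := (evalT_lex ι s hι hII hI _ _ _ _).1 hw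
      obtain ⟨⟨⟨⟨q₁, a₁, q₁'⟩, p₁⟩, f₁⟩, ⟨h₁, h₂, h₃⟩, h₄⟩ := eval_id_tensor_comp.1 h
      obtain ⟨h₅, h₆⟩ := eval_assocInv_comp.1 h₄
      obtain ⟨h₇, h₈⟩ := Prod.mk.inj h₁
      obtain ⟨h₈, h₉⟩ := Prod.mk.inj h₈
      obtain rfl : p₁ = r.val ι := h₂
      obtain ⟨h, h', h''⟩ := (evalT_link ι s _ _ _ _ _ _ _ _ _).1 h₅
      obtain rfl := Forest.val_injective ι (toRight_injective _ (h₇.symm.trans h))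
      obtain rfl := Forest.val_injective ι (toLeft_injective _ (h₉.symm.trans h'))
      exact Prod.ext (h''.trans h₈) (Eq.trans (Eq.symm h₆) h₃)
    · rintro rfl
      refine ⟨(wordsVal l.yield, PUnit.unit, wordsVal (r.yield ++ f.yield)),
        evalT_split ι s _ _ _ _, (l.val ι, (toRight _ (l.val ι),
          (⟨x, .cons w x y z hII hI l r .nil⟩ : Σ x, G.Forest [x]), toLeft _ (r.val ι)),
        r.val ι, f.val ι), ⟨(ihl _ _).2 rfl, (evalT_lex ι s hι hII hI _ _ _ _).2
          ⟨l, r, rfl, rfl, rfl⟩, (wordsVal r.yield, wordsVal f.yield), evalT_split ι s _ _ _ _,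
          (ihr _ _).2 rfl, (ih _ _).2 rfl⟩, ?_⟩
      exact eval_id_tensor_comp.2 ⟨((_, r.val ι), f.val ι), ⟨rfl, rfl, rfl⟩, eval_assocInv_comp.2
        ⟨(evalT_link ι s _ _ _ _ _ _ _ _ _).2 ⟨rfl, rfl, rfl⟩, rfl⟩⟩

/-- The interpretation of a reduction as a relation. -/
def evalReduction {u : List V} (f : (G.pregroup ι s).Reduction u) (d : Σ x, G.Forest [x]) : Prop :=
  Quotient.liftOn f (fun f => evalT ι s f (wordsVal u) d) fun _ _ h => by
    rw [evalT, evalT, eval_congr h]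

theorem evalReduction_toReduction (hι : Function.Injective ι) {u : List V} (t : G.Tree u)
    (d : Σ x, G.Forest [x]) :
    evalReduction ι s (t.toReduction ι s) d ↔ d = ⟨t.root, t.forest⟩ := by
  obtain ⟨x, hx, f, rfl⟩ := t
  cases f with
  | cons w x y z hII hI l r f =>
    cases f
    refine (eval_comp_iff_of_iff (evalT_toTerm ι s hι _ _)).trans ?_
    constructor
    · rintro ⟨d', h, h'⟩
      exact Eq.trans h' h
    · rintro rfl
      exact ⟨_, rfl, rfl⟩

/-- A dependency tree is determined by its reduction. -/
theorem toReduction_injective (hι : Function.Injective ι) {u : List V} :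
    Function.Injective (Tree.toReduction ι s : G.Tree u → _) := by
  intro t t' h
  have h' := (evalReduction_toReduction ι s hι t' _).1
    (h ▸ (evalReduction_toReduction ι s hι t _).2 rfl)
  obtain ⟨x, hx, f, e⟩ := t
  obtain ⟨x', hx', f', e'⟩ := t'
  obtain ⟨rfl, h'⟩ := Sigma.mk.inj h'
  obtain rfl := eq_of_heq h'
  rfl

end DependencyGrammar

/-! ### Derivation trees of the context-free grammar -/

namespace CFG.Forest

variable {V : Type u} {N : Type v} {C : CFG V N}

/-- The nodes are compared one by one, hence the statement for lists of roots which are only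
propositionally equal. -/
theorem append_inj_of_heq {α α' β : List (Symbol V N)} {g g' : C.Forest β} {f : C.Forest α}
    {f' : C.Forest α'} (e : α = α') (h : HEq (append g f) (append g' f')) : g = g' ∧ HEq f f' := by
  induction f generalizing α' with
  | nil =>
    cases f' with
    | nil => exact ⟨eq_of_heq h, .rfl⟩
    | _ => cases e
  | leaf w f ih =>
    cases f' with
    | leaf w' f' =>
      obtain ⟨h₁, rfl⟩ := List.cons.inj e
      obtain rfl := Symbol.terminal.inj h₁
      simp only [append, heq_eq_eq] at h
      obtain ⟨rfl, h₂⟩ := ih rfl (heq_of_eq (leaf.inj h))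
      exact ⟨rfl, heq_of_eq (congrArg _ (eq_of_heq h₂))⟩
    | _ => cases e
  | node r hr c f _ ih =>
    cases f' with
    | node r' hr' c' f' =>
      obtain ⟨n, o⟩ := r
      obtain ⟨n', o'⟩ := r'
      obtain ⟨h₁, rfl⟩ := List.cons.inj e
      obtain rfl : n = n' := Symbol.nonterminal.inj h₁
      simp only [append, heq_eq_eq] at h
      injection h with h₁ h₂ h₃ h₄
      obtain rfl : o = o' := (ContextFreeRule.mk.inj h₁).2
      obtain rfl := eq_of_heq h₂
      obtain ⟨rfl, h₂⟩ := ih rfl (heq_of_eq h₄)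
      exact ⟨rfl, heq_of_eq (congrArg _ (eq_of_heq h₂))⟩
    | _ => cases e

theorem append_inj {α β : List (Symbol V N)} {g g' : C.Forest β} {f f' : C.Forest α}
    (h : append g f = append g' f') : g = g' ∧ f = f' :=
  (append_inj_of_heq rfl (heq_of_eq h)).imp_right eq_of_heq

end CFG.Forest

namespace DependencyGrammar

variable {V : Type u} {B : Type v} {G : DependencyGrammar V B} {B' : Type v} {ι : B → B'} {s : B'}

theorem rhs_inj (hι : Function.Injective ι) {y y' : List B} {w w' : V} {z z' : List B}
    (h : rhs ι y w z = rhs ι y' w' z') : y = y' ∧ w = w' ∧ z = z' := by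
  induction y generalizing y' with
  | nil =>
    cases y' with
    | nil =>
      obtain ⟨h₁, h₂⟩ := List.cons.inj h
      refine ⟨rfl, Symbol.terminal.inj h₁, List.map_injective_iff.2 (fun a b h => ?_) h₂⟩
      exact hι (Symbol.nonterminal.inj h)
    | cons => simp [rhs] at h
  | cons b y ih =>
    cases y' with
    | nil => simp [rhs] at h
    | cons b' y' =>
      obtain ⟨h₁, h₂⟩ := List.cons.inj h
      obtain ⟨rfl, rfl, rfl⟩ := ih h₂
      rw [hι (Symbol.nonterminal.inj h₁)]
      exact ⟨rfl, rfl, rfl⟩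

theorem toCFG_injective (hι : Function.Injective ι) {xs : List B} :
    Function.Injective (Forest.toCFG ι s : G.Forest xs → _) := by
  intro f f' h
  induction f with
  | nil => cases f'; rfl
  | cons w x y z hII hI l r f ihl ihr ih =>
    cases f' with
    | cons w' _ y' z' hII' hI' l' r' f' =>
      injection h with h₁ h₂ h₃ h₄
      obtain ⟨rfl, rfl, rfl⟩ := rhs_inj hι (ContextFreeRule.mk.inj h₁).2
      obtain ⟨h₅, h₆⟩ := CFG.Forest.append_inj (eq_of_heq h₂)
      obtain rfl := ihl h₆
      obtain rfl := ihr (CFG.Forest.leaf.inj h₅)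
      obtain rfl := ih h₄
      rfl

/-- Derivation trees whose roots are not labelled by the sentence symbol come from dependency
trees: only rules `x → y w z` can occur in them. The second part is about the children of a node. -/
theorem exists_toCFG (H : G.Fresh ι s) {α : List (Symbol V B')} (t : (G.cfg ι s).Forest α) :
    (∀ xs : List B, (∀ b ∈ xs, ι b ≠ s) → α = xs.map (fun b => .nonterminal (ι b)) →
      ∃ f : G.Forest xs, HEq t (f.toCFG ι s)) ∧
    ∀ (y : List B) (w : V) (z : List B), (∀ b ∈ y, ι b ≠ s) → (∀ b ∈ z, ι b ≠ s) →
      α = rhs ι y w z → ∃ (l : G.Forest y) (r : G.Forest z),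
        HEq t (CFG.Forest.append (.leaf w (r.toCFG ι s)) (l.toCFG ι s)) := by
  induction t with
  | nil =>
    refine ⟨fun xs _ h => ?_, fun y w z _ _ h => ?_⟩
    · obtain rfl := List.map_eq_nil_iff.1 h.symm
      exact ⟨.nil, .rfl⟩
    · simp [rhs] at h
  | leaf w t ih =>
    refine ⟨fun xs _ h => ?_, fun y w' z _ hz h => ?_⟩
    · cases xs <;> simp at h
    · cases y with
      | cons => simp [rhs] at h
      | nil =>
        obtain ⟨h₁, rfl⟩ := List.cons.inj h
        obtain rfl := Symbol.terminal.inj h₁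
        obtain ⟨f, hf⟩ := ih.1 z hz rfl
        obtain rfl := eq_of_heq hf
        exact ⟨.nil, f, .rfl⟩
  | node r hr c t ihc ih =>
    have key : ∀ b, ι b ≠ s → r.input = ι b → ∃ (w : V) (y z : List B) (hII : (w, b) ∈ G.typeII)
        (hI : (b, y, z) ∈ G.typeI) (f : G.Forest y) (f' : G.Forest z), r = ⟨ι b, rhs ι y w z⟩ ∧
        HEq c (CFG.Forest.append (.leaf w (f'.toCFG ι s)) (f.toCFG ι s)) := by
      intro b hb h
      rcases hr with ⟨w, x, y, z, hII, hI, rfl⟩ | ⟨x, hx, rfl⟩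
      · obtain rfl := H.injective h
        obtain ⟨f, f', h⟩ := ihc.2 y w z (H.left hI) (H.right hI) rfl
        exact ⟨w, y, z, hII, hI, f, f', rfl, h⟩
      · exact (hb h.symm).elim
    refine ⟨fun xs hxs h => ?_, fun y w z hy hz h => ?_⟩
    · cases xs with
      | nil => simp at h
      | cons b xs =>
        obtain ⟨h₁, rfl⟩ := List.cons.inj h
        obtain ⟨w, y, z, hII, hI, f, f', rfl, hc⟩ := key b (hxs b (List.mem_cons_self ..))
          (Symbol.nonterminal.inj h₁)
        obtain rfl := eq_of_heq hc
        obtain ⟨f'', hf⟩ := ih.1 xs (fun b hb => hxs b (List.mem_cons_of_mem _ hb)) rfl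
        obtain rfl := eq_of_heq hf
        exact ⟨.cons w b y z hII hI f f' f'', .rfl⟩
    · cases y with
      | nil => simp [rhs] at h
      | cons b xs =>
        obtain ⟨h₁, rfl⟩ := List.cons.inj h
        obtain ⟨w', y', z', hII, hI, f, f', rfl, hc⟩ := key b (hy b (List.mem_cons_self ..))
          (Symbol.nonterminal.inj h₁)
        obtain rfl := eq_of_heq hc
        obtain ⟨f'', r, hf⟩ := ih.2 xs w z (fun b hb => hy b (List.mem_cons_of_mem _ hb)) hz rfl
        obtain rfl := eq_of_heq hf
        exact ⟨.cons w' b y' z' hII hI f f' f'', r, .rfl⟩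

/-- Dependency trees correspond to derivation trees. -/
theorem toDerivation_bijective (H : G.Fresh ι s) (u : List V) :
    Function.Bijective (Tree.toDerivation ι s : G.Tree u → _) := by
  constructor
  · rintro ⟨x, hx, f, hf⟩ ⟨x', hx', f', hf'⟩ h
    have h := congrArg Subtype.val h
    injection h with h₁ h₂ h₃ h₄
    obtain rfl := H.injective (Symbol.nonterminal.inj
      (List.cons.inj (ContextFreeRule.mk.inj h₁).2).1)
    obtain rfl := toCFG_injective H.injective (eq_of_heq h₂)
    rfl
  · rintro ⟨t, rfl⟩
    have key : ∀ {α : List (Symbol V B')} (t : (G.cfg ι s).Forest α),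
        α = [.nonterminal s] → ∃ (x : B) (hx : x ∈ G.typeIII) (f : G.Forest [x]),
          HEq t (CFG.Forest.node ⟨s, [.nonterminal (ι x)]⟩ (G.root_mem ι s hx) (f.toCFG ι s)
            .nil) := by
      intro α t e
      cases t with
      | node r hr c t =>
        obtain ⟨h, rfl⟩ := List.cons.inj e
        have h := Symbol.nonterminal.inj h
        rcases hr with ⟨w, x, y, z, hII, hI, rfl⟩ | ⟨x, hx, rfl⟩
        · exact (H.head hI h).elim
        · obtain ⟨f, hf⟩ := (exists_toCFG H c).1 [x] (by simpa using H.root x hx) rfl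
          obtain rfl := eq_of_heq hf
          cases t
          exact ⟨x, hx, f, .rfl⟩
      | _ => cases e
    obtain ⟨x, hx, f, h⟩ := key t rfl
    obtain rfl := eq_of_heq h
    refine ⟨⟨x, hx, f, ?_⟩, rfl⟩
    simp [CFG.Forest.yield, Forest.yield_toCFG]

end DependencyGrammar

/-! ### Positions and dependencies in a forest -/

namespace Relation

/-- If a set is closed under passing from `y` to `x` whenever `r x y`, then chains of `r` which end
in the set stay in it. -/
theorem TransGen.of_closed {α : Type*} {r r' : α → α → Prop} {S : Set α}
    (h : ∀ x y, y ∈ S → r x y → r' x y ∧ x ∈ S) {a b : α} (hb : b ∈ S) (hab : TransGen r a b) :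
    TransGen r' a b ∧ a ∈ S := by
  induction hab using TransGen.head_induction_on with
  | single hab => exact ⟨.single (h _ _ hb hab).1, (h _ _ hb hab).2⟩
  | head hac _ ih => exact ⟨.head (h _ _ ih.2 hac).1 ih.1, (h _ _ ih.2 hac).2⟩

theorem ReflTransGen.of_closed {α : Type*} {r r' : α → α → Prop} {S : Set α}
    (h : ∀ x y, y ∈ S → r x y → r' x y ∧ x ∈ S) {a b : α} (hb : b ∈ S) (hab : ReflTransGen r a b) :
    ReflTransGen r' a b ∧ a ∈ S := by
  induction hab using ReflTransGen.head_induction_on with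
  | refl => exact ⟨.refl, hb⟩
  | head hac _ ih => exact ⟨.head (h _ _ ih.2 hac).1 ih.1, (h _ _ ih.2 hac).2⟩

end Relation

namespace DependencyGrammar.Forest

open Relation

variable {V : Type u} {B : Type v} {G : DependencyGrammar V B}

theorem length_types {xs : List B} (f : G.Forest xs) : f.types.length = f.yield.length := by
  induction f with
  | nil => rfl
  | cons w x y z hII hI l r f ihl ihr ih => simp [types, yield, ihl, ihr, ih]

theorem length_heads {xs : List B} (f : G.Forest xs) (n : ℕ) (h : Option ℕ) :
    (f.heads n h).length = f.yield.length := by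
  induction f generalizing n h with
  | nil => rfl
  | cons w x y z hII hI l r f ihl ihr ih => simp [heads, yield, ihl, ihr, ih]

theorem length_cons {w : V} {x : B} {y z xs : List B} {hII : (w, x) ∈ G.typeII}
    {hI : (x, y, z) ∈ G.typeI} (l : G.Forest y) (r : G.Forest z) (f : G.Forest xs) :
    (Forest.cons w x y z hII hI l r f).yield.length =
      l.yield.length + 1 + r.yield.length + f.yield.length := by
  simp only [yield, List.length_append, List.length_cons]
  omega

/-- The dependencies between positions given by a forest whose first word has position `n` and
whose roots depend on `h`. -/
def Edge : ∀ {xs : List B}, G.Forest xs → ℕ → Option ℕ → ℕ → ℕ → Prop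
  | _, .nil, _, _, _, _ => False
  | _, .cons _ _ _ _ _ _ l r rest, n, h, i, j =>
    l.Edge n (some (n + l.yield.length)) i j ∨ (i = n + l.yield.length ∧ h = some j) ∨
      r.Edge (n + l.yield.length + 1) (some (n + l.yield.length)) i j ∨
      rest.Edge (n + l.yield.length + 1 + r.yield.length) h i j

theorem Edge.range {xs : List B} {f : G.Forest xs} {n : ℕ} {h : Option ℕ} {i j : ℕ}
    (e : f.Edge n h i j) : n ≤ i ∧ i < n + f.yield.length ∧
      (h = some j ∨ n ≤ j ∧ j < n + f.yield.length) := by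
  induction f generalizing n h with
  | nil => exact e.elim
  | cons w x y z hII hI l r f ihl ihr ih =>
    rw [length_cons]
    rcases e with e | ⟨rfl, rfl⟩ | e | e
    · have := ihl e
      simp only [Option.some.injEq] at this
      omega
    · exact ⟨by omega, by omega, .inl rfl⟩
    · have := ihr e
      simp only [Option.some.injEq] at this
      omega
    · obtain ⟨h₁, h₂, h₃⟩ := ih e
      exact ⟨by omega, by omega, h₃.imp_right fun h => by omega⟩

theorem edge_iff {xs : List B} (f : G.Forest xs) (n : ℕ) (h : Option ℕ) (k j : ℕ) :
    (f.heads n h)[k]? = some (some j) ↔ f.Edge n h (n + k) j := by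
  induction f generalizing n h k with
  | nil => simp [heads, Edge]
  | cons w x y z hII hI l r f ihl ihr ih =>
    simp only [heads, Edge]
    rcases lt_trichotomy k l.yield.length with hk | rfl | hk
    · rw [List.getElem?_append_left (by rw [length_heads]; exact hk), ihl]
      refine ⟨.inl, ?_⟩
      rintro (e | ⟨e, -⟩ | e | e)
      · exact e
      · omega
      · have := e.range; omega
      · have := e.range; omega
    · rw [List.getElem?_append_right (by rw [length_heads]), length_heads]
      simp only [Nat.sub_self, List.getElem?_cons_zero, Option.some.injEq, true_and]
      refine ⟨fun h => .inr (.inl h), ?_⟩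
      rintro (e | e | e | e)
      · have := e.range; omega
      · exact e
      · have := e.range; omega
      · have := e.range; omega
    · rw [List.getElem?_append_right (by rw [length_heads]; omega), length_heads]
      obtain ⟨k, rfl⟩ : ∃ k', k = l.yield.length + (k' + 1) := ⟨k - l.yield.length - 1, by omega⟩
      rw [Nat.add_sub_cancel_left, List.getElem?_cons_succ]
      rcases lt_or_ge k r.yield.length with hk' | hk'
      · rw [List.getElem?_append_left (by rw [length_heads]; exact hk'), ihr,
          show n + l.yield.length + 1 + k = n + (l.yield.length + (k + 1)) by omega]
        refine ⟨fun h => .inr (.inr (.inl h)), ?_⟩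
        rintro (e | ⟨e, -⟩ | e | e)
        · have := e.range; omega
        · omega
        · exact e
        · have := e.range; omega
      · rw [List.getElem?_append_right (by rw [length_heads]; exact hk'), length_heads, ih,
          show n + l.yield.length + 1 + r.yield.length + (k - r.yield.length) =
            n + (l.yield.length + (k + 1)) by omega]
        refine ⟨fun h => .inr (.inr (.inr h)), ?_⟩
        rintro (e | ⟨e, -⟩ | e | e)
        · have := e.range; omega
        · omega
        · have := e.range; omega
        · exact e

/-- Every word of a forest is governed, directly or indirectly, by the head of the roots. -/
theorem reaches_head {xs : List B} (f : G.Forest xs) (n k i : ℕ) (hi : n ≤ i)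
    (hi' : i < n + f.yield.length) : TransGen (f.Edge n (some k)) i k := by
  induction f generalizing n k with
  | nil => simp [yield] at hi'; omega
  | cons w x y z hII hI l r f ihl ihr ih =>
    rw [length_cons] at hi'
    have hp : (Forest.cons w x y z hII hI l r f).Edge n (some k) (n + l.yield.length) k :=
      .inr (.inl ⟨rfl, rfl⟩)
    rcases lt_trichotomy i (n + l.yield.length) with h | rfl | h
    · exact .tail ((ihl n _ hi h).lift id fun _ _ h => .inl h) hp
    · exact .single hp
    · rcases lt_or_ge i (n + l.yield.length + 1 + r.yield.length) with h' | h'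
      · exact .tail ((ihr _ _ (by omega) h').lift id fun _ _ h => .inr (.inr (.inl h))) hp
      · exact (ih _ _ h' (by omega)).lift id fun _ _ h => .inr (.inr (.inr h))

section

variable {w : V} {x : B} {y z xs : List B} {hII : (w, x) ∈ G.typeII} {hI : (x, y, z) ∈ G.typeI}
  {l : G.Forest y} {r : G.Forest z} {f : G.Forest xs} {n : ℕ} {h : Option ℕ}

/-- A word which depends on a word of the left subtree is itself in the left subtree. -/
theorem edge_left (hh : ∀ k, h = some k → k < n ∨
      n + (Forest.cons w x y z hII hI l r f).yield.length ≤ k) {i j : ℕ}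
    (hj : j ∈ Set.Ico n (n + l.yield.length))
    (e : (Forest.cons w x y z hII hI l r f).Edge n h i j) :
    l.Edge n (some (n + l.yield.length)) i j ∧ i ∈ Set.Ico n (n + l.yield.length) := by
  rw [length_cons] at hh
  obtain ⟨hj, hj'⟩ := hj
  rcases e with e | ⟨rfl, rfl⟩ | e | e
  · exact ⟨e, e.range.1, e.range.2.1⟩
  · have := hh j rfl
    omega
  · have := e.range
    simp only [Option.some.injEq] at this
    omega
  · obtain ⟨h₁, h₂, rfl | h₃⟩ := e.range
    · have := hh j rfl
      omega
    · omega

theorem edge_right (hh : ∀ k, h = some k → k < n ∨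
      n + (Forest.cons w x y z hII hI l r f).yield.length ≤ k) {i j : ℕ}
    (hj : j ∈ Set.Ico (n + l.yield.length + 1) (n + l.yield.length + 1 + r.yield.length))
    (e : (Forest.cons w x y z hII hI l r f).Edge n h i j) :
    r.Edge (n + l.yield.length + 1) (some (n + l.yield.length)) i j ∧
      i ∈ Set.Ico (n + l.yield.length + 1) (n + l.yield.length + 1 + r.yield.length) := by
  rw [length_cons] at hh
  obtain ⟨hj, hj'⟩ := hj
  rcases e with e | ⟨rfl, rfl⟩ | e | e
  · have := e.range
    simp only [Option.some.injEq] at this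
    omega
  · have := hh j rfl
    omega
  · exact ⟨e, e.range.1, e.range.2.1⟩
  · obtain ⟨h₁, h₂, rfl | h₃⟩ := e.range
    · have := hh j rfl
      omega
    · omega

theorem edge_rest (hh : ∀ k, h = some k → k < n ∨
      n + (Forest.cons w x y z hII hI l r f).yield.length ≤ k) {i j : ℕ}
    (hj : j ∈ Set.Ico (n + l.yield.length + 1 + r.yield.length)
      (n + l.yield.length + 1 + r.yield.length + f.yield.length))
    (e : (Forest.cons w x y z hII hI l r f).Edge n h i j) :
    f.Edge (n + l.yield.length + 1 + r.yield.length) h i j ∧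
      i ∈ Set.Ico (n + l.yield.length + 1 + r.yield.length)
        (n + l.yield.length + 1 + r.yield.length + f.yield.length) := by
  rw [length_cons] at hh
  obtain ⟨hj, hj'⟩ := hj
  rcases e with e | ⟨rfl, rfl⟩ | e | e
  · have := e.range
    simp only [Option.some.injEq] at this
    omega
  · have := hh j rfl
    omega
  · have := e.range
    simp only [Option.some.injEq] at this
    omega
  · exact ⟨e, e.range.1, e.range.2.1⟩

theorem edge_root (hh : ∀ k, h = some k → k < n ∨
      n + (Forest.cons w x y z hII hI l r f).yield.length ≤ k) {i j : ℕ}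
    (hj : j ∈ Set.Ico n (n + l.yield.length + 1 + r.yield.length))
    (e : (Forest.cons w x y z hII hI l r f).Edge n h i j) :
    i ∈ Set.Ico n (n + l.yield.length + 1 + r.yield.length) := by
  rw [length_cons] at hh
  obtain ⟨hj, hj'⟩ := hj
  rcases e with e | ⟨rfl, rfl⟩ | e | e
  · have := e.range
    exact ⟨by omega, by omega⟩
  · have := hh j rfl
    omega
  · have := e.range
    exact ⟨by omega, by omega⟩
  · obtain ⟨h₁, h₂, rfl | h₃⟩ := e.range
    · have := hh j rfl
      omega
    · omega

/-- The positions governed by the first root are those of its tree. -/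
theorem reaches_root (hh : ∀ k, h = some k → k < n ∨
      n + (Forest.cons w x y z hII hI l r f).yield.length ≤ k) (i : ℕ) :
    ReflTransGen ((Forest.cons w x y z hII hI l r f).Edge n h) i (n + l.yield.length) ↔
      n ≤ i ∧ i < n + l.yield.length + 1 + r.yield.length := by
  refine ⟨fun e => (e.of_closed (r' := (Forest.cons w x y z hII hI l r f).Edge n h)
    (S := Set.Ico n (n + l.yield.length + 1 + r.yield.length))
    (fun _ _ hj e => ⟨e, edge_root hh hj e⟩) ⟨by omega, by omega⟩).2, fun ⟨hi, hi'⟩ => ?_⟩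
  rcases lt_trichotomy i (n + l.yield.length) with h | rfl | h
  · exact ((l.reaches_head n _ i hi h).lift id fun _ _ h => .inl h).to_reflTransGen
  · exact .refl
  · exact ((r.reaches_head _ _ i (by omega) hi').lift id
      fun _ _ h => .inr (.inr (.inl h))).to_reflTransGen

end

/-- The positions governed by a position form an interval; this yields the planarity of an analysis.
-/
theorem exists_reaches_iff {xs : List B} (f : G.Forest xs) (n : ℕ) (h : Option ℕ)
    (hh : ∀ k, h = some k → k < n ∨ n + f.yield.length ≤ k) (k : ℕ) (hk : n ≤ k)
    (hk' : k < n + f.yield.length) :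
    ∃ a b, a ≤ k ∧ k < b ∧ ∀ i, ReflTransGen (f.Edge n h) i k ↔ a ≤ i ∧ i < b := by
  induction f generalizing n h with
  | nil => simp [yield] at hk'; omega
  | cons w x y z hII hI l r f ihl ihr ih =>
    have hlen := length_cons (hII := hII) (hI := hI) l r f
    rcases lt_trichotomy k (n + l.yield.length) with hkl | rfl | hkl
    · obtain ⟨a, b, hak, hkb, H⟩ := ihl n (some (n + l.yield.length))
        (fun k hk => by cases hk; omega) hk hkl
      refine ⟨a, b, hak, hkb, fun i => (H i).symm.trans ⟨fun e => e.lift id fun _ _ h => .inl h,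
        fun e => (e.of_closed (fun _ _ hj e => edge_left hh hj e) ⟨hk, hkl⟩).1⟩ |>.symm⟩
    · exact ⟨n, n + l.yield.length + 1 + r.yield.length, by omega, by omega, reaches_root hh⟩
    · rcases lt_or_ge k (n + l.yield.length + 1 + r.yield.length) with hkr | hkr
      · obtain ⟨a, b, hak, hkb, H⟩ := ihr (n + l.yield.length + 1) (some (n + l.yield.length))
          (fun k hk => by cases hk; omega) hkl hkr
        exact ⟨a, b, hak, hkb, fun i => (H i).symm.trans
          ⟨fun e => e.lift id fun _ _ h => .inr (.inr (.inl h)),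
            fun e => (e.of_closed (fun _ _ hj e => edge_right hh hj e) ⟨hkl, hkr⟩).1⟩ |>.symm⟩
      · have hkf : k < n + l.yield.length + 1 + r.yield.length + f.yield.length := by omega
        obtain ⟨a, b, hak, hkb, H⟩ := ih (n + l.yield.length + 1 + r.yield.length) h
          (fun k hk => by have := hh k hk; omega) hkr hkf
        exact ⟨a, b, hak, hkb, fun i => (H i).symm.trans
          ⟨fun e => e.lift id fun _ _ h => .inr (.inr (.inr h)),
            fun e => (e.of_closed (fun _ _ hj e => edge_rest hh hj e) ⟨hkr, hkf⟩).1⟩ |>.symm⟩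

theorem edge_acyclic {xs : List B} (f : G.Forest xs) (n : ℕ) (h : Option ℕ)
    (hh : ∀ k, h = some k → k < n ∨ n + f.yield.length ≤ k) (k : ℕ) :
    ¬ TransGen (f.Edge n h) k k := by
  induction f generalizing n h k with
  | nil =>
    intro e
    obtain ⟨_, e, -⟩ := TransGen.head'_iff.1 e
    exact e
  | cons w x y z hII hI l r f ihl ihr ih =>
    have hlen := length_cons (hII := hII) (hI := hI) l r f
    intro e
    obtain ⟨j, e₁, e₂⟩ := TransGen.head'_iff.1 e
    obtain ⟨hk, hk', -⟩ := e₁.range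
    rcases lt_trichotomy k (n + l.yield.length) with hkl | rfl | hkl
    · exact ihl n (some (n + l.yield.length)) (fun k hk => by cases hk; omega) k
        (e.of_closed (fun _ _ hj e => edge_left hh hj e) ⟨hk, hkl⟩).1
    · rcases e₁ with e₁ | ⟨-, rfl⟩ | e₁ | e₁
      · have := e₁.range; omega
      · have := hh j rfl
        rcases ReflTransGen.cases_head e₂ with rfl | ⟨_, e₂, -⟩
        · omega
        · have := e₂.range; omega
      · have := e₁.range; omega
      · have := e₁.range; omega
    · rcases lt_or_ge k (n + l.yield.length + 1 + r.yield.length) with hkr | hkr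
      · exact ihr (n + l.yield.length + 1) (some (n + l.yield.length))
          (fun k hk => by cases hk; omega) k
          (e.of_closed (fun _ _ hj e => edge_right hh hj e) ⟨hkl, hkr⟩).1
      · exact ih (n + l.yield.length + 1 + r.yield.length) h
          (fun k hk => by have := hh k hk; omega) k
          (e.of_closed (fun _ _ hj e => edge_rest hh hj e) ⟨hkr, by omega⟩).1

end DependencyGrammar.Forest

/-! ### The types of the dependents -/

namespace List

open Classical in
/-- The sublist of the entries whose positions satisfy `Q`, where the first position is `n`. -/
noncomputable def select {α : Type*} (Q : ℕ → Prop) : List α → ℕ → List α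
  | [], _ => []
  | a :: L, n => if Q n then a :: select Q L (n + 1) else select Q L (n + 1)

variable {α : Type*} {Q Q' : ℕ → Prop}

theorem select_append (L L' : List α) (n : ℕ) :
    select Q (L ++ L') n = select Q L n ++ select Q L' (n + L.length) := by
  induction L generalizing n with
  | nil => rfl
  | cons a L ih =>
    simp only [cons_append, select, ih, length_cons, Nat.add_right_comm n 1 L.length, Nat.add_assoc]
    split <;> rfl

theorem select_congr {L : List α} {n : ℕ} (h : ∀ j, n ≤ j → j < n + L.length → (Q j ↔ Q' j)) :
    select Q L n = select Q' L n := by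
  induction L generalizing n with
  | nil => rfl
  | cons a L ih =>
    simp only [length_cons] at h
    have h₁ := h n le_rfl (by omega)
    rw [select, select, ih fun j hj hj' => h j (by omega) (by omega)]
    by_cases hQ : Q n
    · rw [if_pos hQ, if_pos (h₁.1 hQ)]
    · rw [if_neg hQ, if_neg (mt h₁.2 hQ)]

theorem select_eq_nil {L : List α} {n : ℕ} (h : ∀ j, n ≤ j → j < n + L.length → ¬ Q j) :
    select Q L n = [] := by
  induction L generalizing n with
  | nil => rfl
  | cons a L ih =>
    simp only [length_cons] at h
    rw [select, if_neg (h n le_rfl (by omega)), ih fun j hj hj' => h j (by omega) (by omega)]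

theorem select_ofFn {N : ℕ} (f : Fin N → α) (n : ℕ) {P : Fin N → Prop} [DecidablePred P]
    (h : ∀ i : Fin N, Q (n + i) ↔ P i) : select Q (ofFn f) n = ((finRange N).filter P).map f := by
  induction N generalizing n with
  | zero => rfl
  | succ N ih =>
    have e : Q n ↔ P 0 := h 0
    rw [ofFn_succ, select, finRange_succ, filter_cons, filter_map,
      ih (fun i => f i.succ) (n + 1) (P := fun i => P i.succ) fun i => by
        rw [← h, Fin.val_succ, Nat.add_right_comm, Nat.add_assoc]]
    simp only [decide_eq_true_eq, e]
    split <;> simp [Function.comp_def]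

end List

namespace DependencyGrammar.Forest

open Relation

variable {V : Type u} {B : Type v} {G : DependencyGrammar V B}

section

variable {w : V} {x : B} {y z xs : List B} {hII : (w, x) ∈ G.typeII} {hI : (x, y, z) ∈ G.typeI}
  {l : G.Forest y} {r : G.Forest z} {f : G.Forest xs} {n : ℕ} {h : Option ℕ}

theorem select_cons (Q : ℕ → Prop) :
    (Forest.cons w x y z hII hI l r f).types.select Q n =
      l.types.select Q n ++ ([x].select Q (n + l.yield.length) ++
        (r.types.select Q (n + l.yield.length + 1) ++
          f.types.select Q (n + l.yield.length + 1 + r.yield.length))) := by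
  rw [types, List.select_append, ← List.singleton_append, List.select_append, List.select_append]
  simp only [length_types, List.length_singleton]

theorem types_cons_get {i : ℕ} {x' : B} :
    (i < l.yield.length ∧ l.types[i]? = some x') ∨ (i = l.yield.length ∧ x = x') ∨
    (∃ i', i = l.yield.length + 1 + i' ∧ i' < r.yield.length ∧ r.types[i']? = some x') ∨
    (∃ i', i = l.yield.length + 1 + r.yield.length + i' ∧ f.types[i']? = some x') →
    (Forest.cons w x y z hII hI l r f).types[i]? = some x' := by
  simp only [types]
  rintro (⟨h, h'⟩ | ⟨rfl, rfl⟩ | ⟨i, rfl, h, h'⟩ | ⟨i, rfl, h⟩)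
  · rw [List.getElem?_append_left (by rw [length_types]; exact h), h']
  · rw [List.getElem?_append_right (by rw [length_types]), length_types]
    simp
  · rw [List.getElem?_append_right (by rw [length_types]; omega), length_types,
      show l.yield.length + 1 + i - l.yield.length = i + 1 by omega, List.getElem?_cons_succ,
      List.getElem?_append_left (by rw [length_types]; exact h), h']
  · rw [List.getElem?_append_right (by rw [length_types]; omega), length_types,
      show l.yield.length + 1 + r.yield.length + i - l.yield.length = r.yield.length + i + 1 by
        omega, List.getElem?_cons_succ, List.getElem?_append_right (by rw [length_types]; omega),
      length_types, Nat.add_sub_cancel_left, h]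

variable {k : ℕ} (c : ℕ → Prop)

theorem select_edge_left (hh : ∀ k, h = some k → k < n ∨
      n + (Forest.cons w x y z hII hI l r f).yield.length ≤ k)
    (hk : n ≤ k) (hk' : k < n + l.yield.length) :
    (Forest.cons w x y z hII hI l r f).types.select
      (fun j => c j ∧ (Forest.cons w x y z hII hI l r f).Edge n h j k) n =
    l.types.select (fun j => c j ∧ l.Edge n (some (n + l.yield.length)) j k) n := by
  have key := fun j => edge_left (hII := hII) (hI := hI) (i := j) hh ⟨hk, hk'⟩
  rw [select_cons, List.select_congr fun j _ _ => and_congr_right fun _ =>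
    ⟨fun e => (key j e).1, .inl⟩, List.select_eq_nil (L := [x]), List.select_eq_nil (L := r.types),
    List.select_eq_nil (L := f.types), List.append_nil]
  · exact List.append_nil _
  all_goals
    rintro j hj hj' ⟨-, e⟩
    have := (key j e).2.2
    omega

theorem select_edge_right (hh : ∀ k, h = some k → k < n ∨
      n + (Forest.cons w x y z hII hI l r f).yield.length ≤ k)
    (hk : n + l.yield.length + 1 ≤ k)
    (hk' : k < n + l.yield.length + 1 + r.yield.length) :
    (Forest.cons w x y z hII hI l r f).types.select
      (fun j => c j ∧ (Forest.cons w x y z hII hI l r f).Edge n h j k) n =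
    r.types.select (fun j => c j ∧ r.Edge (n + l.yield.length + 1) (some (n + l.yield.length)) j k)
      (n + l.yield.length + 1) := by
  have key := fun j => edge_right (hII := hII) (hI := hI) (i := j) hh ⟨hk, hk'⟩
  rw [select_cons, List.select_congr (L := r.types) fun j _ _ => and_congr_right fun _ =>
    ⟨fun e => (key j e).1, fun e => .inr (.inr (.inl e))⟩, List.select_eq_nil (L := [x]),
    List.select_eq_nil (L := l.types), List.select_eq_nil (L := f.types), List.append_nil]
  · rfl
  all_goals
    rintro j hj hj' ⟨-, e⟩
    obtain ⟨h₁, h₂⟩ := (key j e).2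
    simp only [length_types, List.length_singleton] at hj'
    omega

theorem select_edge_rest (hh : ∀ k, h = some k → k < n ∨
      n + (Forest.cons w x y z hII hI l r f).yield.length ≤ k)
    (hk : n + l.yield.length + 1 + r.yield.length ≤ k)
    (hk' : k < n + l.yield.length + 1 + r.yield.length + f.yield.length) :
    (Forest.cons w x y z hII hI l r f).types.select
      (fun j => c j ∧ (Forest.cons w x y z hII hI l r f).Edge n h j k) n =
    f.types.select (fun j => c j ∧ f.Edge (n + l.yield.length + 1 + r.yield.length) h j k)
      (n + l.yield.length + 1 + r.yield.length) := by
  have key := fun j => edge_rest (hII := hII) (hI := hI) (i := j) hh ⟨hk, hk'⟩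
  rw [select_cons, List.select_congr (L := f.types) fun j _ _ => and_congr_right fun _ =>
    ⟨fun e => (key j e).1, fun e => .inr (.inr (.inr e))⟩, List.select_eq_nil (L := [x]),
    List.select_eq_nil (L := l.types), List.select_eq_nil (L := r.types)]
  · rfl
  all_goals
    rintro j hj hj' ⟨-, e⟩
    obtain ⟨h₁, h₂⟩ := (key j e).2
    simp only [length_types, List.length_singleton] at hj'
    omega

end

/-- The roots of a forest are the words which depend on its head. -/
theorem select_head {xs : List B} (f : G.Forest xs) (n k : ℕ)
    (hk : k < n ∨ n + f.yield.length ≤ k) :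
    f.types.select (fun j => f.Edge n (some k) j k) n = xs := by
  induction f generalizing n k with
  | nil => rfl
  | @cons w x y z hII hI l r xs f ihl ihr ih =>
    rw [length_cons] at hk
    have hl : l.types.select
        (fun j => (Forest.cons w x y z hII hI l r f).Edge n (some k) j k) n = [] := by
      refine List.select_eq_nil fun j hj hj' => ?_
      rw [length_types] at hj'
      rintro (e | ⟨e, -⟩ | e | e)
      · have := e.range; simp only [Option.some.injEq] at this; omega
      · omega
      · have := e.range; omega
      · have := e.range; omega
    have hr : r.types.select (fun j => (Forest.cons w x y z hII hI l r f).Edge n (some k) j k)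
        (n + l.yield.length + 1) = [] := by
      refine List.select_eq_nil fun j hj hj' => ?_
      rw [length_types] at hj'
      rintro (e | ⟨e, -⟩ | e | e)
      · have := e.range; omega
      · omega
      · have := e.range; simp only [Option.some.injEq] at this; omega
      · have := e.range; omega
    have hf : f.types.select (fun j => (Forest.cons w x y z hII hI l r f).Edge n (some k) j k)
        (n + l.yield.length + 1 + r.yield.length) = xs := by
      refine (List.select_congr fun j hj hj' => ⟨?_, fun e => .inr (.inr (.inr e))⟩).trans
        (ih _ k (by omega))
      rintro (e | ⟨e, -⟩ | e | e)
      · have := e.range; omega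
      · omega
      · have := e.range; omega
      · exact e
    rw [select_cons, hl, hr, hf]
    simp [List.select, Edge]

theorem select_root_left {w : V} {x : B} {y z xs : List B} {hII : (w, x) ∈ G.typeII}
    {hI : (x, y, z) ∈ G.typeI} (l : G.Forest y) (r : G.Forest z) (f : G.Forest xs) (n : ℕ)
    (h : Option ℕ) :
    (Forest.cons w x y z hII hI l r f).types.select (fun j => j < n + l.yield.length ∧
      (Forest.cons w x y z hII hI l r f).Edge n h j (n + l.yield.length)) n = y := by
  rw [select_cons, List.select_eq_nil (L := [x]) (fun j hj _ h => by omega),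
    List.select_eq_nil (L := r.types) (fun j hj _ h => by omega),
    List.select_eq_nil (L := f.types) (fun j hj _ h => by omega), List.append_nil, List.append_nil,
    List.append_nil]
  refine (List.select_congr fun j hj hj' => ?_).trans
    (l.select_head n (n + l.yield.length) (.inr le_rfl))
  rw [length_types] at hj'
  refine ⟨?_, fun e => ⟨hj', .inl e⟩⟩
  rintro ⟨-, e | ⟨e, -⟩ | e | e⟩
  · exact e
  · omega
  · have := e.range; omega
  · have := e.range; omega

theorem select_root_right {w : V} {x : B} {y z xs : List B} {hII : (w, x) ∈ G.typeII}
    {hI : (x, y, z) ∈ G.typeI} (l : G.Forest y) (r : G.Forest z) (f : G.Forest xs) (n : ℕ)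
    (h : Option ℕ) (hh : ∀ k, h = some k → k < n ∨
      n + (Forest.cons w x y z hII hI l r f).yield.length ≤ k) :
    (Forest.cons w x y z hII hI l r f).types.select (fun j => n + l.yield.length < j ∧
      (Forest.cons w x y z hII hI l r f).Edge n h j (n + l.yield.length)) n = z := by
  have hlen := length_cons (hII := hII) (hI := hI) l r f
  rw [select_cons, List.select_eq_nil (L := [x]) (fun j hj hj' h => by simp at hj'; omega),
    List.select_eq_nil (L := l.types) (fun j hj hj' h => by rw [length_types] at hj'; omega),
    List.select_eq_nil (L := f.types), List.append_nil, List.nil_append, List.nil_append]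
  · refine (List.select_congr fun j hj hj' => ?_).trans
      (r.select_head (n + l.yield.length + 1) (n + l.yield.length) (.inl (by omega)))
    rw [length_types] at hj'
    refine ⟨?_, fun e => ⟨by omega, .inr (.inr (.inl e))⟩⟩
    rintro ⟨-, e | ⟨e, -⟩ | e | e⟩
    · have := e.range; omega
    · omega
    · exact e
    · have := e.range; omega
  · rintro j hj hj' ⟨-, e⟩
    have := (edge_root hh ⟨by omega, by omega⟩ e).2
    omega

/-- The dependents of a position are allowed by a rule of type I. -/
theorem exists_allowed {xs : List B} (f : G.Forest xs) (n : ℕ) (h : Option ℕ)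
    (hh : ∀ k, h = some k → k < n ∨ n + f.yield.length ≤ k) (i : ℕ) (hi : i < f.yield.length) :
    ∃ x, f.types[i]? = some x ∧
      (x, f.types.select (fun j => j < n + i ∧ f.Edge n h j (n + i)) n,
        f.types.select (fun j => n + i < j ∧ f.Edge n h j (n + i)) n) ∈ G.typeI := by
  induction f generalizing n h i with
  | nil => simp [yield] at hi
  | cons w x y z hII hI l r f ihl ihr ih =>
    have hlen := length_cons (hII := hII) (hI := hI) l r f
    rcases lt_trichotomy i l.yield.length with hl | rfl | hl
    · obtain ⟨x', h₁, h₂⟩ := ihl n (some (n + l.yield.length)) (fun k hk => by cases hk; omega) i hl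
      refine ⟨x', types_cons_get (.inl ⟨hl, h₁⟩), ?_⟩
      rwa [select_edge_left _ hh (by omega) (by omega),
        select_edge_left _ hh (by omega) (by omega)]
    · refine ⟨x, types_cons_get (.inr (.inl ⟨rfl, rfl⟩)), ?_⟩
      rwa [select_root_left, select_root_right l r f n h hh]
    · rcases lt_or_ge i (l.yield.length + 1 + r.yield.length) with hr | hr
      · obtain ⟨i, rfl⟩ : ∃ i', i = l.yield.length + 1 + i' := ⟨i - l.yield.length - 1, by omega⟩
        obtain ⟨x', h₁, h₂⟩ := ihr (n + l.yield.length + 1) (some (n + l.yield.length))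
          (fun k hk => by cases hk; omega) i (by omega)
        refine ⟨x', types_cons_get (.inr (.inr (.inl ⟨i, rfl, by omega, h₁⟩))), ?_⟩
        rwa [select_edge_right _ hh (by omega) (by omega),
          select_edge_right _ hh (by omega) (by omega), ← Nat.add_assoc, ← Nat.add_assoc]
      · obtain ⟨i, rfl⟩ : ∃ i', i = l.yield.length + 1 + r.yield.length + i' :=
          ⟨i - l.yield.length - 1 - r.yield.length, by omega⟩
        obtain ⟨x', h₁, h₂⟩ := ih (n + l.yield.length + 1 + r.yield.length) h
          (fun k hk => by have := hh k hk; omega) i (by omega)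
        refine ⟨x', types_cons_get (.inr (.inr (.inr ⟨i, rfl, h₁⟩))), ?_⟩
        rwa [select_edge_rest _ hh (by omega) (by omega),
          select_edge_rest _ hh (by omega) (by omega), ← Nat.add_assoc, ← Nat.add_assoc,
          ← Nat.add_assoc]

/-- The words of a forest have the given types by rules of type II. -/
theorem typed {xs : List B} (f : G.Forest xs) :
    List.Forall₂ (fun w x => (w, x) ∈ G.typeII) f.yield f.types := by
  induction f with
  | nil => exact .nil
  | cons w x y z hII hI l r f ihl ihr ih =>
    exact List.rel_append ihl (.cons hII (List.rel_append ihr ih))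

end DependencyGrammar.Forest

/-! ### The analysis of a dependency tree -/

namespace Relation

/-- Chains which start in `Fin N` and end in it stay below `N`. -/
theorem reflTransGen_fin {N : ℕ} {r : ℕ → ℕ → Prop} (hr : ∀ i j, r i j → i < N) {i k : Fin N} :
    ReflTransGen (fun i j : Fin N => r i j) i k ↔ ReflTransGen r i k := by
  refine ⟨fun h => h.lift Fin.val fun _ _ h => h, fun h => ?_⟩
  suffices H : ∃ hi : i.val < N, ReflTransGen (fun i j : Fin N => r i j) ⟨i, hi⟩ k from H.2
  generalize i.val = a at h
  induction h using ReflTransGen.head_induction_on with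
  | refl => exact ⟨k.2, .refl⟩
  | head hac _ ih => exact ⟨hr _ _ hac, .head hac ih.2⟩

end Relation

namespace DependencyGrammar

open Relation Forest

variable {V : Type u} {B : Type v} {G : DependencyGrammar V B}

/-- The analysis given by a dependency tree. -/
theorem exists_describes {u : List V} (t : G.Tree u) : ∃ a : G.Analysis u, t.Describes a := by
  obtain ⟨x, hx, f, rfl⟩ := t
  have hh : ∀ k, (none : Option ℕ) = some k → k < 0 ∨ 0 + f.yield.length ≤ k := by simp
  have hr : ∀ i j, f.Edge 0 none i j → i < f.yield.length ∧ j < f.yield.length := by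
    intro i j e
    have := e.range
    simp only [reduceCtorEq, false_or] at this
    omega
  have hlen := f.length_types
  let type (i : Fin f.yield.length) : B := f.types[i.val]'(by rw [hlen]; exact i.2)
  have htype : f.types = List.ofFn type := by
    refine List.ext_getElem (by simp [hlen]) fun i h h' => ?_
    simp [type]
  have hget : ∀ i, f.types[i.val]? = some (type i) := fun i => List.getElem?_eq_getElem _
  have key : ∀ i k : Fin f.yield.length, ReflTransGen (fun i j : Fin _ => f.Edge 0 none i j) i k ↔
      ReflTransGen (f.Edge 0 none) i k :=
    fun i k => reflTransGen_fin fun i j e => (hr i j e).1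
  refine ⟨⟨type, fun i j => f.Edge 0 none i j, fun i => ?_, fun i h => ?_, fun i j k h h' => ?_,
    fun i j k h h' => ?_, ?_, fun i => ?_⟩, hget, fun i j => ?_⟩
  · exact f.typed.get i.2 (by rw [hlen]; exact i.2)
  · exact f.edge_acyclic 0 none hh i (h.lift Fin.val fun _ _ h => h)
  · have h₁ := (f.edge_iff 0 none i j).2 (by rwa [Nat.zero_add])
    have h₂ := (f.edge_iff 0 none i k).2 (by rwa [Nat.zero_add])
    exact Fin.ext (Option.some.inj (Option.some.inj (h₁.symm.trans h₂)))
  · obtain ⟨a, b, ha, hb, H⟩ := f.exists_reaches_iff 0 none hh k (Nat.zero_le _)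
      (by rw [Nat.zero_add]; exact k.2)
    rw [key, H] at h' ⊢
    rcases h with ⟨h, h''⟩ | ⟨h, h''⟩ <;> rw [Fin.le_def] at h h'' <;> omega
  · cases f with
    | cons w _ y z hII hI l r f =>
      cases f
      have hN := length_cons (hII := hII) (hI := hI) l r .nil
      rw [show (Forest.nil : G.Forest []).yield.length = 0 from rfl] at hN
      refine ⟨⟨l.yield.length, by omega⟩, fun k => ⟨fun h => ?_, ?_⟩, ?_⟩
      · have h₁ := (reaches_root hh k).2 ⟨Nat.zero_le _, by have := k.2; omega⟩
        rw [Nat.zero_add] at h₁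
        rcases ReflTransGen.cases_head h₁ with h₁ | ⟨j, h₁, -⟩
        · exact Fin.ext h₁
        · exact (h ⟨j, (hr _ _ h₁).2⟩ h₁).elim
      · rintro rfl j (e | ⟨-, e⟩ | e | e)
        · have := e.range
          simp only at this
          omega
        · cases e
        · have := e.range
          simp only at this
          omega
        · exact e
      · have h₁ := hget ⟨l.yield.length, by omega⟩
        rw [types_cons_get (x' := x) (.inr (.inl ⟨rfl, rfl⟩))] at h₁
        rwa [← Option.some.inj h₁]
  · obtain ⟨x, h₁, h₂⟩ := f.exists_allowed 0 none hh i i.2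
    obtain rfl := Option.some.inj ((hget i).symm.trans h₁)
    classical
    rw [htype, List.select_ofFn (P := fun j => j < i ∧ f.Edge 0 none j i),
      List.select_ofFn (P := fun j => i < j ∧ f.Edge 0 none j i)] at h₂
    · convert h₂
    · intro j
      simp only [Nat.zero_add, Fin.lt_def]
    · intro j
      simp only [Nat.zero_add, Fin.lt_def]
  · have := f.edge_iff 0 none i j
    rw [Nat.zero_add] at this
    exact this.symm

theorem Tree.Describes.eq {u : List V} {t : G.Tree u} {a a' : G.Analysis u} (h : t.Describes a)
    (h' : t.Describes a') : a = a' := by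
  ext i j
  · exact Option.some.inj ((h.1 i).symm.trans (h'.1 i))
  · rw [h.2, h'.2]

end DependencyGrammar

/-! ### A dependency tree is determined by its analysis -/

namespace List

theorem eq_of_append_cons_eq {α : Type*} {a : α} {l l' t t' : List α} (h : a ∉ l) (h' : a ∉ l')
    (e : l ++ a :: t = l' ++ a :: t') : l = l' := by
  induction l generalizing l' with
  | nil =>
    cases l' with
    | nil => rfl
    | cons b l' => exact (h' ((cons.inj e).1 ▸ mem_cons_self ..)).elim
  | cons b l ih =>
    cases l' with
    | nil => exact (h ((cons.inj e).1 ▸ mem_cons_self ..)).elim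
    | cons b' l' =>
      obtain ⟨rfl, e'⟩ := cons.inj e
      rw [ih (fun hm => h (mem_cons_of_mem _ hm)) (fun hm => h' (mem_cons_of_mem _ hm)) e']

end List

namespace DependencyGrammar

open Relation Forest

variable {V : Type u} {B : Type v} {G : DependencyGrammar V B}

theorem Forest.notMem_heads {xs : List B} (f : G.Forest xs) (n p : ℕ) {h : Option ℕ}
    (hh : ∀ k, h = some k → k ≠ p ∧ ¬(n ≤ k ∧ k < n + f.yield.length)) :
    h ∉ f.heads n (some p) := by
  intro hmem
  obtain ⟨i, hi, e⟩ := List.getElem_of_mem hmem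
  have e' : (f.heads n (some p))[i]? = some h := by rw [List.getElem?_eq_getElem hi, e]
  rw [length_heads] at hi
  cases h with
  | none =>
    obtain ⟨j, h, -⟩ := TransGen.head'_iff.1 (f.reaches_head n p (n + i) (by omega) (by omega))
    rw [← edge_iff, e'] at h
    cases h
  | some k =>
    have := ((f.edge_iff n (some p) i k).1 e').range
    have := hh k rfl
    simp only [Option.some.injEq] at *
    omega

theorem Forest.edge_eq {xs xs' : List B} {f : G.Forest xs} {f' : G.Forest xs'} {n : ℕ}
    {h : Option ℕ} (H : f.heads n h = f'.heads n h) : f.Edge n h = f'.Edge n h := by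
  ext i j
  rcases lt_or_ge i n with hi | hi
  · exact iff_of_false (fun e => by have := e.range; omega) (fun e => by have := e.range; omega)
  · obtain ⟨i, rfl⟩ := Nat.exists_eq_add_of_le hi
    rw [← edge_iff, ← edge_iff, H]

/-- A forest is determined by its words, their types, and their heads. The equality is
heterogeneous, since the types of the roots are not given. -/
theorem Forest.heq_of_heads {xs xs' : List B} (f : G.Forest xs) (f' : G.Forest xs') (n : ℕ)
    (h : Option ℕ) (hh : ∀ k, h = some k → k < n ∨ n + f.yield.length ≤ k)
    (hy : f.yield = f'.yield) (ht : f.types = f'.types) (hd : f.heads n h = f'.heads n h) :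
    xs = xs' ∧ HEq f f' := by
  induction f generalizing xs' n h with
  | nil =>
    cases f' with
    | nil => exact ⟨rfl, .rfl⟩
    | cons => simp [yield] at hy
  | cons w x y z hII hI l r f ihl ihr ih =>
    cases f' with
    | nil => simp [yield] at hy
    | cons w' x' y' z' hII' hI' l' r' f' =>
      have hN := length_cons (hII := hII) (hI := hI) l r f
      have hN' := length_cons (hII := hII') (hI := hI') l' r' f'
      have hNN := congrArg List.length hy
      have hh' : ∀ k, h = some k → k < n ∨
          n + (Forest.cons w' x' y' z' hII' hI' l' r' f').yield.length ≤ k := hy ▸ hh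
      -- the first root is the first word whose head is `h`
      have h₁ : l.heads n (some (n + l.yield.length)) =
          l'.heads n (some (n + l'.yield.length)) := by
        refine List.eq_of_append_cons_eq (notMem_heads _ _ _ fun k hk => ?_)
          (notMem_heads _ _ _ fun k hk => ?_) hd
        · have := hh k hk
          omega
        · have := hh' k hk
          omega
      have hl : l.yield.length = l'.yield.length := by
        rw [← length_heads l, h₁, length_heads]
      -- the words of its tree are those which reach it
      have hr : r.yield.length = r'.yield.length := by
        have e := edge_eq hd
        have H := reaches_root hh
        have H' := reaches_root hh'
        rw [← e, ← hl] at H'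
        have h₂ := fun i => (H i).symm.trans (H' i)
        have h₃ := h₂ (n + l.yield.length + 1 + r.yield.length)
        have h₄ := h₂ (n + l.yield.length + 1 + r'.yield.length)
        omega
      simp only [yield, types, heads] at hy ht hd
      obtain ⟨hy₁, hy⟩ := List.append_inj hy hl
      obtain ⟨rfl, hy₀⟩ := List.cons.inj hy
      obtain ⟨hy₂, hy₃⟩ := List.append_inj hy₀ hr
      obtain ⟨ht₁, ht⟩ := List.append_inj ht (by rw [length_types, length_types, hl])
      obtain ⟨rfl, ht₀⟩ := List.cons.inj ht
      obtain ⟨ht₂, ht₃⟩ := List.append_inj ht₀ (by rw [length_types, length_types, hr])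
      obtain ⟨hd₁, hd₀⟩ := List.append_inj hd (by rw [length_heads, length_heads, hl])
      obtain ⟨hd₂, hd₃⟩ := List.append_inj (List.cons.inj hd₀).2
        (by rw [length_heads, length_heads, hr])
      rw [← hl] at hd₁ hd₂ hd₃
      rw [← hr] at hd₃
      obtain ⟨rfl, hl⟩ := ihl l' n _ (fun k hk => by cases hk; omega) hy₁ ht₁ hd₁
      obtain ⟨rfl, hr⟩ := ihr r' _ _ (fun k hk => by cases hk; omega) hy₂ ht₂ hd₂
      obtain ⟨rfl, hf⟩ := ih f' _ h (fun k hk => by have := hh k hk; omega) hy₃ ht₃ hd₃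
      obtain rfl := eq_of_heq hl
      obtain rfl := eq_of_heq hr
      obtain rfl := eq_of_heq hf
      exact ⟨rfl, .rfl⟩

theorem Tree.Describes.tree_eq {u : List V} {t t' : G.Tree u} {a : G.Analysis u}
    (h : t.Describes a) (h' : t'.Describes a) : t = t' := by
  obtain ⟨x, hx, f, hf⟩ := t
  obtain ⟨x', hx', f', hf'⟩ := t'
  obtain ⟨h₁, h₂⟩ := h
  obtain ⟨h₁', h₂'⟩ := h'
  simp only at h₁ h₂ h₁' h₂'
  have hlen : f.yield.length = u.length := congrArg List.length hf
  have hlen' : f'.yield.length = u.length := congrArg List.length hf'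
  have hr : ∀ {x} (f : G.Forest [x]) i j, f.Edge 0 none i j → j < f.yield.length := by
    intro x f i j e
    have := e.range
    simp only [reduceCtorEq, false_or] at this
    omega
  have ht : f.types = f'.types := by
    refine List.ext_getElem? fun i => ?_
    rcases lt_or_ge i u.length with hi | hi
    · rw [h₁ ⟨i, hi⟩, h₁' ⟨i, hi⟩]
    · rw [List.getElem?_eq_none (by rw [length_types, hlen]; exact hi),
        List.getElem?_eq_none (by rw [length_types, hlen']; exact hi)]
  have hd : f.heads 0 none = f'.heads 0 none := by
    have key : ∀ i j : ℕ, (f.heads 0 none)[i]? = some (some j) ↔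
        (f'.heads 0 none)[i]? = some (some j) := by
      intro i j
      constructor
      · intro h
        have e := (f.edge_iff 0 none i j).1 h
        have hj := hr f _ _ e
        have hi := e.range
        rw [Nat.zero_add] at hi
        exact (h₂' ⟨i, by omega⟩ ⟨j, by omega⟩).1 ((h₂ ⟨i, by omega⟩ ⟨j, by omega⟩).2 h)
      · intro h
        have e := (f'.edge_iff 0 none i j).1 h
        have hj := hr f' _ _ e
        have hi := e.range
        rw [Nat.zero_add] at hi
        exact (h₂ ⟨i, by omega⟩ ⟨j, by omega⟩).1 ((h₂' ⟨i, by omega⟩ ⟨j, by omega⟩).2 h)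
    refine List.ext_getElem (by rw [length_heads, length_heads, hlen, hlen']) fun i hi hi' => ?_
    have := key i
    rw [List.getElem?_eq_getElem hi, List.getElem?_eq_getElem hi'] at this
    simp only [Option.some.injEq] at this
    exact Option.ext this
  obtain ⟨e, h⟩ := f.heq_of_heads f' 0 none (by simp) (hf.trans hf'.symm) ht hd
  cases e
  obtain rfl := eq_of_heq h
  rfl

end DependencyGrammar

/-! ### Blocks of positions -/

namespace List

variable {α : Type*} {Q : ℕ → Prop}

theorem map_range'_split (f : ℕ → α) {a k c m : ℕ} (h : a ≤ k) (h' : k < c) (h'' : c ≤ a + m) :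
    (range' a m).map f = (range' a (k - a)).map f ++ f k ::
      ((range' (k + 1) (c - (k + 1))).map f ++ (range' c (a + m - c)).map f) := by
  obtain ⟨k, rfl⟩ := Nat.exists_eq_add_of_le h
  obtain ⟨c, rfl⟩ := Nat.exists_eq_add_of_lt h'
  obtain ⟨d, hd⟩ := Nat.exists_eq_add_of_le h''
  obtain rfl : m = k + (1 + (c + d)) := by omega
  rw [← range'_append_1, ← range'_append_1, ← range'_append_1]
  simp only [map_append, range'_one, map_cons, singleton_append]
  rw [show a + k - a = k by omega, show a + k + c + 1 - (a + k + 1) = c by omega,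
    show a + (k + (1 + (c + d))) - (a + k + c + 1) = d by omega,
    show a + k + 1 + c = a + k + c + 1 by omega]

theorem select_range' (f : ℕ → α) {a m N : ℕ} (h : a + m ≤ N) (hQ : ∀ j, Q j → a ≤ j ∧ j < a + m) :
    ((range' 0 N).map f).select Q 0 = ((range' a m).map f).select Q a := by
  obtain ⟨d, rfl⟩ := Nat.exists_eq_add_of_le h
  rw [Nat.add_assoc, ← range'_append_1, ← range'_append_1, map_append, map_append, select_append,
    select_append, select_eq_nil (L := (range' 0 a).map f),
    select_eq_nil (L := (range' (0 + a + m) d).map f)]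
  · simp
  · intro j hj hj' h
    have := hQ j h
    simp at hj
    omega
  · intro j hj hj' h
    have := hQ j h
    simp at hj'
    omega

end List

namespace DependencyGrammar

open Relation Forest

variable {V : Type u} {B : Type v} {G : DependencyGrammar V B}

/-- The interval of the positions from `a` to `b` consists of trees whose roots have the head `h`:
the head of each position is in the interval or is `h`, and no other position depends on a position
in the interval. Here `hd` gives the head of each position. -/
structure IsBlock (hd : ℕ → Option ℕ) (a b : ℕ) (h : Option ℕ) : Prop where
  head : ∀ i, a ≤ i → i < b → hd i = h ∨ ∃ j, hd i = some j ∧ a ≤ j ∧ j < b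
  closed : ∀ i j, hd i = some j → a ≤ j → j < b → a ≤ i ∧ i < b
  outside : ∀ k, h = some k → k < a ∨ b ≤ k

section

variable {hd : ℕ → Option ℕ}

theorem eq_of_reaches (hwf : WellFounded fun j i => hd i = some j) {i j : ℕ}
    (h : ReflTransGen (fun i j => hd i = some j) i j)
    (h' : ReflTransGen (fun i j => hd i = some j) j i) : i = j := by
  rcases reflTransGen_iff_eq_or_transGen.1 h with h₁ | h₁
  · exact h₁.symm
  · have h₂ := transGen_swap.1 (h₁.trans_left h')
    exact (hwf.transGen.irrefl.irrefl _ h₂).elim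

/-- A nonempty block consists of a tree, whose dependents form two blocks, and of another block. -/
theorem IsBlock.exists_split (hwf : WellFounded fun j i => hd i = some j)
    (hpl : ∀ i j k, (i ≤ j ∧ j ≤ k) ∨ (k ≤ j ∧ j ≤ i) →
      ReflTransGen (fun i j => hd i = some j) i k → ReflTransGen (fun i j => hd i = some j) j k)
    {a b : ℕ} {h : Option ℕ} (hb : IsBlock hd a b h) (hab : a < b) :
    ∃ k c, a ≤ k ∧ k < c ∧ c ≤ b ∧ hd k = h ∧ IsBlock hd a k (some k) ∧
      IsBlock hd (k + 1) c (some k) ∧ IsBlock hd c b h ∧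
      ∀ j, hd j = some k → a ≤ j ∧ j < c := by
  -- the root of the tree of the first position
  obtain ⟨k, hak, hkb, hk, hr⟩ : ∃ k, a ≤ k ∧ k < b ∧ hd k = h ∧
      ReflTransGen (fun i j => hd i = some j) a k := by
    have : ∀ i, a ≤ i → i < b → ∃ k, a ≤ k ∧ k < b ∧ hd k = h ∧
        ReflTransGen (fun i j => hd i = some j) i k := by
      intro i
      induction i using hwf.induction with
      | h i ih =>
        intro hi hi'
        rcases hb.head i hi hi' with h₁ | ⟨j, h₁, hj, hj'⟩
        · exact ⟨i, hi, hi', h₁, .refl⟩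
        · obtain ⟨k, hk, hk', h₂, h₃⟩ := ih j h₁ hj hj'
          exact ⟨k, hk, hk', h₂, .head h₁ h₃⟩
    exact this a le_rfl hab
  have hsub : ∀ i, ReflTransGen (fun i j => hd i = some j) i k → a ≤ i ∧ i < b := fun i h =>
    (h.of_closed (r' := fun i j => hd i = some j) (S := Set.Ico a b)
      (fun x y hy e => ⟨e, hb.closed x y e hy.1 hy.2⟩) ⟨hak, hkb⟩).2
  have hex : ∃ c, k < c ∧ ¬ ReflTransGen (fun i j => hd i = some j) c k :=
    ⟨b, hkb, fun h => (hsub b h).2.false⟩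
  -- the words governed by `k` form the interval from `a` to `c`
  obtain ⟨c, hkc, hc⟩ : ∃ c, k < c ∧
      ∀ i, ReflTransGen (fun i j => hd i = some j) i k ↔ a ≤ i ∧ i < c := by
    classical
    refine ⟨Nat.find hex, (Nat.find_spec hex).1, fun i => ⟨fun h => ⟨(hsub i h).1, ?_⟩, ?_⟩⟩
    · by_contra! hi
      exact (Nat.find_spec hex).2 (hpl i _ k (.inr ⟨(Nat.find_spec hex).1.le, hi⟩) h)
    · rintro ⟨hi, hi'⟩
      rcases le_or_gt i k with h | h
      · exact hpl a i k (.inl ⟨hi, h⟩) hr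
      · by_contra h₁
        exact Nat.find_min hex hi' ⟨h, h₁⟩
  have hcb : c ≤ b := by
    by_contra! hcb
    exact ((hsub b ((hc b).2 ⟨by omega, hcb⟩)).2).false
  have anti : ∀ j, j ≠ k → ReflTransGen (fun i j => hd i = some j) j k →
      ¬ ReflTransGen (fun i j => hd i = some j) k j := fun j hj h h' => hj (eq_of_reaches hwf h h')
  have hstep : ∀ i, a ≤ i → i < c → i ≠ k → ∃ j, hd i = some j ∧ a ≤ j ∧ j < c := by
    intro i hi hi' hik
    rcases ReflTransGen.cases_head ((hc i).2 ⟨hi, hi'⟩) with h | ⟨j, hj, h⟩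
    · exact (hik h).elim
    · exact ⟨j, hj, (hc j).1 h⟩
  refine ⟨k, c, hak, hkc, hcb, hk, ⟨?_, ?_, ?_⟩, ⟨?_, ?_, ?_⟩, ⟨?_, ?_, ?_⟩, ?_⟩
  · intro i hi hi'
    obtain ⟨j, h₁, hj, hj'⟩ := hstep i hi (by omega) (by omega)
    rcases lt_trichotomy j k with h₂ | rfl | h₂
    · exact .inr ⟨j, h₁, hj, h₂⟩
    · exact .inl h₁
    · exact (anti j h₂.ne' ((hc j).2 ⟨hj, hj'⟩)
        (hpl i k j (.inl ⟨hi'.le, h₂.le⟩) (.single h₁))).elim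
  · intro i j h₁ hj hj'
    have hjk := (hc j).2 ⟨hj, by omega⟩
    have hi := (hc i).1 (.head h₁ hjk)
    refine ⟨hi.1, ?_⟩
    by_contra! h₂
    exact anti j hj'.ne hjk (hpl i k j (.inr ⟨hj'.le, h₂⟩) (.single h₁))
  · rintro _ ⟨⟩
    exact .inr le_rfl
  · intro i hi hi'
    obtain ⟨j, h₁, hj, hj'⟩ := hstep i (by omega) hi' (by omega)
    rcases lt_trichotomy j k with h₂ | rfl | h₂
    · exact (anti j h₂.ne ((hc j).2 ⟨hj, hj'⟩)
        (hpl i k j (.inr ⟨h₂.le, by omega⟩) (.single h₁))).elim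
    · exact .inl h₁
    · exact .inr ⟨j, h₁, h₂, hj'⟩
  · intro i j h₁ hj hj'
    have hjk := (hc j).2 ⟨by omega, hj'⟩
    have hi := (hc i).1 (.head h₁ hjk)
    refine ⟨?_, hi.2⟩
    by_contra! h₂
    exact anti j (by omega) hjk (hpl i k j (.inl ⟨by omega, by omega⟩) (.single h₁))
  · rintro _ ⟨⟩
    exact .inl (by omega)
  · intro i hi hi'
    rcases hb.head i (by omega) hi' with h₁ | ⟨j, h₁, hj, hj'⟩
    · exact .inl h₁
    · refine .inr ⟨j, h₁, ?_, hj'⟩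
      by_contra! h₂
      have := (hc i).1 (.head h₁ ((hc j).2 ⟨hj, h₂⟩))
      omega
  · intro i j h₁ hj hj'
    have hi := hb.closed i j h₁ (by omega) hj'
    refine ⟨?_, hi.2⟩
    by_contra! h₂
    rcases eq_or_ne i k with rfl | hik
    · have := hb.outside j (hk.symm.trans h₁)
      omega
    · obtain ⟨j', h₃, hj₃⟩ := hstep i hi.1 h₂ hik
      obtain rfl := Option.some.inj (h₁.symm.trans h₃)
      omega
  · intro k' hk'
    have := hb.outside k' hk'
    omega
  · exact fun j h => (hc j).1 (.single h)

variable {wd : ℕ → V} {tp : ℕ → B} {N : ℕ}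

/-- The types of the dependents of `k` are the types of the roots of a forest on a block of head
`k`, when `Q` singles out the dependents of `k` in this block. -/
theorem eq_select {a m k : ℕ} {xs : List B} {f : G.Forest xs}
    (ht : f.types = (List.range' a m).map tp)
    (hh : f.heads a (some k) = (List.range' a m).map hd) (hk : k < a ∨ a + m ≤ k) {Q : ℕ → Prop}
    (ham : a + m ≤ N) (hQ : ∀ j, Q j ↔ (a ≤ j ∧ j < a + m) ∧ hd j = some k) :
    ((List.range' 0 N).map tp).select Q 0 = xs := by
  have hlen : f.yield.length = m := by rw [← length_types, ht]; simp
  rw [List.select_range' tp ham fun j h => ((hQ j).1 h).1, ← ht]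
  refine (List.select_congr fun j hj hj' => ?_).trans (f.select_head a k (hlen ▸ hk))
  rw [length_types, hlen] at hj'
  obtain ⟨j, rfl⟩ := Nat.exists_eq_add_of_le hj
  rw [← edge_iff, hh, List.getElem?_map, List.getElem?_range' (by omega)]
  simp [hQ, hj, hj']

/-- The forest of a block: its first tree is obtained from the blocks of the left and right
dependents of its root, by strong induction on the length. -/
theorem IsBlock.exists_forest (hwf : WellFounded fun j i => hd i = some j)
    (hpl : ∀ i j k, (i ≤ j ∧ j ≤ k) ∨ (k ≤ j ∧ j ≤ i) →
      ReflTransGen (fun i j => hd i = some j) i k → ReflTransGen (fun i j => hd i = some j) j k)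
    (hII : ∀ i, i < N → (wd i, tp i) ∈ G.typeII)
    (hI : ∀ i, i < N → (tp i,
      ((List.range' 0 N).map tp).select (fun j => j < i ∧ hd j = some i) 0,
      ((List.range' 0 N).map tp).select (fun j => i < j ∧ hd j = some i) 0) ∈ G.typeI)
    (m : ℕ) {a : ℕ} {h : Option ℕ} (hb : IsBlock hd a (a + m) h)
    (hN : a + m ≤ N) : ∃ (xs : List B) (f : G.Forest xs), f.yield = (List.range' a m).map wd ∧
      f.types = (List.range' a m).map tp ∧ f.heads a h = (List.range' a m).map hd := by
  induction m using Nat.strong_induction_on generalizing a h with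
  | _ m ih =>
    rcases Nat.eq_zero_or_pos m with rfl | hm
    · exact ⟨[], .nil, rfl, rfl, rfl⟩
    · obtain ⟨k, c, hak, hkc, hcb, hk, hbl, hbr, hbf, hdep⟩ :=
        hb.exists_split hwf hpl (by omega)
      obtain ⟨y, l, hl₁, hl₂, hl₃⟩ := ih (k - a) (by omega)
        (by rwa [show a + (k - a) = k by omega]) (by omega)
      obtain ⟨z, r, hr₁, hr₂, hr₃⟩ := ih (c - (k + 1)) (by omega)
        (by rwa [show k + 1 + (c - (k + 1)) = c by omega]) (by omega)
      obtain ⟨xs, f, hf₁, hf₂, hf₃⟩ := ih (a + m - c) (by omega)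
        (by rwa [show c + (a + m - c) = a + m by omega]) (by omega)
      have hI' := hI k (by omega)
      rw [eq_select hl₂ hl₃ (.inr (by omega)) (by omega) fun j => ?_,
        eq_select hr₂ hr₃ (.inl (by omega)) (by omega) fun j => ?_] at hI'
      · have e₁ : a + l.yield.length = k := by rw [hl₁]; simp; omega
        have e₂ : k + 1 + r.yield.length = c := by rw [hr₁]; simp; omega
        refine ⟨tp k :: xs, .cons (wd k) (tp k) y z (hII k (by omega)) hI' l r f, ?_, ?_, ?_⟩
        · rw [yield, hl₁, hr₁, hf₁, List.map_range'_split wd hak hkc hcb]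
        · rw [Forest.types, hl₂, hr₂, hf₂, List.map_range'_split tp hak hkc hcb]
        · simp only [heads]
          rw [e₁, e₂, hl₃, hr₃, hf₃, List.map_range'_split hd hak hkc hcb, hk]
      · have := hdep j
        constructor
        · rintro ⟨h₁, h₂⟩
          exact ⟨by have := this h₂; omega, h₂⟩
        · rintro ⟨h₁, h₂⟩
          exact ⟨by omega, h₂⟩
      · have := hdep j
        constructor
        · rintro ⟨h₁, h₂⟩
          exact ⟨by have := this h₂; omega, h₂⟩
        · rintro ⟨h₁, h₂⟩
          exact ⟨by omega, h₂⟩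

end

end DependencyGrammar

/-! ### The dependency tree of an analysis -/

namespace DependencyGrammar

open Relation

variable {V : Type u} {B : Type v} {G : DependencyGrammar V B}

/-- The analysis `a` of a string is described by a tree: the string is a single block. -/
theorem exists_tree {u : List V} (a : G.Analysis u) : ∃ t : G.Tree u, t.Describes a := by
  classical
  obtain ⟨h₀, hroot, hIII⟩ := a.rooted
  obtain ⟨hd, hhd⟩ : ∃ hd : ℕ → Option ℕ, ∀ i j, hd i = some j ↔
      ∃ (hi : i < u.length) (hj : j < u.length), a.dep ⟨i, hi⟩ ⟨j, hj⟩ := by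
    have (i : ℕ) : ∃ o : Option ℕ, ∀ j, o = some j ↔
        ∃ (hi : i < u.length) (hj : j < u.length), a.dep ⟨i, hi⟩ ⟨j, hj⟩ := by
      by_cases h : ∃ j, ∃ (hi : i < u.length) (hj : j < u.length), a.dep ⟨i, hi⟩ ⟨j, hj⟩
      · obtain ⟨j, hi, hj, h⟩ := h
        refine ⟨some j, fun k => ⟨?_, ?_⟩⟩
        · rintro ⟨⟩
          exact ⟨hi, hj, h⟩
        · rintro ⟨_, hk, h'⟩
          exact congrArg some (Fin.mk.inj (a.monogamous _ _ _ h h'))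
      · exact ⟨none, fun k => ⟨by simp, fun e => (h ⟨k, e⟩).elim⟩⟩
    choose hd hhd using this
    exact ⟨hd, hhd⟩
  have hlt : ∀ i j, hd i = some j → i < u.length ∧ j < u.length := fun i j h =>
    let ⟨hi, hj, _⟩ := (hhd i j).1 h
    ⟨hi, hj⟩
  have hdep : ∀ i j : Fin u.length, a.dep i j ↔ hd i = some j.val := by
    intro i j
    rw [hhd]
    exact ⟨fun h => ⟨i.2, j.2, h⟩, fun ⟨_, _, h⟩ => h⟩
  have hdep' : a.dep = fun i j : Fin u.length => hd i = some j.val := by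
    ext i j
    exact hdep i j
  -- positions beyond the string get the word and the symbol of the root
  let wd (i : ℕ) : V := if h : i < u.length then u[i] else u[h₀]
  let tp (i : ℕ) : B := if h : i < u.length then a.type ⟨i, h⟩ else a.type h₀
  have hwd : (List.range' 0 u.length).map wd = u :=
    List.ext_getElem (by simp) fun i h h' => by simp [wd, h']
  have htp : (List.range' 0 u.length).map tp = List.ofFn a.type :=
    List.ext_getElem (by simp) fun i h h' => by
      simp only [List.length_ofFn] at h'
      simp [tp, h']
  have hwf : WellFounded fun j i => hd i = some j := by
    have : WellFounded (fun j i => a.dep i j) := by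
      have : IsTrans (Fin u.length) (TransGen fun j i => a.dep i j) := ⟨fun _ _ _ => .trans⟩
      have : Std.Irrefl (TransGen fun j i => a.dep i j) :=
        ⟨fun i h => a.acyclic i (transGen_swap.1 h)⟩
      have h := Finite.wellFounded_of_trans_of_irrefl (TransGen fun j i => a.dep i j)
      exact ⟨fun i => Subrelation.accessible (fun h => .single h) (h.apply i)⟩
    have hacc : ∀ i : Fin u.length, Acc (fun j i => hd i = some j) i.val := fun i => by
      induction i using this.induction with
      | h i ih => exact ⟨_, fun j h => ih ⟨j, (hlt _ _ h).2⟩ ((hdep i ⟨j, (hlt _ _ h).2⟩).2 h)⟩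
    exact ⟨fun i => ⟨_, fun j h => hacc ⟨j, (hlt _ _ h).2⟩⟩⟩
  have hpl : ∀ i j k, (i ≤ j ∧ j ≤ k) ∨ (k ≤ j ∧ j ≤ i) →
      ReflTransGen (fun i j => hd i = some j) i k →
        ReflTransGen (fun i j => hd i = some j) j k := by
    intro i j k h h'
    by_cases hik : i < u.length ∧ k < u.length
    · have := a.planar ⟨i, hik.1⟩ ⟨j, by omega⟩ ⟨k, hik.2⟩ h
      rw [hdep', reflTransGen_fin fun i j h => (hlt i j h).1,
        reflTransGen_fin fun i j h => (hlt i j h).1] at this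
      exact this h'
    · have hik' : i = k := by
        rcases ReflTransGen.cases_head h' with rfl | ⟨j', h₁, -⟩
        · rfl
        · rcases ReflTransGen.cases_tail h' with rfl | ⟨k', -, h₂⟩
          · rfl
          · exact (hik ⟨(hlt _ _ h₁).1, (hlt _ _ h₂).2⟩).elim
      obtain rfl : j = k := by omega
      exact .refl
  have hII : ∀ i, i < u.length → (wd i, tp i) ∈ G.typeII := fun i h => by
    simpa [wd, tp, h] using a.typed ⟨i, h⟩
  have hI : ∀ i, i < u.length → (tp i,
      ((List.range' 0 u.length).map tp).select (fun j => j < i ∧ hd j = some i) 0,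
      ((List.range' 0 u.length).map tp).select (fun j => i < j ∧ hd j = some i) 0) ∈ G.typeI := by
    intro i hi
    rw [htp, List.select_ofFn (P := fun j => j < ⟨i, hi⟩ ∧ a.dep j ⟨i, hi⟩),
      List.select_ofFn (P := fun j => ⟨i, hi⟩ < j ∧ a.dep j ⟨i, hi⟩)]
    · have := a.allowed ⟨i, hi⟩
      simp only [tp, dif_pos hi]
      convert this
    · intro j
      rw [Nat.zero_add, Fin.lt_def, hdep]
    · intro j
      rw [Nat.zero_add, Fin.lt_def, hdep]
  have hnone : ∀ i, i < u.length → (hd i = none ↔ i = h₀) := by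
    intro i hi
    rw [← show (⟨i, hi⟩ : Fin u.length) = h₀ ↔ i = h₀ from Fin.ext_iff, ← hroot,
      Option.eq_none_iff_forall_ne_some]
    exact ⟨fun h j h' => h j ((hdep _ _).1 h'), fun h j h' =>
      h ⟨j, (hlt _ _ h').2⟩ ((hdep ⟨i, hi⟩ ⟨j, _⟩).2 h')⟩
  have hb : IsBlock hd 0 (0 + u.length) none := by
    refine ⟨fun i _ hi => ?_, fun i j h _ _ => ⟨Nat.zero_le _, ?_⟩, by simp⟩
    · rcases h : hd i with _ | j
      · exact .inl rfl
      · exact .inr ⟨j, rfl, Nat.zero_le _, by have := hlt i j h; omega⟩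
    · have := hlt i j h
      omega
  obtain ⟨xs, f, hy, ht, hh⟩ := hb.exists_forest hwf hpl hII hI _ (by omega)
  rw [hwd] at hy
  have hhead : ∀ i, i < u.length → (f.heads 0 none)[i]? = some (hd i) := fun i hi => by
    rw [hh, List.getElem?_map, List.getElem?_range' (by omega)]
    simp
  have htype : ∀ i, i < u.length → f.types[i]? = some (tp i) := fun i hi => by
    rw [ht, List.getElem?_map, List.getElem?_range' (by omega)]
    simp
  cases f with
  | nil =>
    have := h₀.2
    simp [← hy, Forest.yield] at this
  | cons w x y z hx hxyz l r f =>
    have hlen := Forest.length_cons (hII := hx) (hI := hxyz) l r f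
    rw [hy] at hlen
    -- the first root has no head, hence is the root of the analysis
    have h₁ : l.yield.length = h₀ := by
      rw [← hnone _ (by omega)]
      refine Option.some.inj ((hhead _ (by omega)).symm.trans ?_)
      rw [Forest.heads, List.getElem?_append_right (by rw [Forest.length_heads]),
        Forest.length_heads, Nat.sub_self, List.getElem?_cons_zero]
    have h₂ : x = a.type h₀ := by
      have := (htype _ h₀.2).symm.trans (Forest.types_cons_get (.inr (.inl ⟨h₁.symm, rfl⟩)))
      simpa [tp] using this.symm
    cases f with
    | nil =>
      refine ⟨⟨x, h₂ ▸ hIII, _, hy⟩, fun i => ?_, fun i j => ?_⟩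
      · rw [htype i i.2]
        simp [tp]
      · rw [hhead i i.2, hdep, Option.some.injEq]
    -- a second root would have no head either
    | cons w' x' y' z' hx' hxyz' l' r' f' =>
      rw [Forest.length_cons] at hlen
      have h₃ : l.yield.length + (1 + (r.yield.length + l'.yield.length)) = h₀ := by
        rw [← hnone _ (by omega)]
        refine Option.some.inj ((hhead _ (by omega)).symm.trans ?_)
        rw [Forest.heads, List.getElem?_append_right (by rw [Forest.length_heads]; omega),
          Forest.length_heads, Nat.add_sub_cancel_left, Nat.add_comm 1, List.getElem?_cons_succ,
          List.getElem?_append_right (by rw [Forest.length_heads]; omega), Forest.length_heads,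
          Nat.add_sub_cancel_left, Forest.heads,
          List.getElem?_append_right (by rw [Forest.length_heads]), Forest.length_heads,
          Nat.sub_self, List.getElem?_cons_zero]
      omega

end DependencyGrammar

/-! ### Structural equivalence -/

namespace DependencyGrammar

variable {V : Type u} {B B' : Type v} {G : DependencyGrammar V B}

/-- Every analysis is described by exactly one tree, and conversely. -/
theorem exists_equiv_tree (u : List V) :
    ∃ e : G.Analysis u ≃ G.Tree u, ∀ a t, t.Describes a ↔ e a = t := by
  choose tree htree using exists_tree (G := G) (u := u)
  choose analysis hanalysis using exists_describes (G := G) (u := u)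
  exact ⟨⟨tree, analysis, fun a => (hanalysis _).eq (htree a),
    fun t => (htree _).tree_eq (hanalysis t)⟩,
    fun a t => ⟨fun h => (htree a).tree_eq h, fun h => h ▸ htree a⟩⟩

theorem Fresh.structurallyEquivalent {ι : B → B'} {s : B'} (H : G.Fresh ι s) :
    G.StructurallyEquivalent ι s := by
  intro u
  obtain ⟨e, he⟩ := exists_equiv_tree (G := G) u
  refine ⟨e.trans (Equiv.ofBijective _
      ⟨toReduction_injective ι s H.injective, exists_toReduction_eq H⟩),
    e.trans (Equiv.ofBijective _ (toDerivation_bijective H u)), fun a => ?_, fun t => ?_,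
    fun a t h => ?_⟩
  · simp only [he]
    exact ⟨e a, rfl, fun t h => h.symm⟩
  · simp only [he]
    exact ⟨e.symm t, by simp, fun a h => by simp [← h]⟩
  · rw [he] at h
    subst h
    exact ⟨rfl, rfl⟩

theorem fresh_some : G.Fresh (some : B → Option B) none where
  injective := Option.some_injective B
  head := by simp
  left := by simp
  right := by simp
  root := by simp

theorem StartReserved.fresh (h : G.StartReserved) : G.Fresh (id : B → B) G.start where
  injective := Function.injective_id
  head hI := (h.1 _ _ _ hI).1
  left hI _ hb e := (h.1 _ _ _ hI).2.1 (e ▸ hb)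
  right hI _ hb e := (h.1 _ _ _ hI).2.2 (e ▸ hb)
  root _ hx e := h.2 (e ▸ hx)

variable (ι : B → B') (s : B')

theorem isOperadic_pregroup : (G.pregroup ι s).IsOperadic := by
  rintro w t ⟨x, y, z, -, -, h⟩
  exact ⟨y.map ι, ι x, z.map ι, h⟩

theorem isFinite_pregroup [Finite B'] : (G.pregroup ι s).IsFinite :=
  ⟨inferInstance, Set.toFinite _⟩

theorem FiniteRules.finite_lexicon (h : G.FiniteRules) : (G.pregroup ι s).lexicon.Finite := by
  refine ((h.2.1.prod h.1).image fun e : (V × B) × (B × List B × List B) =>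
    (e.1.1, PregroupType.operadic (e.2.2.1.map ι) (ι e.2.1) (e.2.2.2.map ι))).subset ?_
  rintro ⟨w, t⟩ ⟨x, y, z, hII, hI, rfl⟩
  exact ⟨((w, x), (x, y, z)), ⟨hII, hI⟩, rfl⟩

theorem FiniteRules.finite_rules (h : G.FiniteRules) : (G.cfg ι s).rules.Finite := by
  refine (((h.2.1.prod h.1).image fun e : (V × B) × (B × List B × List B) =>
    (⟨ι e.2.1, rhs ι e.2.2.1 e.1.1 e.2.2.2⟩ : ContextFreeRule V B')).union
    (h.2.2.image fun x => (⟨s, [.nonterminal (ι x)]⟩ : ContextFreeRule V B'))).subset ?_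
  rintro _ (⟨w, x, y, z, hII, hI, rfl⟩ | ⟨x, hx, rfl⟩)
  · exact .inl ⟨((w, x), (x, y, z)), ⟨hII, hI⟩, rfl⟩
  · exact .inr ⟨x, hx, rfl⟩

end DependencyGrammar

theorem mainTheorem1 {V : Type u} {B : Type v} (G : DependencyGrammar V B) :
    (G.StructurallyEquivalent (some : B → Option B) none ∧
      (G.pregroup (some : B → Option B) none).IsOperadic ∧
      (Finite B → (G.pregroup (some : B → Option B) none).IsFinite) ∧
      (G.FiniteRules → (G.pregroup (some : B → Option B) none).lexicon.Finite ∧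
        (G.cfg (some : B → Option B) none).rules.Finite)) ∧
    (G.StartReserved →
      G.StructurallyEquivalent (id : B → B) G.start ∧
      (G.pregroup (id : B → B) G.start).IsOperadic ∧
      (Finite B → (G.pregroup (id : B → B) G.start).IsFinite) ∧
      (G.FiniteRules → (G.pregroup (id : B → B) G.start).lexicon.Finite ∧
        (G.cfg (id : B → B) G.start).rules.Finite)) := by
  exact ⟨⟨DependencyGrammar.fresh_some.structurallyEquivalent,
    DependencyGrammar.isOperadic_pregroup _ _,
    fun _ => DependencyGrammar.isFinite_pregroup _ _,
    fun h => ⟨h.finite_lexicon _ _, h.finite_rules _ _⟩⟩,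
    fun hs => ⟨hs.fresh.structurallyEquivalent,
      DependencyGrammar.isOperadic_pregroup _ _,
      fun _ => DependencyGrammar.isFinite_pregroup _ _,
      fun h => ⟨h.finite_lexicon _ _, h.finite_rules _ _⟩⟩⟩
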